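/- Let $n\ge 1$, and let $W=\mathbb{R}^{1,n+2}$ with orthonormal basis $e_-,e_0,e_1,\dots,e_n,e_+$, where $e_-^2=-1$ and the other basis vectors have square $1$. Let $G=\mathrm{SO}(1,n+2)$ be the group of linear isometries of $W$ of determinant one, acting on the projectivised light cone $\mathbb{P}W_0$, $W_0=\{0\ne w\in W: w^2=0\}$, which is identified with the sphere $M=\mathbb{S}^{n+1}\subset e_-^\perp$ by $x\mapsto[e_-+x]$. Put $o=[p]$ with $p=\frac{1}{\sqrt2}(e_-+e_+)$, and $\mathcal{S}_{e_0}=\{[w]\in\mathbb{P}W_0: w\cdot e_0=0\}$. For $l\ge 0$ let $J^l=J^l(n,M)$ be the manifold of $l$-jets $[S]^l_x$ of embedded hypersurfaces $S\subset M$ at points $x\in S$, on which $G$ acts by $g\cdot[S]^l_x=[gS]^l_{gx}$. For $l\ge2$ the projection $J^l\to J^{l-1}$ is an affine bundle; its fibre over the $(l-1)$-jet $[S]_x^{l-1}$ is modelled on $S^lT_x^*S\otimes N_xS$, where $N_xS=T_xM/T_xS$: in a chart $(u,x^1,\dots,x^n)$ in which hypersurfaces are graphs $u=f(x^1,\dots,x^n)$,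 the tensor $v_{i_1\cdots i_l}\,dx^{i_1}\odot\cdots\odot dx^{i_l}\otimes\partial_u$ is added to the $l$-th order derivatives $f_{i_1\cdots i_l}$. For $k\ge2$, a hypersurface $S$ through $o$ is called a fiducial hypersurface of order $k$ for a transitive smooth action of $G$ on $M$ if (i) the orbit $\check J^{k-1}=G\cdot[S]^{k-1}_o$ is open in $J^{k-1}$, and (ii) the orbit $\mathcal R=G\cdot[S]^k_o$ is a proper (smooth) affine sub-bundle of $J^k|_{\check J^{k-1}}$. Then $\mathcal{S}_{e_0}$ is an embedded hypersurface of $M$ through $o$, and: 1. if $n\ge 2$, then $\mathcal{S}_{e_0}$ is a fiducial hypersurface of order $2$ with respect to $G$; 2. $G\cdot[\mathcal{S}_{e_0}]^1_o$ is open in $J^1$, and $\mathcal R=G\cdot[\mathcal{S}_{e_0}]^2_o$ is an affine sub-bundle of rank one of the restriction of $J^2$ to $G\cdot[\mathcal{S}_{e_0}]^1_o$. Its model is the line bundle whose fibre over $[S]^1_x$ is $\mathbb{R}g^0\otimes N_xS\subset S^2T^*_xS\otimes N_xS$, where $g^0$ is the restriction to $T_xS$ of a metric of the conformal class of $M$ induced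 by the scalar product of $W$ (the line does not depend on the choice of the metric). In particular, for $S=\mathcal{S}_{e_0}$ it is $\mathbb{R}g^0\otimes N\mathcal{S}_{e_0}$. -/

import Mathlib

open scoped Manifold ContDiff Topology Pointwise LinearAlgebra.Projectivization

noncomputable section

/-! ### Jets of hypersurfaces of a smooth manifold -/

namespace HypJet

section General

variable {E H : Type*} [NormedAddCommGroup E] [NormedSpace ℝ E] [TopologicalSpace H]

/-- A smooth chart `(u, x) = (u, x¹, …, xⁿ)` of `M`, with values in `ℝ × ℝⁿ`. -/
structure CoordChart (n : ℕ) (I : ModelWithCorners ℝ E H) (M : Type*) [TopologicalSpace M]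
    [ChartedSpace H M] extends OpenPartialHomeomorph M (ℝ × EuclideanSpace ℝ (Fin n)) where
  smooth_toFun : ContMDiffOn I 𝓘(ℝ, ℝ × EuclideanSpace ℝ (Fin n)) ∞
    toOpenPartialHomeomorph toOpenPartialHomeomorph.source
  smooth_symm : ContMDiffOn 𝓘(ℝ, ℝ × EuclideanSpace ℝ (Fin n)) I ∞
    toOpenPartialHomeomorph.symm toOpenPartialHomeomorph.target

variable {n : ℕ} {I : ModelWithCorners ℝ E H} {M : Type*} [TopologicalSpace M] [ChartedSpace H M]

instance : CoeFun (CoordChart n I M) (fun _ => M → ℝ × EuclideanSpace ℝ (Fin n)) where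
  coe φ := φ.toOpenPartialHomeomorph

/-- Near `p`, in the chart `φ = (u, x)`, the set `S` is the graph `u = f(x)` of the locally defined
smooth function `f`. -/
structure IsGraphAt (φ : CoordChart n I M) (S : Set M) (f : EuclideanSpace ℝ (Fin n) → ℝ)
    (p : M) : Prop where
  mem_source : p ∈ φ.source
  smooth : ∀ᶠ y in 𝓝 (φ p).2, ContDiffAt ℝ ∞ f y
  eq_graph : ∀ᶠ q in 𝓝 p, (q ∈ S ↔ (φ q).1 = f (φ q).2)

/-- `S` is an embedded hypersurface: near each of its points it is a graph in some chart. -/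
def IsHypersurface (n : ℕ) (I : ModelWithCorners ℝ E H) {M : Type*} [TopologicalSpace M]
    [ChartedSpace H M] (S : Set M) : Prop :=
  ∀ p ∈ S, ∃ (φ : CoordChart n I M) (f : EuclideanSpace ℝ (Fin n) → ℝ), IsGraphAt φ S f p

/-- An embedded hypersurface together with one of its points. -/
@[ext]
structure PointedHypersurface (n : ℕ) (I : ModelWithCorners ℝ E H) (M : Type*)
    [TopologicalSpace M] [ChartedSpace H M] where
  carrier : Set M
  pt : M
  isHypersurface : IsHypersurface n I carrier
  pt_mem : pt ∈ carrier

/-- `l`-equivalence of hypersurfaces at a common point: in a chart admissible for both, they are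
graphs of functions with the same `l`-jet. -/
def JetRel (l : ℕ) (P Q : PointedHypersurface n I M) : Prop :=
  P.pt = Q.pt ∧ ∃ (φ : CoordChart n I M) (f g : EuclideanSpace ℝ (Fin n) → ℝ),
    IsGraphAt φ P.carrier f P.pt ∧ IsGraphAt φ Q.carrier g P.pt ∧
    ∀ k ≤ l, iteratedFDeriv ℝ k f (φ P.pt).2 = iteratedFDeriv ℝ k g (φ P.pt).2

/-- The space `J^l(n, M)` of `l`-jets of hypersurfaces of `M`, the quotient by `l`-equivalence. -/
def Jet (n : ℕ) (I : ModelWithCorners ℝ E H) (M : Type*) [TopologicalSpace M] [ChartedSpace H M]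
    (l : ℕ) : Type _ :=
  Quot (JetRel (n := n) (I := I) (M := M) l)

namespace Jet

/-- The `l`-jet `[S]^l_p`. -/
def mk (l : ℕ) (P : PointedHypersurface n I M) : Jet n I M l := Quot.mk _ P

/-- The projection `π_{l,m} : J^l → J^m`. -/
def proj {l m : ℕ} (h : m ≤ l) (a : Jet n I M l) : Jet n I M m :=
  Quot.map id (fun _ _ ⟨h₁, φ, f, g, hf, hg, hk⟩ =>
    ⟨h₁, φ, f, g, hf, hg, fun k hkm => hk k (hkm.trans h)⟩) a

end Jet

/-- The symmetric `k`-linear forms on `ℝⁿ`. -/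
def SymForm (n k : ℕ) :
    Submodule ℝ (ContinuousMultilinearMap ℝ (fun _ : Fin k => EuclideanSpace ℝ (Fin n)) ℝ) where
  carrier := {c | ∀ (σ : Equiv.Perm (Fin k)) (v : Fin k → EuclideanSpace ℝ (Fin n)),
    c (v ∘ σ) = c v}
  add_mem' ha hb σ v := by simp [ha σ v, hb σ v]
  zero_mem' σ v := by simp
  smul_mem' t a ha σ v := by simp [ha σ v]

/-- Values of the jet coordinates `(x, u, u_i, u_{ij}, …)` of order at most `l`: a point `x` and,
for each `k ≤ l`, a symmetric `k`-linear form (for `k = 0` this is the value of `u`). -/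
abbrev JetCoord (n l : ℕ) : Type :=
  EuclideanSpace ℝ (Fin n) × ((k : Fin (l + 1)) → SymForm n (k : ℕ))

namespace JetCoord

/-- Forget the coordinates of order greater than `m`. -/
def trunc {l m : ℕ} (h : m ≤ l) (y : JetCoord n l) : JetCoord n m :=
  (y.1, fun k => y.2 ⟨k, k.2.trans_le (Nat.succ_le_succ h)⟩)

/-- The coordinates of highest order. -/
def top {l : ℕ} (y : JetCoord n l) : SymForm n l := y.2 ⟨l, Nat.lt_succ_self l⟩

end JetCoord

/-- The jet `a` lies in the domain of the jet coordinates induced by the chart `φ`, and `y` are its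
coordinates: `a` is the jet of a graph `u = f(x)`, and `y` consists of `x` and the partial
derivatives of `f` at `x`. -/
def Jet.HasCoord {l : ℕ} (a : Jet n I M l) (φ : CoordChart n I M) (y : JetCoord n l) : Prop :=
  ∃ (P : PointedHypersurface n I M) (f : EuclideanSpace ℝ (Fin n) → ℝ),
    Jet.mk l P = a ∧ IsGraphAt φ P.carrier f P.pt ∧ y.1 = (φ P.pt).2 ∧
    ∀ k : Fin (l + 1),
      (y.2 k : ContinuousMultilinearMap ℝ (fun _ : Fin k => EuclideanSpace ℝ (Fin n)) ℝ)
        = iteratedFDeriv ℝ k f y.1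

/-- The manifold topology of `J^l`: a set is open when it is open in all jet coordinates. -/
instance {l : ℕ} : TopologicalSpace (Jet n I M l) where
  IsOpen U := ∀ a ∈ U, ∀ (φ : CoordChart n I M) (y : JetCoord n l), a.HasCoord φ y →
    ∀ᶠ y' in 𝓝 y, ∀ a' : Jet n I M l, a'.HasCoord φ y' → a' ∈ U
  isOpen_univ := fun _ _ _ _ _ => Filter.Eventually.of_forall fun _ _ _ => trivial
  isOpen_inter := fun U V hU hV a ha φ y hy => by
    filter_upwards [hU a ha.1 φ y hy, hV a ha.2 φ y hy] with y' h₁ h₂ a' ha'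
    exact ⟨h₁ a' ha', h₂ a' ha'⟩
  isOpen_sUnion := fun s hs a ⟨U, hU, ha⟩ φ y hy => by
    filter_upwards [hs U hU a ha φ y hy] with y' h a' ha'
    exact ⟨U, hU, h a' ha'⟩

/-! #### Tangent space and normal space of a hypersurface -/

/-- The tangent space `T_p S`: the vectors killed by the differentials of all smooth functions that
vanish on `S` near `p`. -/
def tangentAt (I : ModelWithCorners ℝ E H) {M : Type*} [TopologicalSpace M] [ChartedSpace H M]
    (S : Set M) (p : M) : Submodule ℝ (TangentSpace I p) where
  carrier := {X | ∀ h : M → ℝ, ContMDiffAt I 𝓘(ℝ, ℝ) ∞ h p → (∀ᶠ q in 𝓝 p, q ∈ S → h q = 0) →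
    mfderiv I 𝓘(ℝ, ℝ) h p X = 0}
  add_mem' ha hb h h₁ h₂ := by rw [map_add, ha h h₁ h₂, hb h h₁ h₂, add_zero]
  zero_mem' h _ _ := by rw [map_zero]
  smul_mem' t a ha h h₁ h₂ := by rw [map_smul, ha h h₁ h₂, smul_zero]

/-- In a chart, the tangent space of the graph of `f` is given by `du = df(dx)`. -/
theorem mem_tangentAt_iff {φ : CoordChart n I M} {S : Set M}
    {f : EuclideanSpace ℝ (Fin n) → ℝ} {p : M} (h : IsGraphAt φ S f p) (hp : p ∈ S)
    (X : TangentSpace I p) :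
    X ∈ tangentAt I S p ↔
      (mfderiv I 𝓘(ℝ, ℝ × EuclideanSpace ℝ (Fin n)) φ p X :
          ℝ × EuclideanSpace ℝ (Fin n)).1 =
        fderiv ℝ f (φ p).2 (mfderiv I 𝓘(ℝ, ℝ × EuclideanSpace ℝ (Fin n)) φ p X :
          ℝ × EuclideanSpace ℝ (Fin n)).2 := by
  have hφ : ContMDiffAt I 𝓘(ℝ, ℝ × EuclideanSpace ℝ (Fin n)) ∞ φ p :=
    φ.smooth_toFun.contMDiffAt (φ.open_source.mem_nhds h.mem_source)
  have hφ' : MDifferentiableAt I 𝓘(ℝ, ℝ × EuclideanSpace ℝ (Fin n)) φ p :=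
    hφ.mdifferentiableAt (by simp)
  have hf : ContDiffAt ℝ ∞ f (φ p).2 := h.smooth.self_of_nhds
  have hfd : HasFDerivAt f (fderiv ℝ f (φ p).2) (φ p).2 :=
    (hf.differentiableAt (by simp)).hasFDerivAt
  have hpS : (φ p).1 = f (φ p).2 := h.eq_graph.self_of_nhds.1 hp
  constructor
  · intro hX
    have hG : HasFDerivAt (fun z : ℝ × EuclideanSpace ℝ (Fin n) => z.1 - f z.2)
        (ContinuousLinearMap.fst ℝ ℝ _ -
          (fderiv ℝ f (φ p).2).comp (ContinuousLinearMap.snd ℝ ℝ _)) (φ p) :=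
      hasFDerivAt_fst.sub (HasFDerivAt.comp (φ p) hfd hasFDerivAt_snd)
    have hGs : ContDiffAt ℝ ∞ (fun z : ℝ × EuclideanSpace ℝ (Fin n) => z.1 - f z.2) (φ p) :=
      contDiffAt_fst.sub (ContDiffAt.comp (φ p) hf contDiffAt_snd)
    have h1 := hX ((fun z : ℝ × EuclideanSpace ℝ (Fin n) => z.1 - f z.2) ∘ φ)
      (hGs.contMDiffAt.comp p hφ) (by
        filter_upwards [h.eq_graph] with q hq hqS
        simp [hq.1 hqS])
    rw [mfderiv_comp p hG.differentiableAt.mdifferentiableAt hφ', mfderiv_eq_fderiv,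
      hG.fderiv] at h1
    exact sub_eq_zero.1 h1
  · intro hX k hk hkS
    set F : EuclideanSpace ℝ (Fin n) → ℝ × EuclideanSpace ℝ (Fin n) := fun y => (f y, y) with hF
    have hFx : F (φ p).2 = φ p := by simp [hF, ← hpS]
    have hsymm : φ.symm (φ p) = p := φ.left_inv h.mem_source
    have hs : ContMDiffAt 𝓘(ℝ, ℝ × EuclideanSpace ℝ (Fin n)) I ∞ φ.symm (φ p) :=
      φ.smooth_symm.contMDiffAt (φ.open_target.mem_nhds (φ.map_source h.mem_source))
    have hK : ContMDiffAt 𝓘(ℝ, ℝ × EuclideanSpace ℝ (Fin n)) 𝓘(ℝ, ℝ) ∞ (k ∘ φ.symm) (φ p) :=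
      ContMDiffAt.comp (φ p) (by rw [hsymm]; exact hk) hs
    have hKd : MDifferentiableAt 𝓘(ℝ, ℝ × EuclideanSpace ℝ (Fin n)) 𝓘(ℝ, ℝ) (k ∘ φ.symm) (φ p) :=
      hK.mdifferentiableAt (by simp)
    have hev : k =ᶠ[𝓝 p] (k ∘ φ.symm) ∘ φ := by
      filter_upwards [φ.open_source.mem_nhds h.mem_source] with q hq
      simp [φ.left_inv hq]
    rw [hev.mfderiv_eq, mfderiv_comp p hKd hφ', mfderiv_eq_fderiv]
    have hKf : HasFDerivAt (k ∘ φ.symm) (fderiv ℝ (k ∘ φ.symm) (φ p)) (F (φ p).2) := by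
      rw [hFx]; exact hKd.differentiableAt.hasFDerivAt
    have hFd : HasFDerivAt F ((fderiv ℝ f (φ p).2).prod (ContinuousLinearMap.id ℝ _)) (φ p).2 :=
      hfd.prodMk (hasFDerivAt_id _)
    have hcomp := hKf.comp _ hFd
    have hzero : (k ∘ φ.symm) ∘ F =ᶠ[𝓝 (φ p).2] fun _ => 0 := by
      have hc : Filter.Tendsto (fun y => φ.symm (F y)) (𝓝 (φ p).2) (𝓝 p) := by
        have h2 : ContinuousAt φ.symm (F (φ p).2) := by rw [hFx]; exact hs.continuousAt
        have h3 := ContinuousAt.comp h2 hFd.continuousAt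
        have h4 : φ.symm (F (φ p).2) = p := by rw [hFx, hsymm]
        rw [ContinuousAt, Function.comp_apply, h4] at h3
        exact h3
      have ht : ∀ᶠ y in 𝓝 (φ p).2, F y ∈ φ.target := by
        apply hFd.continuousAt
        rw [hFx]
        exact φ.open_target.mem_nhds (φ.map_source h.mem_source)
      filter_upwards [hc.eventually hkS, hc.eventually h.eq_graph, ht] with y h5 h6 h7
      have h8 : φ (φ.symm (F y)) = F y := φ.right_inv h7
      exact h5 (h6.2 (by rw [h8]))
    have h9 : HasFDerivAt ((k ∘ φ.symm) ∘ F) (0 : EuclideanSpace ℝ (Fin n) →L[ℝ] ℝ) (φ p).2 :=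
      (hasFDerivAt_const (0 : ℝ) _).congr_of_eventuallyEq hzero
    have h10 := DFunLike.congr_fun (hcomp.unique h9)
      (mfderiv I 𝓘(ℝ, ℝ × EuclideanSpace ℝ (Fin n)) φ p X : ℝ × EuclideanSpace ℝ (Fin n)).2
    have h11 : (mfderiv I 𝓘(ℝ, ℝ × EuclideanSpace ℝ (Fin n)) φ p X :
        ℝ × EuclideanSpace ℝ (Fin n)) = (fderiv ℝ f (φ p).2
        (mfderiv I 𝓘(ℝ, ℝ × EuclideanSpace ℝ (Fin n)) φ p X : ℝ × EuclideanSpace ℝ (Fin n)).2,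
        (mfderiv I 𝓘(ℝ, ℝ × EuclideanSpace ℝ (Fin n)) φ p X : ℝ × EuclideanSpace ℝ (Fin n)).2) :=
      Prod.ext hX rfl
    change fderiv ℝ (k ∘ φ.symm) (φ p)
      (mfderiv I 𝓘(ℝ, ℝ × EuclideanSpace ℝ (Fin n)) φ p X : ℝ × EuclideanSpace ℝ (Fin n)) = 0
    rw [h11]
    exact h10

theorem tangentAt_eq_of_jetRel {P Q : PointedHypersurface n I M} (h : JetRel 1 P Q) :
    (⟨P.pt, tangentAt I P.carrier P.pt⟩ : Σ p : M, Submodule ℝ (TangentSpace I p)) =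
      ⟨Q.pt, tangentAt I Q.carrier Q.pt⟩ := by
  obtain ⟨S, p, hS, hp⟩ := P
  obtain ⟨T, q, hT, hq⟩ := Q
  obtain ⟨h₁, φ, f, g, hf, hg, hk⟩ := h
  obtain rfl : p = q := h₁
  simp only at hf hg hk ⊢
  congr 1
  ext X
  rw [mem_tangentAt_iff hf hp, mem_tangentAt_iff hg hq]
  have h1 : fderiv ℝ f (φ p).2 = fderiv ℝ g (φ p).2 := by
    ext v
    have := DFunLike.congr_fun (hk 1 le_rfl) (fun _ => v)
    simpa [iteratedFDeriv_one_apply] using this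
  rw [h1]

namespace Jet

/-- The pair `(p, T_p S)` associated with `[S]^1_p`. -/
def tangentPair (a : Jet n I M 1) : Σ p : M, Submodule ℝ (TangentSpace I p) :=
  Quot.lift (fun P : PointedHypersurface n I M => ⟨P.pt, tangentAt I P.carrier P.pt⟩)
    (fun _ _ h => tangentAt_eq_of_jetRel h) a

/-- The fibre `T_p S` of the tautological bundle at `[S]^1_p`. -/
abbrev tangent (a : Jet n I M 1) : Submodule ℝ (TangentSpace I a.tangentPair.1) :=
  a.tangentPair.2

/-- The fibre `N_p S = T_p M / T_p S` of the normal bundle at `[S]^1_p`. -/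
abbrev normal (a : Jet n I M 1) : Type _ := TangentSpace I a.tangentPair.1 ⧸ a.tangent

/-- The fibre `S^l T_p^* S ⊗ N_p S` at `[S]^1_p`: symmetric `l`-linear maps on `T_p S` with values
in `N_p S`. -/
def SymTensor (a : Jet n I M 1) (l : ℕ) :
    Submodule ℝ (MultilinearMap ℝ (fun _ : Fin l => a.tangent) a.normal) where
  carrier := {v | ∀ (σ : Equiv.Perm (Fin l)) (X : Fin l → a.tangent), v (X ∘ σ) = v X}
  add_mem' ha hb σ X := by simp [ha σ X, hb σ X]
  zero_mem' σ X := by simp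
  smul_mem' t a ha σ X := by simp [ha σ X]

end Jet

/-- The subspace `ℝ g⁰ ⊗ N_p S` of `S² T_p^* S ⊗ N_p S`, where `g⁰` is the restriction to `T_p S` of
the bilinear form `g` on `T_p M`: the maps `(X, Y) ↦ g(X, Y) ν` with `ν ∈ N_p S`. -/
def Jet.formLine (g : ∀ p : M, TangentSpace I p → TangentSpace I p → ℝ) (c : Jet n I M 1) :
    Submodule ℝ (c.SymTensor 2) where
  carrier := {v | ∃ ν : c.normal, ∀ X : Fin 2 → c.tangent,
    v.1 X = g c.tangentPair.1 (X 0).1 (X 1).1 • ν}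
  add_mem' := by
    rintro a b ⟨ν, hν⟩ ⟨μ, hμ⟩
    refine ⟨ν + μ, fun X => ?_⟩
    rw [smul_add, ← hν X, ← hμ X]
    rfl
  zero_mem' := ⟨0, fun X => by rw [smul_zero]; rfl⟩
  smul_mem' := by
    rintro t a ⟨ν, hν⟩
    refine ⟨t • ν, fun X => ?_⟩
    rw [smul_comm, ← hν X]
    rfl

/-- The differential `(du, dx)` of a chart at `p`. -/
abbrev CoordChart.diff (φ : CoordChart n I M) (p : M) :
    TangentSpace I p →L[ℝ] ℝ × EuclideanSpace ℝ (Fin n) :=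
  mfderiv I 𝓘(ℝ, ℝ × EuclideanSpace ℝ (Fin n)) φ p

/-- `b = a + v` for the affine structure of the fibre of `J^k → J^{k-1}` over `c`: in a chart
`(u, x)`, passing from `a` to `b` adds to the derivatives of order `k` the coefficients of `v`. -/
def IsTranslate {k : ℕ} (hk : 2 ≤ k) (c : Jet n I M (k - 1))
    (v : (c.proj (Nat.le_sub_one_of_lt hk)).SymTensor k) (a b : Jet n I M k) : Prop :=
  a.proj (Nat.sub_le k 1) = c ∧ b.proj (Nat.sub_le k 1) = c ∧
  ∃ (φ : CoordChart n I M) (y z : JetCoord n k), a.HasCoord φ y ∧ b.HasCoord φ z ∧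
    ∀ X : Fin k → (c.proj (Nat.le_sub_one_of_lt hk)).tangent,
      ∃ ξ : TangentSpace I (c.proj (Nat.le_sub_one_of_lt hk)).tangentPair.1,
        φ.diff _ ξ = ((z.top - y.top : SymForm n k).1 (fun i => (φ.diff _ (X i).1).2), 0) ∧
        v.1 X = Submodule.Quotient.mk ξ

/-- `A` is a (smooth) affine sub-bundle of rank `d` of the restriction of `J^k → J^{k-1}` to the open
set `U`, modelled on the family of subspaces `R` of the fibres of `S^k T^* ⊗ N`. -/
structure IsAffineSubbundle {k : ℕ} (hk : 2 ≤ k) (U : Set (Jet n I M (k - 1)))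
    (A : Set (Jet n I M k)) (d : ℕ)
    (R : ∀ c : Jet n I M (k - 1),
      Submodule ℝ ((c.proj (Nat.le_sub_one_of_lt hk)).SymTensor k)) : Prop where
  isOpen_base : IsOpen U
  proj_mem : ∀ a ∈ A, a.proj (Nat.sub_le k 1) ∈ U
  exists_mem : ∀ c ∈ U, ∃ a ∈ A, a.proj (Nat.sub_le k 1) = c
  mem_iff : ∀ a ∈ A, ∀ b : Jet n I M k,
    (b ∈ A ∧ b.proj (Nat.sub_le k 1) = a.proj (Nat.sub_le k 1)) ↔
      ∃ v ∈ R (a.proj (Nat.sub_le k 1)), IsTranslate hk (a.proj (Nat.sub_le k 1)) v a b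
  finrank_eq : ∀ c ∈ U, Module.finrank ℝ (R c) = d
  /-- In suitable jet coordinates around each point of `U`, the fibres of `A` are
  `s + span (r₁, …, r_d)` for a smooth section `s` and a smooth frame `r₁, …, r_d`. -/
  smooth : ∀ c ∈ U, ∃ (φ : CoordChart n I M) (O : Set (JetCoord n (k - 1)))
    (s : JetCoord n (k - 1) → SymForm n k) (r : Fin d → JetCoord n (k - 1) → SymForm n k),
    (∃ y ∈ O, c.HasCoord φ y) ∧ IsOpen O ∧ ContDiffOn ℝ ∞ s O ∧ (∀ i, ContDiffOn ℝ ∞ (r i) O) ∧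
    (∀ y ∈ O, LinearIndependent ℝ (fun i => r i y)) ∧
    ∀ (b : Jet n I M k) (z : JetCoord n k), b.HasCoord φ z →
      z.trunc (Nat.sub_le k 1) ∈ O →
      (b ∈ A ↔ ∃ t : Fin d → ℝ, z.top = s (z.trunc (Nat.sub_le k 1)) +
        ∑ i, t i • r i (z.trunc (Nat.sub_le k 1)))

/-! #### Smooth group actions and fiducial hypersurfaces -/

/-- The group `G` acts on `M` by diffeomorphisms. -/
class SmoothAction {E H : Type*} [NormedAddCommGroup E] [NormedSpace ℝ E] [TopologicalSpace H]
    (I : ModelWithCorners ℝ E H) (G M : Type*) [TopologicalSpace M] [ChartedSpace H M] [Group G]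
    [MulAction G M] : Prop where
  contMDiff_smul : ∀ g : G, ContMDiff I I ∞ (fun x : M => g • x)

variable {G : Type*} [Group G] [MulAction G M] [SmoothAction I G M]

/-- The action of `g` as a homeomorphism. -/
def smulHomeo (I : ModelWithCorners ℝ E H) (M : Type*) [TopologicalSpace M] [ChartedSpace H M]
    [MulAction G M] [SmoothAction I G M] (g : G) : M ≃ₜ M where
  toEquiv := MulAction.toPerm g
  continuous_toFun := (SmoothAction.contMDiff_smul (I := I) (M := M) g).continuous
  continuous_invFun := (SmoothAction.contMDiff_smul (I := I) (M := M) g⁻¹).continuous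

/-- The chart `φ ∘ g⁻¹`. -/
def CoordChart.translate (g : G) (φ : CoordChart n I M) : CoordChart n I M where
  toOpenPartialHomeomorph :=
    (smulHomeo I M g⁻¹).toOpenPartialHomeomorph.trans φ.toOpenPartialHomeomorph
  smooth_toFun := by
    refine φ.smooth_toFun.comp
      (SmoothAction.contMDiff_smul (I := I) (M := M) g⁻¹).contMDiffOn ?_
    intro x hx
    simpa [smulHomeo] using hx
  smooth_symm := by
    have h := (SmoothAction.contMDiff_smul (I := I) (M := M) g).comp_contMDiffOn φ.smooth_symm
    have h' : ∀ x : M, ((smulHomeo I M g⁻¹).symm x) = g • x := fun x => by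
      change (g⁻¹)⁻¹ • x = g • x
      rw [inv_inv]
    refine (h.mono ?_).congr ?_
    · intro x hx
      simpa using hx
    · intro x hx
      simp [h']

theorem CoordChart.translate_apply (g : G) (φ : CoordChart n I M) (x : M) :
    φ.translate g x = φ (g⁻¹ • x) := rfl

theorem IsGraphAt.smul {φ : CoordChart n I M} {S : Set M} {f : EuclideanSpace ℝ (Fin n) → ℝ}
    {p : M} (h : IsGraphAt φ S f p) (g : G) : IsGraphAt (φ.translate g) (g • S) f (g • p) where
  mem_source := by
    change _ ∈ ((smulHomeo I M g⁻¹).toOpenPartialHomeomorph.trans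
      φ.toOpenPartialHomeomorph).source
    have h' : smulHomeo I M g⁻¹ (g • p) = p := inv_smul_smul g p
    simpa [h'] using h.mem_source
  smooth := by
    rw [CoordChart.translate_apply, inv_smul_smul]
    exact h.smooth
  eq_graph := by
    have hc : Filter.Tendsto (fun q : M => g⁻¹ • q) (𝓝 (g • p)) (𝓝 p) := by
      have := (SmoothAction.contMDiff_smul (I := I) (M := M) g⁻¹).continuous.tendsto (g • p)
      simpa using this
    filter_upwards [hc.eventually h.eq_graph] with q hq
    rw [CoordChart.translate_apply, Set.mem_smul_set_iff_inv_smul_mem]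
    exact hq

instance : MulAction G (PointedHypersurface n I M) where
  smul g P := {
    carrier := g • P.carrier
    pt := g • P.pt
    isHypersurface := by
      rintro _ ⟨p, hp, rfl⟩
      obtain ⟨φ, f, h⟩ := P.isHypersurface p hp
      exact ⟨φ.translate g, f, h.smul g⟩
    pt_mem := Set.smul_mem_smul_set P.pt_mem }
  one_smul P := PointedHypersurface.ext (one_smul G P.carrier) (one_smul G P.pt)
  mul_smul g h P := PointedHypersurface.ext (mul_smul g h P.carrier) (mul_smul g h P.pt)

/-- The prolonged action of `G` on `J^l`: `g · [S]^l_p = [g S]^l_{g p}`. -/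
instance {l : ℕ} : MulAction G (Jet n I M l) where
  smul g := Quot.map (fun P => g • P) (by
    rintro P Q ⟨h₁, φ, f₁, f₂, hf₁, hf₂, hk⟩
    refine ⟨congrArg (fun x => g • x) h₁, φ.translate g, f₁, f₂, hf₁.smul g, hf₂.smul g, ?_⟩
    intro k hkl
    change iteratedFDeriv ℝ k f₁ (φ.translate g (g • P.pt)).2 =
      iteratedFDeriv ℝ k f₂ (φ.translate g (g • P.pt)).2
    rw [CoordChart.translate_apply, inv_smul_smul]
    exact hk k hkl)
  one_smul := by
    rintro ⟨P⟩
    exact congrArg (Quot.mk _) (one_smul G P)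
  mul_smul := by
    rintro g h ⟨P⟩
    exact congrArg (Quot.mk _) (mul_smul g h P)

/-- The hypersurface `P.carrier` through the point `P.pt` is a fiducial hypersurface of order `k` for
the transitive action of `G` on `M`: the orbit of its `(k-1)`-jet is open in `J^{k-1}`, and the orbit
of its `k`-jet is a proper affine sub-bundle of `J^k` restricted to that open set. -/
structure IsFiducial (G : Type*) [Group G] [MulAction G M] [SmoothAction I G M] (k : ℕ)
    (P : PointedHypersurface n I M) : Prop where
  transitive : MulAction.IsPretransitive G M
  two_le : 2 ≤ k
  isOpen_orbit : IsOpen (MulAction.orbit G (Jet.mk (k - 1) P))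
  affine : ∃ d R, IsAffineSubbundle two_le (MulAction.orbit G (Jet.mk (k - 1) P))
    (MulAction.orbit G (Jet.mk k P)) d R
  proper : ∀ c ∈ MulAction.orbit G (Jet.mk (k - 1) P),
    ∃ b : Jet n I M k, b.proj (Nat.sub_le k 1) = c ∧ b ∉ MulAction.orbit G (Jet.mk k P)

end General
end HypJet

/-! ### The conformal sphere as projectivised light cone -/

namespace ConfSphere

open HypJet

/-- The pseudo-Euclidean space `W = ℝ^{1,n+2}`, with coordinates in the orthonormal basis
`e₋, e₀, e₁, …, e_n, e₊` (in this order). -/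
abbrev W (n : ℕ) : Type := Fin (n + 3) → ℝ

/-- The scalar product of `W`: `e₋` has square `-1`, the other basis vectors have square `1`. -/
def scal {n : ℕ} (v w : W n) : ℝ := -(v 0 * w 0) + ∑ i : Fin (n + 2), v i.succ * w i.succ

/-- The basis vector `e₋`. -/
def eMinus (n : ℕ) : W n := Pi.single 0 1

/-- The basis vector `e₀`. -/
def eZero (n : ℕ) : W n := Pi.single 1 1

/-- The basis vector `e₊`. -/
def ePlus (n : ℕ) : W n := Pi.single (Fin.last (n + 2)) 1

/-- The isotropic vector `p = (e₋ + e₊) / √2`. -/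
def pVec (n : ℕ) : W n := (Real.sqrt 2)⁻¹ • (eMinus n + ePlus n)

theorem scal_smul_smul {n : ℕ} (a : ℝ) (v : W n) : scal (a • v) (a • v) = a ^ 2 * scal v v := by
  simp only [scal, Pi.smul_apply, smul_eq_mul, mul_add, Finset.mul_sum]
  congr 1
  · ring
  · exact Finset.sum_congr rfl fun i _ => by ring

/-- The conformal group `SO(1, n+2)`: matrices of determinant one preserving the scalar product. -/
def SO (n : ℕ) : Subgroup (Matrix.SpecialLinearGroup (Fin (n + 3)) ℝ) where
  carrier := {A | ∀ v w : W n, scal (A • v) (A • w) = scal v w}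
  mul_mem' ha hb v w := by rw [mul_smul, mul_smul, ha, hb]
  one_mem' v w := by rw [one_smul, one_smul]
  inv_mem' {A} ha v w := by
    have h := ha (A⁻¹ • v) (A⁻¹ • w)
    rw [smul_inv_smul, smul_inv_smul] at h
    exact h.symm

/-- The projectivised light cone `ℙ W₀`. -/
def PCone (n : ℕ) : Type := {ℓ : ℙ ℝ (W n) // scal ℓ.rep ℓ.rep = 0}

theorem scal_rep_mk {n : ℕ} (v : W n) (hv : v ≠ 0) (h : scal v v = 0) :
    scal (Projectivization.mk ℝ v hv).rep (Projectivization.mk ℝ v hv).rep = 0 := by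
  obtain ⟨a, ha⟩ := Projectivization.exists_smul_eq_mk_rep ℝ v hv
  rw [← ha, Units.smul_def, scal_smul_smul, h, mul_zero]

/-- The point `[v]` of the projectivised light cone. -/
def PCone.mk {n : ℕ} (v : W n) (hv : v ≠ 0) (h : scal v v = 0) : PCone n :=
  ⟨Projectivization.mk ℝ v hv, scal_rep_mk v hv h⟩

theorem PCone.mk_eq_mk {n : ℕ} {v w : W n} {hv : v ≠ 0} {h : scal v v = 0} {hw : w ≠ 0}
    {h' : scal w w = 0} (a : ℝ) (ha : a • w = v) : PCone.mk v hv h = PCone.mk w hw h' :=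
  Subtype.ext ((Projectivization.mk_eq_mk_iff' ℝ v w hv hw).2 ⟨a, ha⟩)

theorem PCone.ind {n : ℕ} {q : PCone n → Prop} (h : ∀ v hv hs, q (PCone.mk v hv hs)) (ℓ) : q ℓ := by
  obtain ⟨ℓ, hℓ⟩ := ℓ
  have h' : q (PCone.mk ℓ.rep ℓ.rep_nonzero hℓ) := h _ _ _
  have h'' : PCone.mk ℓ.rep ℓ.rep_nonzero hℓ = ⟨ℓ, hℓ⟩ := Subtype.ext ℓ.mk_rep
  rwa [h''] at h'

/-- The linear action of `SO(1, n+2)` on isotropic lines. -/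
instance {n : ℕ} : MulAction (SO n) (PCone n) where
  smul A ℓ := ⟨(A : Matrix.SpecialLinearGroup (Fin (n + 3)) ℝ) • ℓ.1, by
    have h : (A : Matrix.SpecialLinearGroup (Fin (n + 3)) ℝ) • ℓ.1 =
        Projectivization.mk ℝ ((A : Matrix.SpecialLinearGroup (Fin (n + 3)) ℝ) • ℓ.1.rep)
          ((smul_ne_zero_iff_ne _).2 ℓ.1.rep_nonzero) := by
      conv_lhs => rw [← ℓ.1.mk_rep]
      rfl
    rw [h]
    exact scal_rep_mk _ _ (by rw [A.2]; exact ℓ.2)⟩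
  one_smul ℓ := Subtype.ext (one_smul _ ℓ.1)
  mul_smul A B ℓ := Subtype.ext
    (mul_smul (A : Matrix.SpecialLinearGroup (Fin (n + 3)) ℝ) B ℓ.1)

theorem PCone.smul_mk {n : ℕ} (A : SO n) (v : W n) (hv : v ≠ 0) (h : scal v v = 0) :
    A • PCone.mk v hv h =
      PCone.mk ((A : Matrix.SpecialLinearGroup (Fin (n + 3)) ℝ) • v)
        ((smul_ne_zero_iff_ne _).2 hv) (by rw [A.2]; exact h) := rfl

/-- The sphere `S^{n+1}`, as the unit sphere of the Euclidean space `e₋^⊥`. -/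
abbrev Sph (n : ℕ) : Type := Metric.sphere (0 : EuclideanSpace ℝ (Fin (n + 2))) 1

/-- The section `x ↦ e₋ + x` of the light cone over the sphere. -/
def coneLift {n : ℕ} (x : Sph n) : W n := Fin.cons 1 (fun i => x.1 i)

theorem coneLift_ne_zero {n : ℕ} (x : Sph n) : coneLift x ≠ 0 := fun h => by
  have := congrFun h 0
  simp [coneLift] at this

theorem scal_coneLift {n : ℕ} (x : Sph n) : scal (coneLift x) (coneLift x) = 0 := by
  have h : ‖x.1‖ = 1 := by simp
  have h2 := EuclideanSpace.real_norm_sq_eq x.1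
  rw [h] at h2
  simp only [scal, coneLift, Fin.cons_zero, Fin.cons_succ]
  simp only [← pow_two, ← h2]
  norm_num

theorem apply_zero_ne_zero {n : ℕ} {v : W n} (hv : v ≠ 0) (h : scal v v = 0) : v 0 ≠ 0 := by
  intro h0
  apply hv
  simp only [scal, h0, mul_zero, neg_zero, zero_add] at h
  have h1 := (Finset.sum_eq_zero_iff_of_nonneg (fun i _ => mul_self_nonneg (v (Fin.succ i)))).1 h
  funext i
  refine Fin.cases h0 (fun j => ?_) i
  exact mul_self_eq_zero.1 (h1 j (Finset.mem_univ j))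

/-- The unit vector obtained by rescaling an isotropic vector to have `e₋`-coordinate `1`. -/
def unitOf {n : ℕ} (v : W n) (hv : v ≠ 0) (h : scal v v = 0) : Sph n :=
  ⟨WithLp.toLp 2 (fun i => (v 0)⁻¹ * v i.succ), by
    have h0 := apply_zero_ne_zero hv h
    have h2 : ∑ i : Fin (n + 2), v i.succ * v i.succ = v 0 ^ 2 := by
      simp only [scal] at h
      linarith
    rw [mem_sphere_zero_iff_norm, ← sq_eq_sq₀ (norm_nonneg _) zero_le_one,
      EuclideanSpace.real_norm_sq_eq]
    have h3 : ∀ i : Fin (n + 2), ((v 0)⁻¹ * v i.succ) ^ 2 =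
        ((v 0)⁻¹) ^ 2 * (v i.succ * v i.succ) := fun i => by ring
    simp only [h3, ← Finset.mul_sum, h2]
    field_simp⟩

theorem smul_coneLift_unitOf {n : ℕ} (v : W n) (hv : v ≠ 0) (h : scal v v = 0) :
    v 0 • coneLift (unitOf v hv h) = v := by
  have h0 := apply_zero_ne_zero hv h
  funext i
  refine Fin.cases ?_ (fun j => ?_) i
  · simp [coneLift]
  · simp [coneLift, unitOf, h0]

/-- The identification of the sphere with the projectivised light cone, `x ↦ [e₋ + x]`. -/
def coneEquiv (n : ℕ) : Sph n ≃ PCone n where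
  toFun x := PCone.mk (coneLift x) (coneLift_ne_zero x) (scal_coneLift x)
  invFun ℓ := unitOf ℓ.1.rep ℓ.1.rep_nonzero ℓ.2
  left_inv x := by
    obtain ⟨a, ha⟩ := Projectivization.exists_smul_eq_mk_rep ℝ _ (coneLift_ne_zero x)
    apply Subtype.ext
    ext i
    have h1 : ∀ j, (Projectivization.mk ℝ _ (coneLift_ne_zero x)).rep j = a * coneLift x j :=
      fun j => by rw [← ha]; rfl
    simp only [unitOf, PCone.mk, h1]
    simp [coneLift]
  right_inv := by
    rintro ⟨ℓ, hℓ⟩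
    have h : (⟨ℓ, hℓ⟩ : PCone n) = PCone.mk ℓ.rep ℓ.rep_nonzero hℓ := Subtype.ext ℓ.mk_rep.symm
    conv_rhs => rw [h]
    exact (PCone.mk_eq_mk _ (smul_coneLift_unitOf ℓ.rep ℓ.rep_nonzero hℓ)).symm

/-- The action of `SO(1, n+2)` on the sphere, viewed as the projectivised light cone. -/
instance {n : ℕ} : MulAction (SO n) (Sph n) := (coneEquiv n).mulAction (SO n)

theorem smul_eq {n : ℕ} (A : SO n) (x : Sph n) :
    A • x = (coneEquiv n).symm (A • coneEquiv n x) := rfl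

theorem smul_eq_unitOf {n : ℕ} (A : SO n) (x : Sph n) :
    A • x = unitOf ((A : Matrix.SpecialLinearGroup (Fin (n + 3)) ℝ) • coneLift x)
      ((smul_ne_zero_iff_ne _).2 (coneLift_ne_zero x)) (by rw [A.2]; exact scal_coneLift x) := by
  have hv := (smul_ne_zero_iff_ne (A : Matrix.SpecialLinearGroup (Fin (n + 3)) ℝ)).2
    (coneLift_ne_zero x)
  have hs : scal ((A : Matrix.SpecialLinearGroup (Fin (n + 3)) ℝ) • coneLift x)
      ((A : Matrix.SpecialLinearGroup (Fin (n + 3)) ℝ) • coneLift x) = 0 := by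
    rw [A.2]; exact scal_coneLift x
  rw [smul_eq, Equiv.symm_apply_eq]
  have h : A • coneEquiv n x = PCone.mk _ hv hs := rfl
  rw [h]
  exact PCone.mk_eq_mk (hw := coneLift_ne_zero _) (h' := scal_coneLift _) _
    (smul_coneLift_unitOf _ hv hs)

instance {n : ℕ} : Fact (Module.finrank ℝ (EuclideanSpace ℝ (Fin (n + 2))) = n + 1 + 1) :=
  ⟨by simp⟩

theorem contMDiff_coneLift (n : ℕ) : ContMDiff (𝓡 (n + 1)) 𝓘(ℝ, W n) ∞ (coneLift (n := n)) := by
  have h1 : ContDiff ℝ ∞ (fun x : EuclideanSpace ℝ (Fin (n + 2)) =>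
      (Fin.cons 1 (fun i => x i) : W n)) := by
    rw [contDiff_pi]
    intro i
    refine Fin.cases ?_ (fun j => ?_) i
    · simp [contDiff_const]
    · simp only [Fin.cons_succ]
      fun_prop
  exact h1.contMDiff.comp contMDiff_coe_sphere

instance {n : ℕ} : SmoothAction (𝓡 (n + 1)) (SO n) (Sph n) where
  contMDiff_smul A := by
    have h : ContMDiff (𝓡 (n + 1)) 𝓘(ℝ, EuclideanSpace ℝ (Fin (n + 2))) ∞
        (fun x : Sph n => ((A • x : Sph n) : EuclideanSpace ℝ (Fin (n + 2)))) := by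
      intro x
      have h0 := apply_zero_ne_zero ((smul_ne_zero_iff_ne
        (A : Matrix.SpecialLinearGroup (Fin (n + 3)) ℝ)).2 (coneLift_ne_zero x))
        (by rw [A.2]; exact scal_coneLift x)
      have h1 : ContDiffAt ℝ ∞ (fun v : W n => (WithLp.toLp 2 fun i : Fin (n + 2) =>
          (((A : Matrix.SpecialLinearGroup (Fin (n + 3)) ℝ) • v) 0)⁻¹ *
          ((A : Matrix.SpecialLinearGroup (Fin (n + 3)) ℝ) • v) i.succ :
            EuclideanSpace ℝ (Fin (n + 2)))) (coneLift x) := by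
        have h2 : ∀ j, ContDiff ℝ ∞
            (fun v : W n => ((A : Matrix.SpecialLinearGroup (Fin (n + 3)) ℝ) • v) j) := fun j =>
          ((ContinuousLinearMap.proj (R := ℝ) (φ := fun _ : Fin (n + 3) => ℝ) j).comp
            (LinearMap.toContinuousLinearMap (Matrix.toLin' A.1.1))).contDiff
        rw [contDiffAt_euclidean]
        intro i
        exact ((h2 0).contDiffAt.inv h0).mul (h2 i.succ).contDiffAt
      refine (h1.contMDiffAt.comp x (contMDiff_coneLift n x)).congr_of_eventuallyEq ?_
      refine Filter.Eventually.of_forall fun y => ?_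
      simp only [smul_eq_unitOf, unitOf, Function.comp_apply]
    exact ContMDiff.codRestrict_sphere h _

theorem pVec_ne_zero (n : ℕ) : pVec n ≠ 0 := fun h => by
  have h0 := congrFun h 0
  have h1 : (0 : Fin (n + 3)) ≠ Fin.last (n + 2) := (Fin.last_pos).ne
  simp [pVec, eMinus, ePlus, h1] at h0

theorem scal_pVec (n : ℕ) : scal (pVec n) (pVec n) = 0 := by
  rw [pVec, scal_smul_smul]
  have h1 : (0 : Fin (n + 3)) ≠ Fin.last (n + 2) := (Fin.last_pos).ne
  have h2 : ∀ i : Fin (n + 2), (eMinus n + ePlus n) i.succ =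
      if i = Fin.last (n + 1) then 1 else 0 := fun i => by
    simp [eMinus, ePlus, Pi.single_apply, ← Fin.succ_last]
  have h3 : (eMinus n + ePlus n) 0 = 1 := by simp [eMinus, ePlus, h1]
  simp only [scal, h2, h3]
  simp

/-- The origin `o = [p]`. -/
def origin (n : ℕ) : Sph n := (coneEquiv n).symm (PCone.mk (pVec n) (pVec_ne_zero n) (scal_pVec n))

/-- The equatorial sphere `𝒮_{e₀} = ℙ(W₀ ∩ e₀^⊥)`: the isotropic lines orthogonal to `e₀`. -/
def equator (n : ℕ) : Set (Sph n) := {x | scal (coneEquiv n x).1.rep (eZero n) = 0}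

theorem scal_eZero {n : ℕ} (v : W n) : scal v (eZero n) = v 1 := by
  have h : ∀ i : Fin (n + 2), eZero n i.succ = if i = 0 then 1 else 0 := fun i => by
    simp only [eZero, Pi.single_apply, ← Fin.succ_zero_eq_one, Fin.succ_inj]
  have h0 : eZero n 0 = 0 := Pi.single_eq_of_ne (Fin.succ_ne_zero 0).symm 1
  simp [scal, h, h0]

theorem origin_mem_equator (n : ℕ) : origin n ∈ equator n := by
  obtain ⟨a, ha⟩ := Projectivization.exists_smul_eq_mk_rep ℝ (pVec n) (pVec_ne_zero n)
  change scal (coneEquiv n ((coneEquiv n).symm (PCone.mk (pVec n) _ _))).1.rep (eZero n) = 0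
  rw [Equiv.apply_symm_apply]
  change scal (Projectivization.mk ℝ (pVec n) (pVec_ne_zero n)).rep (eZero n) = 0
  have h1 : eMinus n 1 = 0 := Pi.single_eq_of_ne (Fin.succ_ne_zero 0) 1
  have h2 : ePlus n 1 = 0 := by
    refine Pi.single_eq_of_ne ?_ 1
    rw [← Fin.succ_last, ← Fin.succ_zero_eq_one, Ne, Fin.succ_inj]
    exact (Fin.last_pos).ne
  rw [← ha, scal_eZero]
  simp [pVec, h1, h2]

/-- The equatorial sphere together with its point `o`. -/
def pointedEquator (n : ℕ) (h : IsHypersurface n (𝓡 (n + 1)) (equator n)) :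
    PointedHypersurface n (𝓡 (n + 1)) (Sph n) :=
  ⟨equator n, origin n, h, origin_mem_equator n⟩

/-- The differential of the section `coneLift` of the light cone. -/
def diffLift {n : ℕ} (x : Sph n) : TangentSpace (𝓡 (n + 1)) x →L[ℝ] W n :=
  mfderiv (𝓡 (n + 1)) 𝓘(ℝ, W n) coneLift x

/-- A metric of the conformal class of the sphere: the scalar product of `W`, restricted to the
tangent vectors of the section `coneLift` of the light cone (another section rescales it). -/
def metric {n : ℕ} (x : Sph n) (X Y : TangentSpace (𝓡 (n + 1)) x) : ℝ :=
  scal (diffLift x X) (diffLift x Y)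

end ConfSphere

end

/-! The vector of `W` with e₋-coordinate `a` and projection `ε` to e₋^⊥ pairs with e₋ + x to `height
ε a x` = ⟨ε, x⟩ - a. It is spacelike exactly when a² < ‖ε‖², and its orthogonal complement then cuts
out a hypersphere `slice ε a`. Reflections of `W` move any pair (spacelike line, isotropic line
orthogonal to it) to any other, and one more reflection, fixing e₀ and p, corrects the determinant
when n ≥ 1. So the hyperspheres with a marked point form a single orbit, that of the equator with o
(`exists_smul_equator_eq_slice`, `exists_smul_equator`).

Every hypersurface is tangent to a great sphere at each of its points, so the orbit of the 1-jet is
all of J¹ (`orbit_one_eq_univ`). The orbit of the 2-jet consists of the jets with second order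
contact with some hypersphere (`mem_orbit_two_iff`). Contact is expressed without charts: `height ε
a` is o(dist²) along the hypersurface.

The fibres come from the pencil of hyperspheres tangent at a point p. Replacing (ε, a) by (ε + s p,
a + s) changes the height by -(s/2) dist(·, p)², and the squared chordal distance is the metric to
second order. Hence two umbilic 2-jets over one 1-jet differ by a multiple of g⁰, and every multiple
occurs (`exists_sub_eq_of_isUmbilicAt`, `isUmbilicAt_of_sub_eq`).

For smoothness, affine hyperplanes in stereographic coordinates are hyperspheres and the metric is
conformal to the Euclidean one. There the fibre is the line through 0 spanned by δ_ij + u_i u_j, and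
translates of such charts by the group reach every 1-jet. For n ≥ 2 the graph of (x¹)² gives a jet
outside the orbit; for n = 1 every symmetric form is a multiple of g⁰, so properness fails. -/

noncomputable section

open Asymptotics Filter

/-! ### Second order Taylor expansions and their uniqueness. -/

section Taylor

variable {E : Type*} [NormedAddCommGroup E] [NormedSpace ℝ E]

/-- Restricted to a ray, the expression is c + t ℓ(w) + t² q(w) = o(t²), which forces the
coefficients to vanish one after the other. Only homogeneity along rays is used, so ℓ and q need not
be linear or quadratic. -/
theorem homogeneous_eq_zero_of_isLittleO {ℓ q : E → ℝ} {c : ℝ} (y₀ : E)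
    (hℓ : ∀ (t : ℝ) w, ℓ (t • w) = t * ℓ w) (hq : ∀ (t : ℝ) w, q (t • w) = t ^ 2 * q w)
    (h : (fun y => c + ℓ (y - y₀) + q (y - y₀)) =o[𝓝 y₀] fun y => ‖y - y₀‖ ^ 2) :
    c = 0 ∧ ∀ w, ℓ w = 0 ∧ q w = 0 := by
  have hc : c = 0 := by
    have h1 := h.isBigO.eq_zero_of_norm_pow (x₀ := y₀) (by norm_num)
    have hl0 : ℓ 0 = 0 := by simpa using hℓ 0 0
    have hq0 : q 0 = 0 := by simpa using hq 0 0
    simpa [hl0, hq0] using h1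
  subst hc
  refine ⟨rfl, fun w => ?_⟩
  have ht : Tendsto (fun t : ℝ => y₀ + t • w) (𝓝 0) (𝓝 y₀) := by
    have : ContinuousAt (fun t : ℝ => y₀ + t • w) 0 := by fun_prop
    simpa [ContinuousAt] using this
  have h2 := h.comp_tendsto ht
  have h3 : (fun t : ℝ => t * ℓ w + t ^ 2 * q w) =o[𝓝 0] fun t : ℝ => t ^ 2 := by
    have h4 : (fun t : ℝ => t * ℓ w + t ^ 2 * q w) =o[𝓝 0] fun t : ℝ => ‖t • w‖ ^ 2 := by
      simpa [Function.comp_def, hℓ, hq] using h2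
    refine h4.trans_isBigO ?_
    refine IsBigO.of_bound (‖w‖ ^ 2) (Eventually.of_forall fun t => ?_)
    simp [norm_smul, mul_pow]
    linarith [mul_comm (t ^ 2) (‖w‖ ^ 2)]
  have h5 : (fun t : ℝ => t * ℓ w) =o[𝓝 0] fun t : ℝ => t := by
    have h6 : (fun t : ℝ => t ^ 2) =o[𝓝 0] fun t : ℝ => t := by
      simpa using (isLittleO_pow_pow (𝕜 := ℝ) (m := 1) (n := 2) (by norm_num))
    have h7 : (fun t : ℝ => t ^ 2 * q w) =o[𝓝 0] fun t : ℝ => t := by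
      simpa [mul_comm] using h6.const_mul_left (q w)
    simpa using (h3.trans h6).sub h7
  have h8 : ∀ {a : ℝ} {g : ℝ → ℝ}, (∀ t : ℝ, t ≠ 0 → g t ≠ 0) →
      ((fun t : ℝ => g t * a) =o[𝓝 0] fun t : ℝ => g t) → a = 0 := by
    intro a g hg ho
    have h9 := (ho.mono (nhdsWithin_le_nhds (s := {(0 : ℝ)}ᶜ))).tendsto_div_nhds_zero
    refine tendsto_nhds_unique (tendsto_const_nhds.congr' ?_) h9
    filter_upwards [self_mem_nhdsWithin] with t ht
    rw [mul_div_cancel_left₀ _ (hg t ht)]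
  have hℓ0 : ℓ w = 0 := h8 (g := fun t => t) (fun t ht => ht) h5
  refine ⟨hℓ0, h8 (g := fun t => t ^ 2) (fun t ht => pow_ne_zero 2 ht) ?_⟩
  simpa [hℓ0] using h3

/-- The second order Taylor formula. -/
theorem ContDiffAt.taylor_two {f : E → ℝ} {y₀ : E} (hf : ContDiffAt ℝ ∞ f y₀) :
    (fun y => f y - f y₀ - fderiv ℝ f y₀ (y - y₀)
      - 1 / 2 * iteratedFDeriv ℝ 2 f y₀ (fun _ => y - y₀)) =o[𝓝 y₀] fun y => ‖y - y₀‖ ^ 2 := by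
  have hf2 : ContDiffAt ℝ 2 f y₀ := hf.of_le (WithTop.coe_le_coe.2 le_top)
  have hsymm : IsSymmSndFDerivAt ℝ f y₀ := hf2.isSymmSndFDerivAt (by simp)
  obtain ⟨u, hu, hdu⟩ : ∃ u ∈ 𝓝 y₀, ∀ y ∈ u, DifferentiableAt ℝ f y := by
    have h1 := (hf2.of_le one_le_two).eventually (by simp)
    exact ⟨_, h1, fun y (hy : ContDiffAt ℝ 1 f y) => hy.differentiableAt (by simp)⟩
  obtain ⟨r, hr, hru⟩ := Metric.mem_nhds_iff.1 hu
  set B := fderiv ℝ (fderiv ℝ f) y₀ with hB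
  have hd : HasFDerivAt (fderiv ℝ f) B y₀ := by
    have : ContDiffAt ℝ 1 (fderiv ℝ f) y₀ := hf2.fderiv_right (by norm_num)
    exact (this.differentiableAt (by simp)).hasFDerivAt
  -- Mean value inequality on a ball: a remainder whose derivative is o(‖y - y₀‖) is itself o(‖y -
  -- y₀‖²), up to its value at y₀.
  have hmain := Convex.isLittleO_pow_succ (convex_ball y₀ r) (Metric.mem_ball_self hr) (n := 1)
    (f := fun y => f y - fderiv ℝ f y₀ (y - y₀) - 1 / 2 * B (y - y₀) (y - y₀))
    (f' := fun y => fderiv ℝ f y - fderiv ℝ f y₀ - B (y - y₀)) ?_ ?_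
  · rw [nhdsWithin_eq_nhds.2 (Metric.ball_mem_nhds y₀ hr)] at hmain
    refine hmain.congr_left fun y => ?_
    simp only [iteratedFDeriv_two_apply, sub_self, map_zero]
    ring
  · intro y hy
    have h1 := (hdu y (hru hy)).hasFDerivAt
    have h0 : HasFDerivAt (fun y : E => y - y₀) (ContinuousLinearMap.id ℝ E) y :=
      (hasFDerivAt_id y).sub_const y₀
    have h2 := (fderiv ℝ f y₀).hasFDerivAt.comp y h0
    have h3 := ((B.hasFDerivAt.comp y h0).clm_apply h0).const_mul (1 / 2 : ℝ)
    refine (((h1.sub h2).sub h3).congr_fderiv ?_).hasFDerivWithinAt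
    ext v
    simp only [_root_.sub_apply, ContinuousLinearMap.comp_id,
      _root_.smul_apply, _root_.add_apply, smul_eq_mul,
      ContinuousLinearMap.flip_apply]
    -- The product rule yields both B(y - y₀, v) and B(v, y - y₀); symmetry of the second derivative
    -- merges them and cancels the factor 1/2.
    have := hsymm.eq v (y - y₀)
    simp only [Function.comp_apply, ← hB] at this ⊢
    linarith
  · rw [nhdsWithin_eq_nhds.2 (Metric.ball_mem_nhds y₀ hr)]
    simpa using hd.isLittleO.norm_right

/-- Uniqueness of the Taylor expansion. It turns the asymptotic form of contact into equations
between derivatives, of which the second is known on the diagonal only. -/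
theorem ContDiffAt.jet_of_isLittleO {f : E → ℝ} {y₀ : E} (hf : ContDiffAt ℝ ∞ f y₀)
    {ℓ q : E → ℝ} {c : ℝ}
    (hℓ : ∀ (t : ℝ) w, ℓ (t • w) = t * ℓ w) (hq : ∀ (t : ℝ) w, q (t • w) = t ^ 2 * q w)
    (h : (fun y => f y - (c + ℓ (y - y₀) + 1 / 2 * q (y - y₀))) =o[𝓝 y₀] fun y => ‖y - y₀‖ ^ 2) :
    f y₀ = c ∧ (∀ w, fderiv ℝ f y₀ w = ℓ w) ∧
      ∀ w, iteratedFDeriv ℝ 2 f y₀ (fun _ => w) = q w := by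
  have hB : ∀ (t : ℝ) w, iteratedFDeriv ℝ 2 f y₀ (fun _ => t • w) =
      t ^ 2 * iteratedFDeriv ℝ 2 f y₀ (fun _ => w) := fun t w => by
    simp only [iteratedFDeriv_two_apply, map_smul, _root_.smul_apply, smul_eq_mul]
    ring
  have h1 := homogeneous_eq_zero_of_isLittleO y₀ (c := f y₀ - c)
    (ℓ := fun w => fderiv ℝ f y₀ w - ℓ w)
    (q := fun w => 1 / 2 * iteratedFDeriv ℝ 2 f y₀ (fun _ => w) - 1 / 2 * q w)
    (fun t w => by simp only [hℓ, map_smul, smul_eq_mul]; ring)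
    (fun t w => by simp only [hq, hB]; ring)
    ((h.sub hf.taylor_two).congr_left fun y => by ring)
  refine ⟨by linarith [h1.1], fun w => by linarith [(h1.2 w).1], fun w => ?_⟩
  linarith [(h1.2 w).2]

theorem iteratedFDeriv_two_comp_perm {f : E → ℝ} {y₀ : E} (hf : ContDiffAt ℝ ∞ f y₀) {k : ℕ}
    (hk : k ≤ 2) (σ : Equiv.Perm (Fin k)) (v : Fin k → E) :
    iteratedFDeriv ℝ k f y₀ (v ∘ σ) = iteratedFDeriv ℝ k f y₀ v := by
  have hf2 : ContDiffAt ℝ 2 f y₀ := hf.of_le (WithTop.coe_le_coe.2 le_top)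
  have hsymm : IsSymmSndFDerivAt ℝ f y₀ := hf2.isSymmSndFDerivAt (by simp)
  interval_cases k
  · rw [Subsingleton.elim σ 1]; rfl
  · rw [Subsingleton.elim σ 1]; rfl
  · simp only [iteratedFDeriv_two_apply, Function.comp_apply]
    have h01 : σ = 1 ∨ σ = Equiv.swap 0 1 := by decide +revert
    rcases h01 with rfl | rfl
    · rfl
    · simpa using hsymm.eq _ _

end Taylor

/-! ### Charts and the graph parametrization of a hypersurface. -/

namespace HypJet

variable {E H : Type*} [NormedAddCommGroup E] [NormedSpace ℝ E] [TopologicalSpace H]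
  {n : ℕ} {I : ModelWithCorners ℝ E H} {M : Type*} [TopologicalSpace M] [ChartedSpace H M]

namespace CoordChart

variable {φ : CoordChart n I M} {p : M}

theorem contMDiffAt (hp : p ∈ φ.source) :
    ContMDiffAt I 𝓘(ℝ, ℝ × EuclideanSpace ℝ (Fin n)) ∞ φ p :=
  φ.smooth_toFun.contMDiffAt (φ.open_source.mem_nhds hp)

theorem contMDiffAt_symm (hp : p ∈ φ.source) :
    ContMDiffAt 𝓘(ℝ, ℝ × EuclideanSpace ℝ (Fin n)) I ∞ φ.symm (φ p) :=
  φ.smooth_symm.contMDiffAt (φ.open_target.mem_nhds (φ.map_source hp))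

theorem diff_surjective (hp : p ∈ φ.source) : Function.Surjective (φ.diff p) := by
  intro v
  have h1 : MDifferentiableAt I 𝓘(ℝ, ℝ × EuclideanSpace ℝ (Fin n)) φ (φ.symm (φ p)) := by
    rw [φ.left_inv hp]
    exact (contMDiffAt hp).mdifferentiableAt (by simp)
  have h2 := (contMDiffAt_symm hp).mdifferentiableAt (by simp)
  have h3 : φ ∘ φ.symm =ᶠ[𝓝 (φ p)] id := by
    filter_upwards [φ.open_target.mem_nhds (φ.map_source hp)] with z hz
    exact φ.right_inv hz
  have h4 := h3.mfderiv_eq (I := 𝓘(ℝ, ℝ × EuclideanSpace ℝ (Fin n)))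
    (I' := 𝓘(ℝ, ℝ × EuclideanSpace ℝ (Fin n)))
  rw [mfderiv_comp _ h1 h2, mfderiv_id] at h4
  refine ⟨mfderiv 𝓘(ℝ, ℝ × EuclideanSpace ℝ (Fin n)) I φ.symm (φ p) v, ?_⟩
  have h5 := DFunLike.congr_fun h4 v
  have h6 : φ.symm (φ p) = p := φ.left_inv hp
  -- The differentials at `φ.symm (φ p)` and at `p` belong to different base points; substitution
  -- identifies them.
  have h7 : ∀ q, q = p → ∀ w : E, (mfderiv I 𝓘(ℝ, ℝ × EuclideanSpace ℝ (Fin n)) φ q w :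
      ℝ × EuclideanSpace ℝ (Fin n)) = mfderiv I 𝓘(ℝ, ℝ × EuclideanSpace ℝ (Fin n)) φ p w := by
    rintro q rfl w; rfl
  exact (h7 _ h6 _).symm.trans h5

variable {F : Type*} [NormedAddCommGroup F] [NormedSpace ℝ F] {k : M → F}

theorem contDiffAt_comp_symm (hp : p ∈ φ.source) (hk : ContMDiffAt I 𝓘(ℝ, F) ∞ k p) :
    ContDiffAt ℝ ∞ (k ∘ φ.symm) (φ p) := by
  refine ContMDiffAt.contDiffAt (ContMDiffAt.comp (φ p) ?_ (contMDiffAt_symm hp))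
  rwa [φ.left_inv hp]

theorem fderiv_comp_symm (hp : p ∈ φ.source) (hk : ContMDiffAt I 𝓘(ℝ, F) ∞ k p)
    (X : TangentSpace I p) :
    fderiv ℝ (k ∘ φ.symm) (φ p) (φ.diff p X) = mfderiv I 𝓘(ℝ, F) k p X := by
  have hev : k =ᶠ[𝓝 p] (k ∘ φ.symm) ∘ φ := by
    filter_upwards [φ.open_source.mem_nhds hp] with q hq
    simp [φ.left_inv hq]
  have hK : MDifferentiableAt 𝓘(ℝ, ℝ × EuclideanSpace ℝ (Fin n)) 𝓘(ℝ, F) (k ∘ φ.symm) (φ p) :=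
    ((contDiffAt_comp_symm hp hk).differentiableAt (by simp)).mdifferentiableAt
  rw [hev.mfderiv_eq, mfderiv_comp p hK ((contMDiffAt hp).mdifferentiableAt (by simp)),
    mfderiv_eq_fderiv]
  rfl

/-- The parametrization `y ↦ (f(y), y)` of a graph in a chart. -/
def graphMap (φ : CoordChart n I M) (f : EuclideanSpace ℝ (Fin n) → ℝ)
    (y : EuclideanSpace ℝ (Fin n)) : M := φ.symm (f y, y)

end CoordChart

namespace IsGraphAt

variable {φ : CoordChart n I M} {S : Set M} {f : EuclideanSpace ℝ (Fin n) → ℝ} {p : M}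

theorem apply_eq (h : IsGraphAt φ S f p) (hp : p ∈ S) : (f (φ p).2, (φ p).2) = φ p :=
  Prod.ext (h.eq_graph.self_of_nhds.1 hp).symm rfl

theorem contDiffAt (h : IsGraphAt φ S f p) : ContDiffAt ℝ ∞ f (φ p).2 := h.smooth.self_of_nhds

theorem contDiffAt_graph (h : IsGraphAt φ S f p) :
    ContDiffAt ℝ ∞ (fun y => (f y, y)) (φ p).2 := h.contDiffAt.prodMk contDiffAt_id

theorem hasFDerivAt_graph (h : IsGraphAt φ S f p) :
    HasFDerivAt (fun y => (f y, y)) ((fderiv ℝ f (φ p).2).prod (ContinuousLinearMap.id ℝ _))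
      (φ p).2 :=
  (h.contDiffAt.differentiableAt (by simp)).hasFDerivAt.prodMk (hasFDerivAt_id _)

theorem tendsto_graph (h : IsGraphAt φ S f p) (hp : p ∈ S) :
    Tendsto (fun y => (f y, y)) (𝓝 (φ p).2) (𝓝 (φ p)) := by
  have := h.contDiffAt_graph.continuousAt
  rwa [ContinuousAt, h.apply_eq hp] at this

theorem eventually_apply_graphMap (h : IsGraphAt φ S f p) (hp : p ∈ S) :
    ∀ᶠ y in 𝓝 (φ p).2, φ (φ.graphMap f y) = (f y, y) := by
  filter_upwards [(h.tendsto_graph hp).eventually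
    (φ.open_target.mem_nhds (φ.map_source h.mem_source))] with y hy
  exact φ.right_inv hy

theorem graphMap_apply (h : IsGraphAt φ S f p) (hp : p ∈ S) : φ.graphMap f (φ p).2 = p := by
  rw [CoordChart.graphMap, h.apply_eq hp]
  exact φ.left_inv h.mem_source

theorem tendsto_graphMap_nhds (h : IsGraphAt φ S f p) (hp : p ∈ S) :
    Tendsto (φ.graphMap f) (𝓝 (φ p).2) (𝓝 p) := by
  have h1 := (φ.contMDiffAt_symm h.mem_source).continuousAt
  rw [ContinuousAt, φ.left_inv h.mem_source] at h1
  exact h1.comp (h.tendsto_graph hp)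

theorem tendsto_graphMap (h : IsGraphAt φ S f p) (hp : p ∈ S) :
    Tendsto (φ.graphMap f) (𝓝 (φ p).2) (𝓝[S] p) := by
  refine tendsto_nhdsWithin_iff.2 ⟨h.tendsto_graphMap_nhds hp, ?_⟩
  filter_upwards [(h.tendsto_graphMap_nhds hp).eventually h.eq_graph,
    h.eventually_apply_graphMap hp] with y h1 h2
  exact h1.2 (by rw [h2])

theorem tendsto_snd (h : IsGraphAt φ S f p) :
    Tendsto (fun q => (φ q).2) (𝓝[S] p) (𝓝 (φ p).2) :=
  ((φ.contMDiffAt h.mem_source).continuousAt.snd).mono_left nhdsWithin_le_nhds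

theorem eventually_graphMap_snd (h : IsGraphAt φ S f p) :
    ∀ᶠ q in 𝓝[S] p, φ.graphMap f (φ q).2 = q := by
  filter_upwards [nhdsWithin_le_nhds h.eq_graph, self_mem_nhdsWithin,
    nhdsWithin_le_nhds (φ.open_source.mem_nhds h.mem_source)] with q h1 h2 h3
  rw [CoordChart.graphMap, ← h1.1 h2]
  exact φ.left_inv h3

variable {F : Type*} [NormedAddCommGroup F] [NormedSpace ℝ F] {k : M → F}

theorem contDiffAt_comp_graphMap (h : IsGraphAt φ S f p) (hp : p ∈ S)
    (hk : ContMDiffAt I 𝓘(ℝ, F) ∞ k p) : ContDiffAt ℝ ∞ (k ∘ φ.graphMap f) (φ p).2 := by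
  have h1 := CoordChart.contDiffAt_comp_symm h.mem_source hk
  rw [← h.apply_eq hp] at h1
  exact ContDiffAt.comp (f := fun y => (f y, y)) (φ p).2 h1 h.contDiffAt_graph

theorem hasFDerivAt_comp_graphMap (h : IsGraphAt φ S f p) (hp : p ∈ S)
    (hk : ContMDiffAt I 𝓘(ℝ, F) ∞ k p) :
    HasFDerivAt (k ∘ φ.graphMap f) ((fderiv ℝ (k ∘ φ.symm) (φ p)).comp
      ((fderiv ℝ f (φ p).2).prod (ContinuousLinearMap.id ℝ _))) (φ p).2 := by
  have h1 := ((CoordChart.contDiffAt_comp_symm h.mem_source hk).differentiableAt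
    (by simp)).hasFDerivAt
  exact HasFDerivAt.comp (g := k ∘ φ.symm) (f := fun y => (f y, y)) (φ p).2
    (by rwa [h.apply_eq hp]) h.hasFDerivAt_graph

/-- Variation of a function along two graphs which agree to first order at a point. -/
theorem comp_graphMap_sub_isLittleO {S' : Set M} {f' : EuclideanSpace ℝ (Fin n) → ℝ}
    {k : M → ℝ} (h : IsGraphAt φ S f p) (h' : IsGraphAt φ S' f' p) (hp : p ∈ S)
    (hp' : p ∈ S') (hd : fderiv ℝ f (φ p).2 = fderiv ℝ f' (φ p).2)
    (hk : ContMDiffAt I 𝓘(ℝ, ℝ) ∞ k p) :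
    (fun y => k (φ.graphMap f' y) - k (φ.graphMap f y) -
      fderiv ℝ (k ∘ φ.symm) (φ p) (1, 0) * (1 / 2 *
        (iteratedFDeriv ℝ 2 f' (φ p).2 (fun _ => y - (φ p).2) -
          iteratedFDeriv ℝ 2 f (φ p).2 (fun _ => y - (φ p).2))))
      =o[𝓝 (φ p).2] fun y => ‖y - (φ p).2‖ ^ 2 := by
  set y₀ := (φ p).2 with hy₀
  set K := fderiv ℝ (k ∘ φ.symm) (φ p) with hK
  have h0 : f y₀ = f' y₀ :=
    (h.eq_graph.self_of_nhds.1 hp).symm.trans (h'.eq_graph.self_of_nhds.1 hp')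
  have h1 : (fun y => f' y - f y - 1 / 2 * (iteratedFDeriv ℝ 2 f' y₀ (fun _ => y - y₀) -
      iteratedFDeriv ℝ 2 f y₀ (fun _ => y - y₀))) =o[𝓝 y₀] fun y => ‖y - y₀‖ ^ 2 := by
    refine (h'.contDiffAt.taylor_two.sub h.contDiffAt.taylor_two).congr_left fun y => ?_
    rw [← hy₀, h0, hd]
    ring
  have h2 : (fun y => f' y - f y) =O[𝓝 y₀] fun y => ‖y - y₀‖ ^ 2 := by
    have h3 : (fun y => 1 / 2 * (iteratedFDeriv ℝ 2 f' y₀ (fun _ => y - y₀) -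
      iteratedFDeriv ℝ 2 f y₀ (fun _ => y - y₀))) =O[𝓝 y₀] fun y => ‖y - y₀‖ ^ 2 := by
      refine IsBigO.const_mul_left ?_ _
      refine IsBigO.of_bound ‖iteratedFDeriv ℝ 2 f' y₀ - iteratedFDeriv ℝ 2 f y₀‖
        (Eventually.of_forall fun y => ?_)
      have := (iteratedFDeriv ℝ 2 f' y₀ - iteratedFDeriv ℝ 2 f y₀).le_opNorm (fun _ => y - y₀)
      simpa using this
    simpa using h1.isBigO.add h3
  -- Strict differentiability is needed because both points (f' y, y) and (f y, y) move with y;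
  -- their difference (f' y - f y, 0) is of second order.
  have hs : HasStrictFDerivAt (k ∘ φ.symm) K (φ p) :=
    (CoordChart.contDiffAt_comp_symm h.mem_source hk).hasStrictFDerivAt (by simp)
  have h4 := hs.isLittleO.comp_tendsto ((h'.tendsto_graph hp').prodMk_nhds (h.tendsto_graph hp))
  have h5 : (fun y => k (φ.graphMap f' y) - k (φ.graphMap f y) - K (f' y - f y, 0))
      =o[𝓝 y₀] fun y => ‖y - y₀‖ ^ 2 := by
    refine (h4.congr_left fun y => ?_).trans_isBigO (IsBigO.trans ?_ h2)
    · simp [CoordChart.graphMap, -map_sub]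
    · refine IsBigO.of_bound 1 (Eventually.of_forall fun y => ?_)
      simp [Prod.norm_def]
  have h6 : ∀ a : ℝ, K (a, 0) = K (1, 0) * a := fun a => by
    have : ((a, 0) : ℝ × EuclideanSpace ℝ (Fin n)) = a • (1, 0) := by simp
    rw [this, map_smul, smul_eq_mul, mul_comm]
  refine (h5.add (h1.const_mul_left (K (1, 0)))).congr_left fun y => ?_
  rw [h6]
  ring

end IsGraphAt

end HypJet

/-! ### Adapting the chart: a given function as first coordinate. -/

namespace HypJet

variable {E H : Type*} [NormedAddCommGroup E] [NormedSpace ℝ E] [TopologicalSpace H]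
  {n : ℕ} {I : ModelWithCorners ℝ E H} {M : Type*} [TopologicalSpace M] [ChartedSpace H M]

/-- The differential of (u, x) ↦ (K, x) is block triangular with diagonal entries ∂K/∂u and the
identity. -/
theorem exists_equiv_hasFDerivAt {K : ℝ × EuclideanSpace ℝ (Fin n) → ℝ}
    {z : ℝ × EuclideanSpace ℝ (Fin n)} (hK : DifferentiableAt ℝ K z)
    (h : fderiv ℝ K z (1, 0) ≠ 0) :
    ∃ e : (ℝ × EuclideanSpace ℝ (Fin n)) ≃L[ℝ] (ℝ × EuclideanSpace ℝ (Fin n)),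
      HasFDerivAt (fun z => (K z, z.2))
        (e : (ℝ × EuclideanSpace ℝ (Fin n)) →L[ℝ] (ℝ × EuclideanSpace ℝ (Fin n))) z := by
  set T := (fderiv ℝ K z).prod (ContinuousLinearMap.snd ℝ ℝ (EuclideanSpace ℝ (Fin n))) with hT
  have hinj : Function.Injective
      (T : (ℝ × EuclideanSpace ℝ (Fin n)) →ₗ[ℝ] (ℝ × EuclideanSpace ℝ (Fin n))) := by
    rw [injective_iff_map_eq_zero]
    rintro ⟨a, w⟩ h0
    obtain ⟨h1, rfl⟩ : fderiv ℝ K z (a, w) = 0 ∧ w = 0 := Prod.mk.inj h0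
    have h2 : ((a, 0) : ℝ × EuclideanSpace ℝ (Fin n)) = a • (1, 0) := by simp
    rw [h2, map_smul, smul_eq_mul, mul_eq_zero] at h1
    rw [h1.resolve_right h]
    rfl
  refine ⟨(LinearEquiv.ofInjectiveEndo _ hinj).toContinuousLinearEquiv, ?_⟩
  refine (hK.hasFDerivAt.prodMk hasFDerivAt_snd).congr_fderiv ?_
  exact ContinuousLinearMap.ext fun v => rfl

/-- The first coordinate of a chart may be replaced by any function whose differential is
independent of the differentials of the other coordinates. -/
theorem CoordChart.exists_replace_fst {φ : CoordChart n I M} {p : M} (hp : p ∈ φ.source)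
    {k : M → ℝ} (hk : ContMDiff I 𝓘(ℝ, ℝ) ∞ k)
    (h : fderiv ℝ (k ∘ φ.symm) (φ p) (1, 0) ≠ 0) :
    ∃ ψ : CoordChart n I M, p ∈ ψ.source ∧ ψ.source ⊆ φ.source ∧
      ∀ q ∈ φ.source, ψ q = (k q, (φ q).2) := by
  have hsm : ∀ z ∈ φ.target, ContDiffAt ℝ ∞ (k ∘ φ.symm) z := fun z hz => by
    rw [← φ.right_inv hz]
    exact contDiffAt_comp_symm (φ.map_target hz) (hk _)
  set Φ : ℝ × EuclideanSpace ℝ (Fin n) → ℝ × EuclideanSpace ℝ (Fin n) :=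
    fun z => (k (φ.symm z), z.2) with hΦ
  have hΦs : ∀ z ∈ φ.target, ContDiffAt ℝ ∞ Φ z := fun z hz => (hsm z hz).prodMk contDiffAt_snd
  -- The inverse function theorem gives smoothness of the inverse only at one point. Restricting to
  -- the open set where ∂k/∂u ≠ 0 makes the differential invertible everywhere, hence the inverse
  -- smooth on the whole target.
  set N := φ.target ∩ {z | fderiv ℝ (k ∘ φ.symm) z (1, 0) ≠ 0} with hN
  have hNo : IsOpen N := by
    have hc : ContinuousOn (fun z => fderiv ℝ (k ∘ φ.symm) z (1, 0)) φ.target := by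
      intro z hz
      have h1 : ContDiffAt ℝ 1 (fderiv ℝ (k ∘ φ.symm)) z :=
        (hsm z hz).fderiv_right (WithTop.coe_le_coe.2 le_top)
      exact (h1.continuousAt.clm_apply continuousAt_const).continuousWithinAt
    exact hc.isOpen_inter_preimage φ.open_target (isOpen_compl_singleton (x := (0 : ℝ)))
  have hpN : φ p ∈ N := ⟨φ.map_source hp, h⟩
  have hder : ∀ z ∈ N, ∃ e : (ℝ × EuclideanSpace ℝ (Fin n)) ≃L[ℝ] (ℝ × EuclideanSpace ℝ (Fin n)),
      HasFDerivAt Φ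
        (e : (ℝ × EuclideanSpace ℝ (Fin n)) →L[ℝ] (ℝ × EuclideanSpace ℝ (Fin n))) z :=
    fun z hz => exists_equiv_hasFDerivAt ((hsm z hz.1).differentiableAt (by simp)) hz.2
  obtain ⟨e₀, he₀⟩ := hder _ hpN
  set e := ((hΦs _ hpN.1).toOpenPartialHomeomorph Φ he₀ (by simp)).restrOpen N hNo with he
  have hes : e.source ⊆ N := fun z hz => hz.2
  have hpe : φ p ∈ e.source := ⟨ContDiffAt.mem_toOpenPartialHomeomorph_source _ he₀ _, hpN⟩
  have heΦ : ∀ z, e z = Φ z := fun z => rfl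
  refine ⟨⟨φ.toOpenPartialHomeomorph.trans e, ?_, ?_⟩, ⟨hp, hpe⟩, fun q hq => hq.1, ?_⟩
  · intro q hq
    have h1 : ContMDiffAt I 𝓘(ℝ, ℝ × EuclideanSpace ℝ (Fin n)) ∞ (Φ ∘ φ) q :=
      ((hΦs _ (φ.map_source hq.1)).contMDiffAt).comp q (contMDiffAt hq.1)
    exact h1.contMDiffWithinAt
  · intro z hz
    have hz1 : z ∈ e.target := hz.1
    have hz2 : e.symm z ∈ φ.target := hz.2
    obtain ⟨e₁, he₁⟩ := hder _ (hes (e.map_target hz1))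
    have h1 : ContDiffAt ℝ ∞ e.symm z := e.contDiffAt_symm hz1 he₁ (hΦs _ hz2)
    have h2 : ContMDiffAt 𝓘(ℝ, ℝ × EuclideanSpace ℝ (Fin n)) I ∞ φ.symm (e.symm z) :=
      φ.smooth_symm.contMDiffAt (φ.open_target.mem_nhds hz2)
    exact (h2.comp z h1.contMDiffAt).contMDiffWithinAt
  · intro q hq
    change Φ (φ q) = _
    simp only [hΦ]
    rw [φ.left_inv hq]

namespace IsGraphAt

variable {φ : CoordChart n I M} {S : Set M} {f : EuclideanSpace ℝ (Fin n) → ℝ} {p : M}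

theorem exists_diff_eq (h : IsGraphAt φ S f p) (hp : p ∈ S) (w : EuclideanSpace ℝ (Fin n)) :
    ∃ X ∈ tangentAt I S p, φ.diff p X = (fderiv ℝ f (φ p).2 w, w) := by
  obtain ⟨X, hX⟩ := φ.diff_surjective h.mem_source (fderiv ℝ f (φ p).2 w, w)
  refine ⟨X, (mem_tangentAt_iff h hp X).2 ?_, hX⟩
  exact (congrArg Prod.fst hX).trans (congrArg (fun z => fderiv ℝ f (φ p).2 z.2) hX).symm

theorem diff_eq_of_mem (h : IsGraphAt φ S f p) (hp : p ∈ S) {X : TangentSpace I p}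
    (hX : X ∈ tangentAt I S p) :
    φ.diff p X = (fderiv ℝ f (φ p).2 (φ.diff p X).2, (φ.diff p X).2) :=
  Prod.ext ((mem_tangentAt_iff h hp X).1 hX) rfl

theorem fderiv_eq_of_tangentAt_eq (h : IsGraphAt φ S f p) (hp : p ∈ S) {S' : Set M}
    {f' : EuclideanSpace ℝ (Fin n) → ℝ} (h' : IsGraphAt φ S' f' p) (hp' : p ∈ S')
    (hT : tangentAt I S p = tangentAt I S' p) :
    fderiv ℝ f (φ p).2 = fderiv ℝ f' (φ p).2 := by
  ext w
  obtain ⟨X, hX, hXw⟩ := h.exists_diff_eq hp w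
  rw [hT, mem_tangentAt_iff h' hp'] at hX
  change (φ.diff p X).1 = fderiv ℝ f' (φ p).2 (φ.diff p X).2 at hX
  rwa [hXw] at hX

variable {F : Type*} [NormedAddCommGroup F] [NormedSpace ℝ F]

theorem fderiv_comp_graphMap_eq (h : IsGraphAt φ S f p) (hp : p ∈ S) {k : M → F}
    (hk : ContMDiffAt I 𝓘(ℝ, F) ∞ k p) {X : TangentSpace I p} (hX : X ∈ tangentAt I S p) :
    fderiv ℝ (k ∘ φ.graphMap f) (φ p).2 (φ.diff p X).2 = mfderiv I 𝓘(ℝ, F) k p X := by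
  rw [(h.hasFDerivAt_comp_graphMap hp hk).fderiv, ← φ.fderiv_comp_symm h.mem_source hk,
    h.diff_eq_of_mem hp hX]
  rfl

/-- A covector vanishing on T_pS is a multiple of du - df; the factor is read off on ∂_u. This
allows two such differentials to be compared. -/
theorem mfderiv_eq_mul (h : IsGraphAt φ S f p) (hp : p ∈ S) {k : M → ℝ}
    (hk : ContMDiffAt I 𝓘(ℝ, ℝ) ∞ k p)
    (hT : ∀ X ∈ tangentAt I S p, mfderiv I 𝓘(ℝ, ℝ) k p X = 0) (X : TangentSpace I p) :
    (mfderiv I 𝓘(ℝ, ℝ) k p X : ℝ) =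
      ((φ.diff p X).1 - fderiv ℝ f (φ p).2 (φ.diff p X).2) *
        fderiv ℝ (k ∘ φ.symm) (φ p) (1, 0) := by
  rw [← φ.fderiv_comp_symm h.mem_source hk]
  obtain ⟨Y, hY, hYX⟩ := h.exists_diff_eq hp (φ.diff p X).2
  have h1 := hT Y hY
  rw [← φ.fderiv_comp_symm h.mem_source hk, hYX] at h1
  have h2 : φ.diff p X = ((φ.diff p X).1 - fderiv ℝ f (φ p).2 (φ.diff p X).2) • (1, 0) +
      (fderiv ℝ f (φ p).2 (φ.diff p X).2, (φ.diff p X).2) := by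
    refine Prod.ext ?_ ?_ <;> simp
  conv_lhs => rw [h2, map_add, map_smul, h1]
  exact add_zero (_ : ℝ)

theorem fderiv_comp_symm_ne_zero (h : IsGraphAt φ S f p) (hp : p ∈ S) {k : M → ℝ}
    (hk : ContMDiffAt I 𝓘(ℝ, ℝ) ∞ k p)
    (hT : ∀ X ∈ tangentAt I S p, mfderiv I 𝓘(ℝ, ℝ) k p X = 0)
    (hne : ∃ X, mfderiv I 𝓘(ℝ, ℝ) k p X ≠ 0) :
    fderiv ℝ (k ∘ φ.symm) (φ p) (1, 0) ≠ 0 := by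
  intro h0
  obtain ⟨X, hX⟩ := hne
  apply hX
  have h1 := h.mfderiv_eq_mul hp hk hT X
  rw [h0, mul_zero] at h1
  exact h1

/-- A hypersurface is a graph over the zero set of a function whose differential is nonzero and
vanishes on the tangent space. -/
theorem exists_chart (h : IsGraphAt φ S f p) (hp : p ∈ S) {k : M → ℝ}
    (hk : ContMDiff I 𝓘(ℝ, ℝ) ∞ k)
    (hT : ∀ X ∈ tangentAt I S p, mfderiv I 𝓘(ℝ, ℝ) k p X = 0)
    (hne : ∃ X, mfderiv I 𝓘(ℝ, ℝ) k p X ≠ 0) :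
    ∃ ψ : CoordChart n I M, (ψ p).2 = (φ p).2 ∧
      IsGraphAt ψ {q | k q = 0} (fun _ => 0) p ∧ IsGraphAt ψ S (k ∘ φ.graphMap f) p := by
  obtain ⟨ψ, hpψ, hsub, hψ⟩ := CoordChart.exists_replace_fst h.mem_source hk
    (h.fderiv_comp_symm_ne_zero hp (hk p) hT hne)
  have hψp := hψ p h.mem_source
  have hy : (ψ p).2 = (φ p).2 := by rw [hψp]
  refine ⟨ψ, hy, ⟨hpψ, Eventually.of_forall fun _ => contDiffAt_const, ?_⟩, ⟨hpψ, ?_, ?_⟩⟩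
  · filter_upwards [φ.open_source.mem_nhds h.mem_source] with q hq
    rw [hψ q hq]
  · rw [hy]
    filter_upwards [h.smooth, (h.tendsto_graph hp).eventually
      (φ.open_target.mem_nhds (φ.map_source h.mem_source))] with y h1 h2
    have h3 : ContDiffAt ℝ ∞ (k ∘ φ.symm) (f y, y) := by
      rw [← φ.right_inv h2]
      exact CoordChart.contDiffAt_comp_symm (φ.map_target h2) (hk _)
    exact ContDiffAt.comp (f := fun y => (f y, y)) y h3 (h1.prodMk contDiffAt_id)
  · have h1 : Tendsto (fun q => φ.graphMap f (φ q).2) (𝓝 p) (𝓝 p) :=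
      (h.tendsto_graphMap_nhds hp).comp (φ.contMDiffAt h.mem_source).continuousAt.snd
    have h2 : Tendsto (fun q => (φ q).2) (𝓝 p) (𝓝 (φ p).2) :=
      (φ.contMDiffAt h.mem_source).continuousAt.snd
    filter_upwards [h.eq_graph, φ.open_source.mem_nhds h.mem_source,
      ψ.open_source.mem_nhds hpψ, h1.eventually (ψ.open_source.mem_nhds hpψ),
      h2.eventually (h.eventually_apply_graphMap hp)] with q h3 h4 h5 h6 h7
    rw [hψ q h4, h3]
    constructor
    · intro h8
      change k q = k (φ.symm (f (φ q).2, (φ q).2))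
      rw [← h8]
      exact congrArg k (φ.left_inv h4).symm
    · intro h8
      -- The point of the graph below `q` has the same x-coordinates as `q` and, by `h8`, the same
      -- value of `k`; injectivity of `ψ` then puts `q` on the graph.
      have h9 : ψ (φ.graphMap f (φ q).2) = ψ q := by
        rw [hψ _ (hsub h6), hψ q h4, h7]
        exact Prod.ext h8.symm rfl
      have h10 := ψ.injOn h6 h5 h9
      rw [h10] at h7
      rw [h7]

end IsGraphAt

end HypJet

/-! ### The round metric, hyperspheres and chordal distance on the sphere. -/

namespace ConfSphere

open HypJet

variable {n : ℕ}

/-- The differential of the inclusion of the sphere in Euclidean space. -/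
def diffCoe (p : Sph n) : TangentSpace (𝓡 (n + 1)) p →L[ℝ] EuclideanSpace ℝ (Fin (n + 2)) :=
  mfderiv (𝓡 (n + 1)) 𝓘(ℝ, EuclideanSpace ℝ (Fin (n + 2)))
    ((↑) : Sph n → EuclideanSpace ℝ (Fin (n + 2))) p

theorem diffCoe_eq_mvfderiv (p : Sph n) : diffCoe p =
    mvfderiv (𝓡 (n + 1)) (Subtype.val : Sph n → EuclideanSpace ℝ (Fin (n + 2))) p := by
  ext X
  rfl

theorem diffCoe_injective (p : Sph n) : Function.Injective (diffCoe p) := by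
  rw [diffCoe_eq_mvfderiv]
  exact injective_mvfderiv_subtypeVal_sphere p

theorem exists_diffCoe_eq (p : Sph n) {v : EuclideanSpace ℝ (Fin (n + 2))}
    (hv : inner ℝ p.1 v = 0) : ∃ X, diffCoe p X = v := by
  have h1 : v ∈ (ℝ ∙ (p : EuclideanSpace ℝ (Fin (n + 2))))ᗮ :=
    Submodule.mem_orthogonal_singleton_iff_inner_right.2 hv
  rw [← range_mvfderiv_subtypeVal (n := n + 1) p, ← diffCoe_eq_mvfderiv] at h1
  exact h1

theorem inner_diffCoe (p : Sph n) (X : TangentSpace (𝓡 (n + 1)) p) :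
    inner ℝ p.1 (diffCoe p X) = 0 := by
  have h1 : diffCoe p X ∈ (ℝ ∙ (p : EuclideanSpace ℝ (Fin (n + 2))))ᗮ := by
    rw [← range_mvfderiv_subtypeVal (n := n + 1) p, ← diffCoe_eq_mvfderiv]
    exact ⟨X, rfl⟩
  exact Submodule.mem_orthogonal_singleton_iff_inner_right.1 h1

theorem contMDiff_coe : ContMDiff (𝓡 (n + 1)) 𝓘(ℝ, EuclideanSpace ℝ (Fin (n + 2))) ∞
    ((↑) : Sph n → EuclideanSpace ℝ (Fin (n + 2))) := contMDiff_coe_sphere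

theorem mfderiv_comp_coe {F : Type*} [NormedAddCommGroup F] [NormedSpace ℝ F]
    {g : EuclideanSpace ℝ (Fin (n + 2)) → F} (p : Sph n) (hg : DifferentiableAt ℝ g p)
    (X : TangentSpace (𝓡 (n + 1)) p) :
    mfderiv (𝓡 (n + 1)) 𝓘(ℝ, F) (fun q : Sph n => g q) p X = fderiv ℝ g p (diffCoe p X) := by
  have h := mfderiv_comp (I := 𝓡 (n + 1)) (I' := 𝓘(ℝ, EuclideanSpace ℝ (Fin (n + 2))))
    (I'' := 𝓘(ℝ, F)) (g := g) (f := ((↑) : Sph n → EuclideanSpace ℝ (Fin (n + 2)))) p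
    hg.mdifferentiableAt ((contMDiff_coe p).mdifferentiableAt (by simp))
  rw [mfderiv_eq_fderiv] at h
  exact DFunLike.congr_fun h X

theorem diffLift_apply (p : Sph n) (X : TangentSpace (𝓡 (n + 1)) p) :
    diffLift p X = Fin.cons 0 (fun i => diffCoe p X i) := by
  have h1 : HasFDerivAt (fun x : EuclideanSpace ℝ (Fin (n + 2)) =>
      (Fin.cons 1 (fun i => x i) : W n))
      (ContinuousLinearMap.pi (Fin.cons 0 (fun i => EuclideanSpace.proj (𝕜 := ℝ) i))) p.1 := by
    rw [hasFDerivAt_pi']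
    intro i
    refine Fin.cases ?_ (fun j => ?_) i
    · simpa using hasFDerivAt_const (1 : ℝ) p.1
    · simpa using (EuclideanSpace.proj (𝕜 := ℝ) j).hasFDerivAt
  have h2 := mfderiv_comp_coe p h1.differentiableAt X
  rw [h1.fderiv] at h2
  refine Eq.trans h2 ?_
  funext i
  refine Fin.cases ?_ (fun j => ?_) i <;> simp

/-- The section e₋ + x has constant e₋-coordinate, so its differential lies in e₋^⊥, where the
scalar product is Euclidean. -/
theorem metric_eq (p : Sph n) (X Y : TangentSpace (𝓡 (n + 1)) p) :
    metric p X Y = inner ℝ (diffCoe p X) (diffCoe p Y) := by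
  simp [metric, diffLift_apply, scal, PiLp.inner_apply, mul_comm]

/-- An affine function on the sphere, i.e. the scalar product of `e₋ + x` with a vector of `W`. -/
def height (ε : EuclideanSpace ℝ (Fin (n + 2))) (a : ℝ) (q : Sph n) : ℝ := inner ℝ ε q.1 - a

/-- A hypersphere of the sphere. -/
def slice (ε : EuclideanSpace ℝ (Fin (n + 2))) (a : ℝ) : Set (Sph n) := {q | height ε a q = 0}

variable {ε : EuclideanSpace ℝ (Fin (n + 2))} {a : ℝ} {p : Sph n}

theorem contMDiff_height : ContMDiff (𝓡 (n + 1)) 𝓘(ℝ, ℝ) ∞ (height (n := n) ε a) := by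
  have h : ContDiff ℝ ∞ (fun x : EuclideanSpace ℝ (Fin (n + 2)) => inner ℝ ε x - a) :=
    (innerSL ℝ ε).contDiff.sub contDiff_const
  exact h.contMDiff.comp contMDiff_coe

theorem mfderiv_height (X : TangentSpace (𝓡 (n + 1)) p) :
    mfderiv (𝓡 (n + 1)) 𝓘(ℝ, ℝ) (height ε a) p X = (inner ℝ ε (diffCoe p X) : ℝ) := by
  have h : HasFDerivAt (fun x : EuclideanSpace ℝ (Fin (n + 2)) => inner ℝ ε x - a)
    (innerSL ℝ ε) p.1 := (innerSL ℝ ε).hasFDerivAt.sub_const a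
  have h2 := mfderiv_comp_coe p h.differentiableAt X
  rw [h.fderiv] at h2
  exact h2

theorem inner_self_coe (p : Sph n) : inner ℝ p.1 p.1 = (1 : ℝ) := by
  rw [real_inner_self_eq_norm_sq]
  simp

/-- The component of ε orthogonal to p is itself a tangent vector of the sphere, hence orthogonal to
itself. -/
theorem eq_smul_of_inner_diffCoe_eq_zero
    (h : ∀ X : TangentSpace (𝓡 (n + 1)) p, (inner ℝ ε (diffCoe p X) : ℝ) = 0) :
    ε = (inner ℝ ε p.1 : ℝ) • p.1 := by
  have h1 : inner ℝ p.1 (ε - (inner ℝ ε p.1 : ℝ) • p.1) = (0 : ℝ) := by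
    rw [inner_sub_right, inner_smul_right, inner_self_coe, real_inner_comm]
    ring
  obtain ⟨X, hX⟩ := exists_diffCoe_eq p h1
  have h2 := h X
  rw [hX] at h2
  rw [← sub_eq_zero, ← inner_self_eq_zero (𝕜 := ℝ), inner_sub_left, h2, inner_smul_left, h1]
  simp

/-- At a critical point on the zero set ε would equal a p, so that ‖ε‖² = a²; the spacelike
condition excludes this. -/
theorem exists_mfderiv_height_ne_zero (ha : a ^ 2 < ‖ε‖ ^ 2) (hp : height ε a p = 0) :
    ∃ X, mfderiv (𝓡 (n + 1)) 𝓘(ℝ, ℝ) (height ε a) p X ≠ 0 := by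
  by_contra! h
  have h1 := eq_smul_of_inner_diffCoe_eq_zero (p := p) (ε := ε) fun X => by
    rw [← mfderiv_height (a := a)]; exact h X
  have h2 : (inner ℝ ε p.1 : ℝ) = a := sub_eq_zero.1 hp
  rw [h2] at h1
  rw [h1, norm_smul] at ha
  simp at ha

theorem dist_sq_eq (q p : Sph n) : dist q p ^ 2 = 2 - 2 * inner ℝ p.1 q.1 := by
  rw [Subtype.dist_eq, dist_eq_norm, norm_sub_sq_real, real_inner_comm]
  simp
  ring

variable {φ : CoordChart n (𝓡 (n + 1)) (Sph n)} {S : Set (Sph n)}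
  {f : EuclideanSpace ℝ (Fin n) → ℝ}

theorem coe_graphMap_injective (h : IsGraphAt φ S f p) (hp : p ∈ S) :
    Function.Injective (fderiv ℝ (((↑) : Sph n → EuclideanSpace ℝ (Fin (n + 2))) ∘
      φ.graphMap f) (φ p).2) := by
  rw [injective_iff_map_eq_zero]
  intro w hw
  obtain ⟨X, hX, hXw⟩ := h.exists_diff_eq hp w
  have h1 := h.fderiv_comp_graphMap_eq hp (contMDiff_coe p) hX
  rw [hXw] at h1
  have h2 : diffCoe p X = 0 := h1.symm.trans hw
  have h3 : X = 0 := diffCoe_injective p (h2.trans (map_zero _).symm)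
  rw [h3, map_zero] at hXw
  exact (congrArg Prod.snd hXw).symm

/-- The parametrization has injective differential, and an injective linear map from a
finite-dimensional space is bounded below. -/
theorem isBigO_dist_graphMap (h : IsGraphAt φ S f p) (hp : p ∈ S) :
    (fun y => ‖y - (φ p).2‖) =O[𝓝 (φ p).2] fun y => dist (φ.graphMap f y) p := by
  have hd := (h.contDiffAt_comp_graphMap hp (contMDiff_coe p)).differentiableAt
    (by simp) |>.hasFDerivAt
  obtain ⟨C, -, hC⟩ := LinearMap.exists_antilipschitzWith
    (fderiv ℝ (((↑) : Sph n → EuclideanSpace ℝ (Fin (n + 2))) ∘ φ.graphMap f) (φ p).2).toLinearMap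
    (LinearMap.ker_eq_bot.2 (coe_graphMap_injective h hp))
  have h1 := hd.isTheta_sub (hC.isUniformInducing (ContinuousLinearMap.uniformContinuous _)).isInducing
  have h2 := h1.isBigO_symm
  refine (IsBigO.norm_left h2).trans (IsBigO.of_bound 1 (Eventually.of_forall fun y => ?_))
  rw [Function.comp_apply, Function.comp_apply, h.graphMap_apply hp, Subtype.dist_eq, dist_eq_norm]
  simp

/-- The squared chordal distance is the first fundamental form to second order: in the factorization
of a difference of squares, one factor is o(‖y - y₀‖) and the other O(‖y - y₀‖). -/
theorem dist_graphMap_sq_sub_isLittleO (h : IsGraphAt φ S f p) (hp : p ∈ S) :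
    (fun y => dist (φ.graphMap f y) p ^ 2 - ‖fderiv ℝ (((↑) : Sph n →
      EuclideanSpace ℝ (Fin (n + 2))) ∘ φ.graphMap f) (φ p).2 (y - (φ p).2)‖ ^ 2)
      =o[𝓝 (φ p).2] fun y => ‖y - (φ p).2‖ ^ 2 := by
  set G := ((↑) : Sph n → EuclideanSpace ℝ (Fin (n + 2))) ∘ φ.graphMap f with hG
  set L := fderiv ℝ G (φ p).2 with hL
  have hd : HasFDerivAt G L (φ p).2 := (h.contDiffAt_comp_graphMap hp (contMDiff_coe p)).differentiableAt
    (by simp) |>.hasFDerivAt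
  have h1 := hd.isLittleO.norm_left.norm_right
  have h2 : (fun y => ‖G y - G (φ p).2‖ + ‖L (y - (φ p).2)‖) =O[𝓝 (φ p).2]
      fun y => ‖y - (φ p).2‖ :=
    hd.isBigO_sub.norm_left.norm_right.add (L.isBigO_sub _ _).norm_left.norm_right
  have h3 := (h1.mul_isBigO h2)
  simp only [← pow_two] at h3
  refine IsBigO.trans_isLittleO (IsBigO.of_bound 1 (Eventually.of_forall fun y => ?_)) h3
  have h4 : dist (φ.graphMap f y) p = ‖G y - G (φ p).2‖ := by
    rw [hG, Function.comp_apply, Function.comp_apply, h.graphMap_apply hp, Subtype.dist_eq,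
      dist_eq_norm]
  rw [h4, sq_sub_sq, one_mul, norm_mul, norm_mul, mul_comm]
  simp only [Real.norm_eq_abs, abs_norm]
  gcongr
  exact abs_norm_sub_norm_le _ _

/-- The order of contact can be tested in any graph parametrization, since ‖y - y₀‖ and the distance
to p along S bound each other up to constants. -/
theorem isLittleO_comp_graphMap_iff (h : IsGraphAt φ S f p) (hp : p ∈ S) {k : Sph n → ℝ} :
    k =o[𝓝[S] p] (fun q => dist q p ^ 2) ↔
      (fun y => k (φ.graphMap f y)) =o[𝓝 (φ p).2] fun y => ‖y - (φ p).2‖ ^ 2 := by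
  constructor
  · intro hk
    refine (hk.comp_tendsto (h.tendsto_graphMap hp)).trans_isBigO ?_
    have hd := (h.contDiffAt_comp_graphMap hp (contMDiff_coe p)).differentiableAt
      (by simp) |>.hasFDerivAt
    have h1 := hd.isBigO_sub.norm_left.norm_right.pow 2
    refine h1.congr_left fun y => ?_
    rw [Function.comp_apply, Function.comp_apply, Function.comp_apply, h.graphMap_apply hp,
      Subtype.dist_eq, dist_eq_norm]
  · intro hk
    have h1 := (hk.trans_isBigO ((isBigO_dist_graphMap h hp).pow 2)).comp_tendsto h.tendsto_snd
    refine h1.congr' ?_ ?_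
    · filter_upwards [h.eventually_graphMap_snd] with q hq
      simp [hq]
    · filter_upwards [h.eventually_graphMap_snd] with q hq
      simp [hq]

end ConfSphere

/-! ### Recovering jets from diagonal values. -/

section Jets

variable {E : Type*} [NormedAddCommGroup E] [NormedSpace ℝ E]

theorem ContinuousMultilinearMap.polarization
    {b : ContinuousMultilinearMap ℝ (fun _ : Fin 2 => E) ℝ}
    (hb : ∀ (σ : Equiv.Perm (Fin 2)) v, b (v ∘ σ) = b v) (v : Fin 2 → E) :
    2 * b v = b (fun _ => v 0 + v 1) - b (fun _ => v 0) - b (fun _ => v 1) := by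
  have e : ∀ x : E, (fun _ : Fin 2 => x) = ![x, x] := fun x => by
    funext i; fin_cases i <;> rfl
  have a1 : ∀ x x' y : E, b ![x + x', y] = b ![x, y] + b ![x', y] := fun x x' y => by
    simpa using MultilinearMap.cons_add b.toMultilinearMap ![y] x x'
  have s : ∀ x y : E, b ![x, y] = b ![y, x] := fun x y => by
    rw [← hb (Equiv.swap 0 1) ![y, x]]
    congr 1
    funext i; fin_cases i <;> rfl
  have hv : v = ![v 0, v 1] := by funext i; fin_cases i <;> rfl
  rw [e, e, e, a1, s (v 0) (v 0 + v 1), s (v 1) (v 0 + v 1), a1, a1, s (v 1) (v 0)]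
  conv_lhs => rw [hv]
  ring

/-- Expansions in powers of y - y₀ control second derivatives on the diagonal only; polarization
recovers the rest. -/
theorem ContinuousMultilinearMap.ext_diag {b c : ContinuousMultilinearMap ℝ (fun _ : Fin 2 => E) ℝ}
    (hb : ∀ (σ : Equiv.Perm (Fin 2)) v, b (v ∘ σ) = b v)
    (hc : ∀ (σ : Equiv.Perm (Fin 2)) v, c (v ∘ σ) = c v)
    (h : ∀ w, b (fun _ => w) = c (fun _ => w)) : b = c := by
  ext v
  have h1 := polarization hb v
  have h2 := polarization hc v
  rw [h, h, h] at h1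
  linarith

theorem fderiv_eq_of_iteratedFDeriv_one_eq {f g : E → ℝ} {y₀ : E}
    (h : iteratedFDeriv ℝ 1 f y₀ = iteratedFDeriv ℝ 1 g y₀) : fderiv ℝ f y₀ = fderiv ℝ g y₀ := by
  ext v
  have := DFunLike.congr_fun h (fun _ => v)
  simpa [iteratedFDeriv_one_apply] using this

theorem iteratedFDeriv_zero_eq_iff {f g : E → ℝ} {y₀ : E} :
    iteratedFDeriv ℝ 0 f y₀ = iteratedFDeriv ℝ 0 g y₀ ↔ f y₀ = g y₀ := by
  refine ⟨fun h => by simpa using DFunLike.congr_fun h 0, fun h => ?_⟩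
  ext v
  simpa using h

theorem iteratedFDeriv_one_eq_of_fderiv_eq {f g : E → ℝ} {y₀ : E}
    (h : fderiv ℝ f y₀ = fderiv ℝ g y₀) : iteratedFDeriv ℝ 1 f y₀ = iteratedFDeriv ℝ 1 g y₀ := by
  ext v
  simp [iteratedFDeriv_one_apply, h]

theorem iteratedFDeriv_two_eq_of_diag {f g : E → ℝ} {y₀ : E} (hf : ContDiffAt ℝ ∞ f y₀)
    (hg : ContDiffAt ℝ ∞ g y₀)
    (h : ∀ w, iteratedFDeriv ℝ 2 f y₀ (fun _ => w) = iteratedFDeriv ℝ 2 g y₀ (fun _ => w)) :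
    iteratedFDeriv ℝ 2 f y₀ = iteratedFDeriv ℝ 2 g y₀ :=
  ContinuousMultilinearMap.ext_diag (fun σ v => iteratedFDeriv_two_comp_perm hf le_rfl σ v)
    (fun σ v => iteratedFDeriv_two_comp_perm hg le_rfl σ v) h

end Jets

/-! ### Second order contact with hyperspheres. -/

namespace ConfSphere

open HypJet

variable {n : ℕ} {ε ε' : EuclideanSpace ℝ (Fin (n + 2))} {a a' : ℝ} {p : Sph n}
  {φ : CoordChart n (𝓡 (n + 1)) (Sph n)} {S S' : Set (Sph n)}
  {f f' : EuclideanSpace ℝ (Fin n) → ℝ}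

/-- The set `S` has second order contact with some hypersphere at `p`. -/
def IsUmbilicAt (S : Set (Sph n)) (p : Sph n) : Prop :=
  ∃ (ε : EuclideanSpace ℝ (Fin (n + 2))) (a : ℝ), a ^ 2 < ‖ε‖ ^ 2 ∧
    height ε a =o[𝓝[S] p] fun q => dist q p ^ 2

theorem height_eq_zero_of_isLittleO (hp : p ∈ S)
    (h : height ε a =o[𝓝[S] p] fun q => dist q p ^ 2) : height ε a p = 0 := by
  have h1 := (h.bound one_pos).self_of_nhdsWithin hp
  simpa using h1

theorem jet_height_comp_graphMap (h : IsGraphAt φ S f p) (hp : p ∈ S)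
    (ho : height ε a =o[𝓝[S] p] fun q => dist q p ^ 2) :
    (height ε a ∘ φ.graphMap f) (φ p).2 = 0 ∧
      (∀ w, fderiv ℝ (height ε a ∘ φ.graphMap f) (φ p).2 w = 0) ∧
      ∀ w, iteratedFDeriv ℝ 2 (height ε a ∘ φ.graphMap f) (φ p).2 (fun _ => w) = 0 := by
  refine (h.contDiffAt_comp_graphMap hp (contMDiff_height p)).jet_of_isLittleO
    (ℓ := fun _ => 0) (q := fun _ => 0) (fun t w => by simp) (fun t w => by simp) ?_
  simpa using (isLittleO_comp_graphMap_iff h hp).1 ho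

theorem mfderiv_height_eq_zero_of_isLittleO (h : IsGraphAt φ S f p) (hp : p ∈ S)
    (ho : height ε a =o[𝓝[S] p] fun q => dist q p ^ 2) :
    ∀ X ∈ tangentAt (𝓡 (n + 1)) S p, mfderiv (𝓡 (n + 1)) 𝓘(ℝ, ℝ) (height ε a) p X = 0 := by
  intro X hX
  rw [← h.fderiv_comp_graphMap_eq hp (contMDiff_height p) hX]
  exact (jet_height_comp_graphMap h hp ho).2.1 _

/-- Within the pencil of hyperspheres tangent at p, the parameter s shifts the height by -(s/2)
dist². Passing from f to f' changes the height to second order by c t/2 times the first fundamental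
form, where c is its derivative along ∂_u; the choice s = c t compensates this. -/
theorem isUmbilicAt_of_sub_eq (h : IsGraphAt φ S f p) (h' : IsGraphAt φ S' f' p) (hp : p ∈ S)
    (hp' : p ∈ S') (hd : fderiv ℝ f (φ p).2 = fderiv ℝ f' (φ p).2) (hS : IsUmbilicAt S p) {t : ℝ}
    (hD : ∀ w, iteratedFDeriv ℝ 2 f' (φ p).2 (fun _ => w) - iteratedFDeriv ℝ 2 f (φ p).2
      (fun _ => w) = t * ‖fderiv ℝ (((↑) : Sph n → EuclideanSpace ℝ (Fin (n + 2))) ∘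
      φ.graphMap f') (φ p).2 w‖ ^ 2) : IsUmbilicAt S' p := by
  obtain ⟨ε, a, ha, ho⟩ := hS
  set c := fderiv ℝ (height ε a ∘ φ.symm) (φ p) (1, 0) with hc
  set s := c * t with hs
  have hpa : (inner ℝ ε p.1 : ℝ) = a := sub_eq_zero.1 (height_eq_zero_of_isLittleO hp ho)
  have hh : ∀ q, height (ε + s • p.1) (a + s) q = height ε a q - s / 2 * dist q p ^ 2 := by
    intro q
    rw [dist_sq_eq, height, height, inner_add_left, inner_smul_left]
    simp
    ring
  refine ⟨ε + s • p.1, a + s, ?_, ?_⟩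
  -- Since ⟨ε, p⟩ = a, both ‖ε‖² and a² grow by 2sa + s², so the spacelike condition persists.
  · rw [norm_add_sq_real, inner_smul_right, hpa, norm_smul]
    simp
    nlinarith
  · rw [isLittleO_comp_graphMap_iff h' hp']
    have h1 := h.comp_graphMap_sub_isLittleO h' hp hp' hd (contMDiff_height (ε := ε) (a := a) p)
    have h2 := (isLittleO_comp_graphMap_iff h hp).1 ho
    have h3 := (dist_graphMap_sq_sub_isLittleO h' hp').const_mul_left (s / 2)
    refine ((h1.add h2).sub h3).congr_left fun y => ?_
    rw [hh, hD, ← hc, hs]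
    ring

/-- Both height differentials at p are multiples, c and c', of du - df. So c ε' - c' ε annihilates
the tangent space of the sphere and equals μ p. Since ⟨p, q⟩ - 1 = -dist²/2, the same combination of
the heights is -(μ/2) dist²; comparing expansions along the two graphs gives t = μ/(c' c). -/
theorem exists_sub_eq_of_isUmbilicAt (h : IsGraphAt φ S f p) (h' : IsGraphAt φ S' f' p)
    (hp : p ∈ S) (hp' : p ∈ S') (hd : fderiv ℝ f (φ p).2 = fderiv ℝ f' (φ p).2)
    (hS : IsUmbilicAt S p) (hS' : IsUmbilicAt S' p) :
    ∃ t : ℝ, ∀ w, iteratedFDeriv ℝ 2 f' (φ p).2 (fun _ => w) - iteratedFDeriv ℝ 2 f (φ p).2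
      (fun _ => w) = t * ‖fderiv ℝ (((↑) : Sph n → EuclideanSpace ℝ (Fin (n + 2))) ∘
      φ.graphMap f') (φ p).2 w‖ ^ 2 := by
  obtain ⟨ε, a, ha, ho⟩ := hS
  obtain ⟨ε', a', ha', ho'⟩ := hS'
  have hpa : (inner ℝ ε p.1 : ℝ) = a := sub_eq_zero.1 (height_eq_zero_of_isLittleO hp ho)
  have hpa' : (inner ℝ ε' p.1 : ℝ) = a' := sub_eq_zero.1 (height_eq_zero_of_isLittleO hp' ho')
  set c := fderiv ℝ (height ε a ∘ φ.symm) (φ p) (1, 0) with hc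
  set c' := fderiv ℝ (height ε' a' ∘ φ.symm) (φ p) (1, 0) with hc'
  have hc0 : c ≠ 0 := h.fderiv_comp_symm_ne_zero hp (contMDiff_height p)
    (mfderiv_height_eq_zero_of_isLittleO h hp ho)
    (exists_mfderiv_height_ne_zero ha (height_eq_zero_of_isLittleO hp ho))
  have hc0' : c' ≠ 0 := h'.fderiv_comp_symm_ne_zero hp' (contMDiff_height p)
    (mfderiv_height_eq_zero_of_isLittleO h' hp' ho')
    (exists_mfderiv_height_ne_zero ha' (height_eq_zero_of_isLittleO hp' ho'))
  have hlin : ∀ X, (inner ℝ (c • ε' - c' • ε) (diffCoe p X) : ℝ) = 0 := by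
    intro X
    have e3 := h.mfderiv_eq_mul hp (contMDiff_height p)
      (mfderiv_height_eq_zero_of_isLittleO h hp ho) X
    have e4 := h'.mfderiv_eq_mul hp' (contMDiff_height p)
      (mfderiv_height_eq_zero_of_isLittleO h' hp' ho') X
    rw [mfderiv_height, ← hc] at e3
    rw [mfderiv_height, ← hc', ← hd] at e4
    rw [inner_sub_left, inner_smul_left, inner_smul_left, e3, e4]
    simp
    ring
  set μ := (inner ℝ (c • ε' - c' • ε) p.1 : ℝ) with hμ
  have hε := eq_smul_of_inner_diffCoe_eq_zero hlin
  have hμ' : μ = c * a' - c' * a := by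
    rw [hμ, inner_sub_left, inner_smul_left, inner_smul_left, hpa, hpa']
    simp
  have hh : ∀ q : Sph n, c * height ε' a' q - c' * height ε a q = -(μ / 2) * dist q p ^ 2 := by
    intro q
    have e1 : (inner ℝ (c • ε' - c' • ε) q.1 : ℝ) = μ * inner ℝ p.1 q.1 := by
      rw [hε, inner_smul_left]
      simp [hμ]
    rw [inner_sub_left, inner_smul_left, inner_smul_left] at e1
    simp only [conj_trivial] at e1
    rw [dist_sq_eq, height, height]
    linarith
  have h1 := (h.comp_graphMap_sub_isLittleO h' hp hp' hd
    (contMDiff_height (ε := ε) (a := a) p)).const_mul_left c'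
  have h2 := ((isLittleO_comp_graphMap_iff h hp).1 ho).const_mul_left c'
  have h3 := ((isLittleO_comp_graphMap_iff h' hp').1 ho').const_mul_left c
  have h4 := (dist_graphMap_sq_sub_isLittleO h' hp').const_mul_left (μ / 2)
  have hB : ∀ (f : EuclideanSpace ℝ (Fin n) → ℝ) (t : ℝ) w,
      iteratedFDeriv ℝ 2 f (φ p).2 (fun _ => t • w) =
      t ^ 2 * iteratedFDeriv ℝ 2 f (φ p).2 (fun _ => w) := fun f t w => by
    simp only [iteratedFDeriv_two_apply, map_smul, _root_.smul_apply, smul_eq_mul]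
    ring
  have h5 := homogeneous_eq_zero_of_isLittleO (φ p).2 (c := 0) (ℓ := fun _ => 0)
    (q := fun w => c' * c / 2 * (iteratedFDeriv ℝ 2 f' (φ p).2 (fun _ => w) -
      iteratedFDeriv ℝ 2 f (φ p).2 (fun _ => w)) - μ / 2 * ‖fderiv ℝ (((↑) : Sph n →
      EuclideanSpace ℝ (Fin (n + 2))) ∘ φ.graphMap f') (φ p).2 w‖ ^ 2)
    (fun t w => by simp) (fun t w => by
      rw [hB, hB, map_smul, norm_smul, mul_pow, Real.norm_eq_abs, sq_abs]; ring)
    (((h3.add h4).sub (h1.add h2)).congr_left fun y => by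
      have := hh (φ.graphMap f' y)
      simp only [hc] at this ⊢
      linarith)
  refine ⟨μ / (c' * c), fun w => ?_⟩
  have h6 := (h5.2 w).2
  field_simp
  linarith

/-- The case t = 0 of `isUmbilicAt_of_sub_eq`; it makes the contact condition descend to 2-jets. -/
theorem isUmbilicAt_of_jetRel {P Q : PointedHypersurface n (𝓡 (n + 1)) (Sph n)}
    (h : JetRel 2 P Q) : IsUmbilicAt P.carrier P.pt ↔ IsUmbilicAt Q.carrier Q.pt := by
  obtain ⟨h₁, φ, f, g, hf, hg, hk⟩ := h
  have hQ := Q.pt_mem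
  rw [← h₁] at hQ ⊢
  have hd := fderiv_eq_of_iteratedFDeriv_one_eq (hk 1 one_le_two)
  have h2 := hk 2 le_rfl
  exact ⟨fun h => isUmbilicAt_of_sub_eq hf hg P.pt_mem hQ hd h (t := 0) (by simp [h2]),
    fun h => isUmbilicAt_of_sub_eq hg hf hQ P.pt_mem hd.symm h (t := 0) (by simp [h2])⟩

/-- The 2-jets of hypersurfaces which have second order contact with a hypersphere. -/
def UmbilicJet (b : Jet n (𝓡 (n + 1)) (Sph n) 2) : Prop :=
  Quot.lift (fun P : PointedHypersurface n (𝓡 (n + 1)) (Sph n) => IsUmbilicAt P.carrier P.pt)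
    (fun _ _ h => propext (isUmbilicAt_of_jetRel h)) b

theorem isUmbilicAt_of_eqOn_zero (ha : a ^ 2 < ‖ε‖ ^ 2) (hS : ∀ q ∈ S, height ε a q = 0) :
    IsUmbilicAt S p := by
  refine ⟨ε, a, ha, ?_⟩
  refine (isLittleO_zero _ _).congr' ?_ EventuallyEq.rfl
  filter_upwards [self_mem_nhdsWithin] with q hq
  exact (hS q hq).symm

/-- A hypersurface tangent to a hypersphere has the same 1-jet. -/
theorem jetRel_one_of_tangent {P Q : PointedHypersurface n (𝓡 (n + 1)) (Sph n)}
    (hPQ : P.pt = Q.pt) (hQ : Q.carrier = slice ε a) (ha : a ^ 2 < ‖ε‖ ^ 2)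
    (hT : ∀ X ∈ tangentAt (𝓡 (n + 1)) P.carrier P.pt,
      mfderiv (𝓡 (n + 1)) 𝓘(ℝ, ℝ) (height ε a) P.pt X = 0) : JetRel 1 P Q := by
  obtain ⟨φ, f, h⟩ := P.isHypersurface P.pt P.pt_mem
  have h0 : height ε a P.pt = 0 := by
    have := Q.pt_mem
    rw [hQ, ← hPQ] at this
    exact this
  -- With the height as first coordinate, the hypersphere is the graph of 0 and `P` the graph of the
  -- height along itself. Equality of jets becomes vanishing of the derivatives of that function.
  obtain ⟨ψ, hψ, hQψ, hPψ⟩ := h.exists_chart P.pt_mem contMDiff_height hT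
    (exists_mfderiv_height_ne_zero ha h0)
  refine ⟨hPQ, ψ, _, _, hPψ, by rw [hQ]; exact hQψ, fun k hk => ?_⟩
  rw [hψ]
  interval_cases k
  · rw [iteratedFDeriv_zero_eq_iff, Function.comp_apply, h.graphMap_apply P.pt_mem, h0]
  · apply iteratedFDeriv_one_eq_of_fderiv_eq
    ext w
    obtain ⟨X, hX, hXw⟩ := h.exists_diff_eq P.pt_mem w
    have h1 := h.fderiv_comp_graphMap_eq P.pt_mem (contMDiff_height (ε := ε) (a := a) P.pt) hX
    rw [hT X hX, hXw] at h1
    rw [fderiv_fun_const]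
    exact h1

/-- A hypersurface with second order contact with a hypersphere has the same 2-jet. -/
theorem jetRel_two_of_isLittleO {P Q : PointedHypersurface n (𝓡 (n + 1)) (Sph n)}
    (hPQ : P.pt = Q.pt) (hQ : Q.carrier = slice ε a) (ha : a ^ 2 < ‖ε‖ ^ 2)
    (ho : height ε a =o[𝓝[P.carrier] P.pt] fun q => dist q P.pt ^ 2) : JetRel 2 P Q := by
  obtain ⟨φ, f, h⟩ := P.isHypersurface P.pt P.pt_mem
  have h0 : height ε a P.pt = 0 := height_eq_zero_of_isLittleO P.pt_mem ho
  have hT := mfderiv_height_eq_zero_of_isLittleO h P.pt_mem ho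
  obtain ⟨ψ, hψ, hQψ, hPψ⟩ := h.exists_chart P.pt_mem contMDiff_height hT
    (exists_mfderiv_height_ne_zero ha h0)
  obtain ⟨j0, j1, j2⟩ := jet_height_comp_graphMap h P.pt_mem ho
  refine ⟨hPQ, ψ, _, _, hPψ, by rw [hQ]; exact hQψ, fun k hk => ?_⟩
  have hsm := hPψ.contDiffAt
  rw [hψ] at hsm ⊢
  interval_cases k
  · rw [iteratedFDeriv_zero_eq_iff, j0]
  · apply iteratedFDeriv_one_eq_of_fderiv_eq
    ext w
    simp [j1]
  · refine iteratedFDeriv_two_eq_of_diag hsm contDiffAt_const fun w => ?_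
    rw [j2]
    simp

end ConfSphere

/-! ### Reflections of `W` and transitivity on pointed hyperspheres. -/

namespace ConfSphere

open HypJet

variable {n : ℕ}

theorem scal_comm (v w : W n) : scal v w = scal w v := by
  simp only [scal, mul_comm]

theorem scal_add_left (u v w : W n) : scal (u + v) w = scal u w + scal v w := by
  simp only [scal, Pi.add_apply, add_mul, Finset.sum_add_distrib]
  ring

theorem scal_smul_left (c : ℝ) (v w : W n) : scal (c • v) w = c * scal v w := by
  simp only [scal, Pi.smul_apply, smul_eq_mul, mul_add, Finset.mul_sum, mul_assoc]
  ring

theorem scal_smul_right (c : ℝ) (v w : W n) : scal v (c • w) = c * scal v w := by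
  rw [scal_comm, scal_smul_left, scal_comm w]

theorem scal_sub_left (u v w : W n) : scal (u - v) w = scal u w - scal v w := by
  rw [sub_eq_add_neg, ← neg_one_smul ℝ v, scal_add_left, scal_smul_left]
  ring

theorem scal_sub_right (u v w : W n) : scal u (v - w) = scal u v - scal u w := by
  rw [scal_comm, scal_sub_left, scal_comm v, scal_comm w]

/-- The linear isometries of `W`. -/
def IsIsometric (T : W n →ₗ[ℝ] W n) : Prop := ∀ v w, scal (T v) (T w) = scal v w

/-- The reflection along a vector. -/
def reflect (u : W n) : W n →ₗ[ℝ] W n where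
  toFun v := v - (2 * scal v u / scal u u) • u
  map_add' v w := by rw [scal_add_left, mul_add, add_div, add_smul]; abel
  map_smul' c v := by
    rw [scal_smul_left, RingHom.id_apply, smul_sub, smul_smul]
    congr 2
    ring

theorem reflect_apply (u v : W n) : reflect u v = v - (2 * scal v u / scal u u) • u := rfl

theorem isIsometric_reflect {u : W n} (hu : scal u u ≠ 0) : IsIsometric (reflect u) := by
  intro v w
  simp only [reflect_apply, scal_sub_left, scal_sub_right, scal_smul_left, scal_smul_right]
  rw [scal_comm u w]
  field_simp
  ring

theorem reflect_sub {x y : W n} (h : scal x x = scal y y) (hxy : scal (x - y) (x - y) ≠ 0) :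
    reflect (x - y) x = y := by
  have h1 : 2 * scal x (x - y) / scal (x - y) (x - y) = 1 := by
    rw [div_eq_one_iff_eq hxy]
    simp only [scal_sub_left, scal_sub_right, scal_comm y x]
    linarith
  rw [reflect_apply, h1, one_smul, sub_sub_cancel]

theorem reflect_of_scal_eq_zero {u v : W n} (h : scal v u = 0) : reflect u v = v := by
  simp [reflect_apply, h]

/-- The Gram matrix of the scalar product. -/
def gram (n : ℕ) : Matrix (Fin (n + 3)) (Fin (n + 3)) ℝ :=
  Matrix.diagonal (Fin.cons (-1) fun _ => 1)

theorem scal_eq_dotProduct (v w : W n) : scal v w = v ⬝ᵥ (gram n).mulVec w := by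
  simp [scal, dotProduct, gram, Matrix.mulVec_diagonal, Fin.sum_univ_succ (n := n + 2)]

/-- Determinants in Aᵀ Γ A = Γ, with Γ the invertible Gram matrix, give det A² = 1. -/
theorem det_toMatrix_sq {T : W n →ₗ[ℝ] W n} (hT : IsIsometric T) :
    (LinearMap.toMatrix' T).det = 1 ∨ (LinearMap.toMatrix' T).det = -1 := by
  set A := LinearMap.toMatrix' T with hA
  have hAT : ∀ v, A.mulVec v = T v := fun v => by
    rw [hA, ← Matrix.toLin'_apply, Matrix.toLin'_toMatrix']
  have h1 : A.transpose * gram n * A = gram n := by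
    have h2 : ∀ v w : W n, v ⬝ᵥ (A.transpose * gram n * A).mulVec w = v ⬝ᵥ (gram n).mulVec w := by
      intro v w
      rw [← scal_eq_dotProduct, ← hT, scal_eq_dotProduct, ← hAT, ← hAT, ← Matrix.mulVec_mulVec,
        ← Matrix.mulVec_mulVec, Matrix.dotProduct_mulVec v, Matrix.vecMul_transpose]
    ext i j
    have := h2 (Pi.single i 1) (Pi.single j 1)
    simpa using this
  have h3 := congrArg Matrix.det h1
  have h4 : (gram n).det ≠ 0 := by
    simp [gram, Matrix.det_diagonal, Fin.prod_univ_succ (n := n + 2)]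
  rw [Matrix.det_mul, Matrix.det_mul, Matrix.det_transpose] at h3
  rw [← sq_eq_one_iff]
  apply mul_right_cancel₀ h4
  linarith

/-- Index 2 is the coordinate of e₁; for n = 0 it would be that of e₊, which is where 1 ≤ n enters.
-/
theorem pVec_apply_two (hn : 1 ≤ n) : pVec n 2 = 0 := by
  have h1 : (2 : Fin (n + 3)) ≠ 0 := by simp [Fin.ext_iff, Nat.mod_eq_of_lt]
  have h2 : (2 : Fin (n + 3)) ≠ Fin.last (n + 2) := by
    rw [Ne, Fin.ext_iff, Fin.val_two, Fin.val_last]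
    omega
  simp [pVec, eMinus, ePlus, h1, h2]

theorem eZero_apply_two : eZero n 2 = 0 := by
  have h1 : (2 : Fin (n + 3)) ≠ 1 := by
    rw [Ne, Fin.ext_iff, Fin.val_two, Fin.val_one]
    decide
  simp [eZero, h1]

/-- The action of a linear isometry on the pair `(e₀, p)` is realized by an element of
`SO(1, n+2)`. -/
theorem exists_SO_of_isIsometric (hn : 1 ≤ n) {T : W n →ₗ[ℝ] W n} (hT : IsIsometric T) :
    ∃ A : SO n, (A : Matrix.SpecialLinearGroup (Fin (n + 3)) ℝ) • eZero n = T (eZero n) ∧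
      (A : Matrix.SpecialLinearGroup (Fin (n + 3)) ℝ) • pVec n = T (pVec n) := by
  have key : ∀ R : W n →ₗ[ℝ] W n, IsIsometric R → (LinearMap.toMatrix' R).det = 1 →
      ∃ A : SO n, ∀ v, (A : Matrix.SpecialLinearGroup (Fin (n + 3)) ℝ) • v = R v := by
    intro R hR hdet
    have hRv : ∀ v, (LinearMap.toMatrix' R).mulVec v = R v := fun v => by
      rw [← Matrix.toLin'_apply, Matrix.toLin'_toMatrix']
    refine ⟨⟨⟨LinearMap.toMatrix' R, hdet⟩, fun v w => ?_⟩, hRv⟩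
    change scal ((LinearMap.toMatrix' R).mulVec v) ((LinearMap.toMatrix' R).mulVec w) = _
    rw [hRv, hRv, hR]
  rcases det_toMatrix_sq hT with h | h
  · obtain ⟨A, hA⟩ := key T hT h
    exact ⟨A, hA _, hA _⟩
  -- If the determinant is -1, precomposing with the reflection along e₁ corrects it without moving
  -- e₀ or p.
  · set u : W n := Pi.single 2 1 with hu
    have h21 : (2 : Fin (n + 3)) = Fin.succ 1 := by
      simp
    have hs : ∀ v : W n, scal v u = v 2 := by
      intro v
      have h1 : ∀ i : Fin (n + 2), u i.succ = if i = 1 then 1 else 0 := fun i => by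
        rw [hu, h21, Pi.single_apply]
        simp only [Fin.succ_inj]
      have h0 : u 0 = 0 := by
        rw [hu, h21]
        exact Pi.single_eq_of_ne (Fin.succ_ne_zero _).symm _
      simp only [scal, h1, h0, mul_zero, mul_ite, mul_one, Finset.sum_ite_eq', Finset.mem_univ,
        if_true, neg_zero, zero_add]
      rw [h21]
    clear h21
    have huu : scal u u = 1 := by rw [hs, hu]; simp
    have hR := isIsometric_reflect (u := u) (by rw [huu]; exact one_ne_zero)
    have hRd : LinearMap.toMatrix' (reflect u) =
        Matrix.diagonal (Function.update (fun _ => 1) 2 (-1)) := by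
      ext i j
      rw [LinearMap.toMatrix'_apply, Matrix.diagonal_apply, reflect_apply, huu, hs]
      simp only [hu, Pi.sub_apply, Pi.smul_apply, Pi.single_apply, Function.update_apply,
        smul_eq_mul]
      split_ifs <;> simp_all
      norm_num
    have hdet : (LinearMap.toMatrix' (T ∘ₗ reflect u)).det = 1 := by
      rw [LinearMap.toMatrix'_comp, Matrix.det_mul, h, hRd, Matrix.det_diagonal,
        Finset.prod_update_of_mem (Finset.mem_univ _)]
      simp
    obtain ⟨A, hA⟩ := key (T ∘ₗ reflect u) (fun v w => by
      rw [LinearMap.comp_apply, LinearMap.comp_apply, hT, hR]) hdet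
    refine ⟨A, ?_, ?_⟩
    · rw [hA, LinearMap.comp_apply, reflect_of_scal_eq_zero]
      rw [hs, eZero_apply_two]
    · rw [hA, LinearMap.comp_apply, reflect_of_scal_eq_zero]
      rw [hs, pVec_apply_two hn]

/-- The vector of `W` with given `e₋`-coordinate and given projection to `e₋^⊥`. -/
def vec (ε : EuclideanSpace ℝ (Fin (n + 2))) (a : ℝ) : W n := Fin.cons a fun i => ε i

variable {ε : EuclideanSpace ℝ (Fin (n + 2))} {a : ℝ}

theorem scal_coneLift_vec (q : Sph n) : scal (coneLift q) (vec ε a) = height ε a q := by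
  simp [scal, coneLift, vec, height, PiLp.inner_apply]
  ring

theorem scal_vec_self : scal (vec ε a) (vec ε a) = ‖ε‖ ^ 2 - a ^ 2 := by
  rw [EuclideanSpace.real_norm_sq_eq]
  simp [scal, vec, pow_two]
  ring

theorem scal_coneLift_coneLift (p q : Sph n) :
    scal (coneLift p) (coneLift q) = -(dist q p ^ 2) / 2 := by
  rw [dist_sq_eq]
  simp [scal, coneLift, PiLp.inner_apply]
  ring_nf
  simp [mul_comm]

/-- For normalized isotropic vectors the scalar product is -dist²/2, so orthogonal isotropic lines
coincide. -/
theorem exists_smul_coneLift_eq {v : W n} {x : Sph n} (hv : v ≠ 0) (h : scal v v = 0)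
    (hx : scal v (coneLift x) = 0) : ∃ c : ℝ, c • coneLift x = v := by
  refine ⟨v 0, ?_⟩
  rw [← smul_coneLift_unitOf v hv h, scal_smul_left, scal_coneLift_coneLift, mul_eq_zero] at hx
  have h1 : dist x (unitOf v hv h) = 0 := by
    have := hx.resolve_left (apply_zero_ne_zero hv h)
    nlinarith
  rw [dist_eq_zero.1 h1]
  exact smul_coneLift_unitOf v hv h

theorem scal_eZero_self : scal (eZero n) (eZero n) = 1 := by
  rw [scal_eZero, eZero, Pi.single_eq_same]

theorem scal_pVec_eZero : scal (pVec n) (eZero n) = 0 := by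
  have h1 : (1 : Fin (n + 3)) ≠ 0 := by simp
  have h2 : (1 : Fin (n + 3)) ≠ Fin.last (n + 2) := by simp [Fin.ext_iff]
  rw [scal_eZero]
  simp [pVec, eMinus, ePlus, h1, h2]

/-- The isometry group acts transitively on pairs of a spacelike line and an isotropic line
orthogonal to it. -/
theorem exists_isIsometric (ha : a ^ 2 < ‖ε‖ ^ 2) {x : Sph n} (hx : height ε a x = 0) :
    ∃ T : W n →ₗ[ℝ] W n, IsIsometric T ∧ (∃ c : ℝ, c ≠ 0 ∧ T (eZero n) = c • vec ε a) ∧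
      ∃ c : ℝ, c • coneLift x = T (pVec n) := by
  have hpos : 0 < ‖ε‖ ^ 2 - a ^ 2 := by linarith
  obtain ⟨T₁, hT₁, c, hc, hT₁e⟩ : ∃ T₁ : W n →ₗ[ℝ] W n, IsIsometric T₁ ∧
      ∃ c : ℝ, c ≠ 0 ∧ T₁ (eZero n) = c • vec ε a := by
    set c := (Real.sqrt (‖ε‖ ^ 2 - a ^ 2))⁻¹ with hc
    have hc0 : c ≠ 0 := inv_ne_zero (Real.sqrt_pos.2 hpos).ne'
    have hcc : c * (c * (‖ε‖ ^ 2 - a ^ 2)) = 1 := by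
      rw [hc]
      nth_rewrite 3 [← Real.mul_self_sqrt hpos.le]
      have := (Real.sqrt_pos.2 hpos).ne'
      field_simp
    have h1 : scal (c • vec ε a) (c • vec ε a) = 1 := by
      rw [scal_smul_left, scal_smul_right, scal_vec_self, hcc]
    have h2 : scal (-c • vec ε a) (-c • vec ε a) = 1 := by
      rw [scal_smul_left, scal_smul_right, scal_vec_self]
      linarith
    -- For unit vectors the squares of e₀ - v and e₀ + v add up to 4, so at least one of the two is
    -- not isotropic and defines a reflection taking e₀ to v or to -v.
    by_cases h : scal (eZero n - c • vec ε a) (eZero n - c • vec ε a) = 0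
    · have h3 : scal (eZero n - -c • vec ε a) (eZero n - -c • vec ε a) ≠ 0 := by
        intro h4
        simp only [scal_sub_left, scal_sub_right, scal_smul_left, scal_smul_right] at h h4 h1 h2
        rw [scal_eZero_self] at h h4
        linarith
      exact ⟨_, isIsometric_reflect h3, -c, neg_ne_zero.2 hc0,
        reflect_sub (scal_eZero_self.trans h2.symm) h3⟩
    · exact ⟨_, isIsometric_reflect h, c, hc0, reflect_sub (scal_eZero_self.trans h1.symm) h⟩
  have hp0 : scal (T₁ (pVec n)) (T₁ (pVec n)) = 0 := by rw [hT₁, scal_pVec]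
  have hpe : scal (vec ε a) (T₁ (pVec n)) = 0 := by
    have h1 := hT₁ (pVec n) (eZero n)
    rw [scal_pVec_eZero, hT₁e, scal_smul_right, mul_eq_zero] at h1
    rw [scal_comm]
    exact h1.resolve_left hc
  have hxe : scal (vec ε a) (coneLift x) = 0 := by rw [scal_comm, scal_coneLift_vec, hx]
  -- If the two isotropic vectors are orthogonal, they are already proportional. Otherwise their
  -- difference is not isotropic, and the reflection along it exchanges them; it fixes `vec ε a`,
  -- which is orthogonal to both.
  by_cases h : scal (T₁ (pVec n)) (coneLift x) = 0
  · have hne : T₁ (pVec n) ≠ 0 := by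
      intro h0
      -- The vectors p and e₋ are not orthogonal, so an isometry cannot send p to 0.
      have h1 := hT₁ (pVec n) (eMinus n)
      have h2 : scal (pVec n) (eMinus n) = -(Real.sqrt 2)⁻¹ := by
        have h3 : (0 : Fin (n + 3)) ≠ Fin.last (n + 2) := (Fin.last_pos).ne
        simp [scal, eMinus, pVec, ePlus, h3]
      rw [h0, h2] at h1
      have h3 : scal (0 : W n) (T₁ (eMinus n)) = 0 := by simp [scal]
      have h4 : (0 : ℝ) < (Real.sqrt 2)⁻¹ := by positivity
      linarith
    exact ⟨T₁, hT₁, ⟨c, hc, hT₁e⟩, exists_smul_coneLift_eq hne hp0 h⟩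
  · have h1 : scal (T₁ (pVec n) - coneLift x) (T₁ (pVec n) - coneLift x) ≠ 0 := by
      simp only [scal_sub_left, scal_sub_right, hp0, scal_coneLift, scal_comm (coneLift x) (T₁ _)]
      intro h2
      apply h
      linarith
    refine ⟨reflect (T₁ (pVec n) - coneLift x) ∘ₗ T₁, fun v w => ?_, ⟨c, hc, ?_⟩, 1, ?_⟩
    · rw [LinearMap.comp_apply, LinearMap.comp_apply, isIsometric_reflect h1, hT₁]
    · rw [LinearMap.comp_apply, hT₁e, map_smul, reflect_of_scal_eq_zero]
      rw [scal_sub_right, hpe, hxe, sub_zero]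
    · rw [LinearMap.comp_apply, reflect_sub (hp0.trans (scal_coneLift x).symm) h1, one_smul]

theorem exists_smul_coneLift_smul (A : SO n) (q : Sph n) : ∃ c : ℝ, c ≠ 0 ∧
    (A : Matrix.SpecialLinearGroup (Fin (n + 3)) ℝ) • coneLift q = c • coneLift (A • q) := by
  have hv := (smul_ne_zero_iff_ne (A : Matrix.SpecialLinearGroup (Fin (n + 3)) ℝ)).2
    (coneLift_ne_zero q)
  have hs : scal ((A : Matrix.SpecialLinearGroup (Fin (n + 3)) ℝ) • coneLift q)
      ((A : Matrix.SpecialLinearGroup (Fin (n + 3)) ℝ) • coneLift q) = 0 := by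
    rw [A.2]; exact scal_coneLift q
  refine ⟨_, apply_zero_ne_zero hv hs, ?_⟩
  rw [smul_eq_unitOf]
  exact (smul_coneLift_unitOf _ hv hs).symm

theorem mem_equator_iff {q : Sph n} : q ∈ equator n ↔ scal (coneLift q) (eZero n) = 0 := by
  obtain ⟨u, hu⟩ := Projectivization.exists_smul_eq_mk_rep ℝ _ (coneLift_ne_zero q)
  change scal (Projectivization.mk ℝ _ (coneLift_ne_zero q)).rep (eZero n) = 0 ↔ _
  rw [← hu, Units.smul_def, scal_smul_left, mul_eq_zero, or_iff_right u.ne_zero]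

theorem smul_equator_eq_slice {A : SO n} {c : ℝ} (hc : c ≠ 0)
    (hA : (A : Matrix.SpecialLinearGroup (Fin (n + 3)) ℝ) • eZero n = c • vec ε a) :
    A • equator n = slice ε a := by
  ext q
  rw [Set.mem_smul_set_iff_inv_smul_mem, mem_equator_iff]
  obtain ⟨d, hd, h⟩ := exists_smul_coneLift_smul A (A⁻¹ • q)
  rw [smul_inv_smul] at h
  rw [← A.2, h, hA, scal_smul_left, scal_smul_right, scal_coneLift_vec, mul_eq_zero,
    or_iff_right hd, mul_eq_zero, or_iff_right hc]
  rfl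

theorem exists_smul_equator_eq_slice (hn : 1 ≤ n) (ha : a ^ 2 < ‖ε‖ ^ 2) {x : Sph n}
    (hx : height ε a x = 0) : ∃ A : SO n, A • origin n = x ∧ A • equator n = slice ε a := by
  obtain ⟨T, hT, ⟨c, hc, hTe⟩, d, hTp⟩ := exists_isIsometric ha hx
  obtain ⟨A, hA₁, hA₂⟩ := exists_SO_of_isIsometric hn hT
  refine ⟨A, ?_, smul_equator_eq_slice hc (hA₁.trans hTe)⟩
  rw [smul_eq, Equiv.symm_apply_eq, origin, Equiv.apply_symm_apply, PCone.smul_mk]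
  exact PCone.mk_eq_mk (h' := scal_coneLift x) d (hTp.trans hA₂.symm)

theorem exists_smul_equator (A : SO n) : ∃ (ε : EuclideanSpace ℝ (Fin (n + 2))) (a : ℝ),
    a ^ 2 < ‖ε‖ ^ 2 ∧ A • equator n = slice ε a := by
  set v := (A : Matrix.SpecialLinearGroup (Fin (n + 3)) ℝ) • eZero n with hv
  have h1 : v = vec (WithLp.toLp 2 fun i => v i.succ) (v 0) := by
    funext i
    refine Fin.cases rfl (fun j => rfl) i
  refine ⟨WithLp.toLp 2 fun i => v i.succ, v 0, ?_, smul_equator_eq_slice one_ne_zero ?_⟩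
  · have h2 : scal v v = 1 := by rw [hv, A.2, scal_eZero_self]
    rw [h1, scal_vec_self] at h2
    linarith
  · rw [one_smul]
    exact h1

end ConfSphere

/-! ### Stereographic charts. -/

namespace ConfSphere

open HypJet

variable {n : ℕ}

/-- The splitting `ℝ × ℝⁿ ≃ ℝ^{n+1}`. -/
def consEquiv (n : ℕ) : (ℝ × EuclideanSpace ℝ (Fin n)) ≃L[ℝ] EuclideanSpace ℝ (Fin (n + 1)) :=
  LinearEquiv.toContinuousLinearEquiv
    { toFun := fun z => WithLp.toLp 2 (Fin.cons z.1 fun i => z.2 i)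
      map_add' := fun z w => by
        ext i
        refine Fin.cases ?_ (fun j => ?_) i <;> simp
      map_smul' := fun c z => by
        ext i
        refine Fin.cases ?_ (fun j => ?_) i <;> simp
      invFun := fun x => (x 0, WithLp.toLp 2 fun i => x i.succ)
      left_inv := fun z => by
        refine Prod.ext ?_ ?_
        · simp
        · ext i; simp
      right_inv := fun x => by
        ext i
        refine Fin.cases ?_ (fun j => ?_) i <;> simp }

theorem inner_consEquiv (z w : ℝ × EuclideanSpace ℝ (Fin n)) :
    inner ℝ (consEquiv n z) (consEquiv n w) = z.1 * w.1 + inner ℝ z.2 w.2 := by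
  have h1 : ∀ z, consEquiv n z = WithLp.toLp 2 (Fin.cons z.1 fun i => z.2 i) := fun z => rfl
  rw [h1, h1]
  simp [PiLp.inner_apply, Fin.sum_univ_succ, mul_comm]

/-- The stereographic chart of the sphere with pole `v`. -/
def stereoChart (v : Sph n) : CoordChart n (𝓡 (n + 1)) (Sph n) where
  toOpenPartialHomeomorph := (stereographic' (n + 1) v).trans
    (consEquiv n).symm.toHomeomorph.toOpenPartialHomeomorph
  smooth_toFun := by
    have h1 : ContMDiffOn (𝓡 (n + 1)) (𝓡 (n + 1)) ∞ (stereographic' (n + 1) v)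
        (stereographic' (n + 1) v).source :=
      contMDiffOn_of_mem_maximalAtlas (IsManifold.subset_maximalAtlas ⟨v, rfl⟩)
    exact ((consEquiv n).symm.contDiff.contMDiff.comp_contMDiffOn h1).mono fun x hx => hx.1
  smooth_symm := by
    have h1 : ContMDiffOn (𝓡 (n + 1)) (𝓡 (n + 1)) ∞ (stereographic' (n + 1) v).symm
        (stereographic' (n + 1) v).target :=
      contMDiffOn_symm_of_mem_maximalAtlas (IsManifold.subset_maximalAtlas ⟨v, rfl⟩)
    exact h1.comp (consEquiv n).contDiff.contMDiff.contMDiffOn fun x hx => hx.2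

theorem stereoChart_target (v : Sph n) : (stereoChart v).target = Set.univ := by
  simp [stereoChart]

theorem stereoChart_apply_symm (v : Sph n) (z : ℝ × EuclideanSpace ℝ (Fin n)) :
    stereoChart v ((stereoChart v).symm z) = z :=
  (stereoChart v).right_inv (by rw [stereoChart_target]; trivial)

theorem stereoChart_symm_mem_source (v : Sph n) (z : ℝ × EuclideanSpace ℝ (Fin n)) :
    (stereoChart v).symm z ∈ (stereoChart v).source :=
  (stereoChart v).map_target (by rw [stereoChart_target]; trivial)

/-- The embedding of the stereographic coordinate space as the orthogonal complement of the pole. -/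
def stereoLin (v : Sph n) : (ℝ × EuclideanSpace ℝ (Fin n)) →ₗ[ℝ] EuclideanSpace ℝ (Fin (n + 2)) :=
  (Submodule.subtype _).comp
    (((OrthonormalBasis.fromOrthogonalSpanSingleton (𝕜 := ℝ) (n + 1)
      (ne_zero_of_mem_unit_sphere v)).repr.symm.toLinearEquiv.toLinearMap).comp
      (consEquiv n).toLinearEquiv.toLinearMap)

theorem inner_stereoLin (v : Sph n) (z w : ℝ × EuclideanSpace ℝ (Fin n)) :
    inner ℝ (stereoLin v z) (stereoLin v w) = z.1 * w.1 + inner ℝ z.2 w.2 := by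
  rw [← inner_consEquiv]
  exact LinearIsometryEquiv.inner_map_map (OrthonormalBasis.fromOrthogonalSpanSingleton (𝕜 := ℝ)
    (n + 1) (ne_zero_of_mem_unit_sphere v)).repr.symm (consEquiv n z) (consEquiv n w)

theorem norm_stereoLin_sq (v : Sph n) (z : ℝ × EuclideanSpace ℝ (Fin n)) :
    ‖stereoLin v z‖ ^ 2 = z.1 ^ 2 + ‖z.2‖ ^ 2 := by
  rw [← real_inner_self_eq_norm_sq, inner_stereoLin, real_inner_self_eq_norm_sq]
  ring

theorem inner_stereoLin_pole (v : Sph n) (z : ℝ × EuclideanSpace ℝ (Fin n)) :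
    inner ℝ (stereoLin v z) v.1 = (0 : ℝ) :=
  Submodule.mem_orthogonal_singleton_iff_inner_left.1 (Submodule.coe_mem _)

theorem coe_stereoChart_symm (v : Sph n) (z : ℝ × EuclideanSpace ℝ (Fin n)) :
    ((stereoChart v).symm z : EuclideanSpace ℝ (Fin (n + 2))) =
      (‖stereoLin v z‖ ^ 2 + 4)⁻¹ • ((4 : ℝ) • stereoLin v z +
        (‖stereoLin v z‖ ^ 2 - 4) • v.1) := by
  rw [smul_add]
  exact stereographic'_symm_apply v (consEquiv n z)

/-- An exact form of conformality: the chordal distance is the Euclidean one up to a factor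
depending on both points. The conformal factor of the metric follows from it by a limit. -/
theorem dist_stereoChart_symm_sq (v : Sph n) (z w : ℝ × EuclideanSpace ℝ (Fin n)) :
    dist ((stereoChart v).symm z) ((stereoChart v).symm w) ^ 2 =
      16 / ((‖stereoLin v z‖ ^ 2 + 4) * (‖stereoLin v w‖ ^ 2 + 4)) *
        ((z.1 - w.1) ^ 2 + ‖z.2 - w.2‖ ^ 2) := by
  have h0 : inner ℝ v.1 (stereoLin v z) = (0 : ℝ) := by
    rw [real_inner_comm]; exact inner_stereoLin_pole v z
  have h1 : (z.1 - w.1) ^ 2 + ‖z.2 - w.2‖ ^ 2 = ‖stereoLin v z‖ ^ 2 -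
      2 * inner ℝ (stereoLin v w) (stereoLin v z) + ‖stereoLin v w‖ ^ 2 := by
    rw [real_inner_comm, ← norm_sub_sq_real, ← map_sub, norm_stereoLin_sq]
    rfl
  rw [dist_sq_eq, h1, coe_stereoChart_symm, coe_stereoChart_symm]
  simp only [inner_smul_left, inner_smul_right, inner_add_left, inner_add_right,
    inner_stereoLin_pole, inner_self_coe, h0, conj_trivial]
  have h2 : ‖stereoLin v z‖ ^ 2 + 4 ≠ 0 := by positivity
  have h3 : ‖stereoLin v w‖ ^ 2 + 4 ≠ 0 := by positivity
  field_simp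
  ring

/-- In stereographic coordinates the affine hyperplanes are hyperspheres. -/
theorem exists_height_stereoChart_symm (v : Sph n) (u₀ : ℝ) (x₀ : EuclideanSpace ℝ (Fin n))
    (ℓ : EuclideanSpace ℝ (Fin n) →L[ℝ] ℝ) :
    ∃ (ε : EuclideanSpace ℝ (Fin (n + 2))) (a : ℝ), a ^ 2 < ‖ε‖ ^ 2 ∧
      ∀ z, height ε a ((stereoChart v).symm z) = 0 ↔ z.1 = u₀ + ℓ (z.2 - x₀) := by
  -- The vector b is the normal (1, -∇ℓ) of the hyperplane. With ε = b + a v the hypersphere passes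
  -- through the pole, so the quadratic terms cancel and the height is 4 (u - ℓ x - 2a) / (‖z‖² +
  -- 4); this dictates 2a = u₀ - ℓ x₀.
  set b := stereoLin v (1, -(InnerProductSpace.toDual ℝ _).symm ℓ) with hb
  set a := (u₀ - ℓ x₀) / 2 with ha
  have hbv : inner ℝ b v.1 = (0 : ℝ) := inner_stereoLin_pole v _
  have hvb : inner ℝ v.1 b = (0 : ℝ) := by rw [real_inner_comm]; exact hbv
  refine ⟨b + a • v.1, a, ?_, fun z => ?_⟩
  · have h1 : ‖b + a • v.1‖ ^ 2 = ‖b‖ ^ 2 + a ^ 2 := by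
      rw [norm_add_sq_real, inner_smul_right, hbv, norm_smul]
      simp
    have h2 : 0 < ‖b‖ ^ 2 := by
      rw [hb, norm_stereoLin_sq]
      positivity
    linarith
  · have h0 : inner ℝ v.1 (stereoLin v z) = (0 : ℝ) := by
      rw [real_inner_comm]; exact inner_stereoLin_pole v z
    have h1 : inner ℝ b (stereoLin v z) = z.1 - ℓ z.2 := by
      rw [hb, inner_stereoLin, inner_neg_left, InnerProductSpace.toDual_symm_apply]
      ring
    have h2 : ‖stereoLin v z‖ ^ 2 + 4 ≠ 0 := by positivity
    have h3 : height (b + a • v.1) a ((stereoChart v).symm z) =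
        (‖stereoLin v z‖ ^ 2 + 4)⁻¹ * (4 * (z.1 - (u₀ + ℓ (z.2 - x₀)))) := by
      rw [height, coe_stereoChart_symm]
      simp only [inner_smul_left, inner_smul_right, inner_add_left, inner_add_right, hbv, h0, h1,
        inner_self_coe, conj_trivial, map_sub]
      field_simp
      rw [ha]
      ring
    rw [h3, mul_eq_zero, or_iff_right (inv_ne_zero h2)]
    constructor
    · intro h; linarith
    · intro h; linarith

theorem isGraphAt_stereoChart {v : Sph n} {ε : EuclideanSpace ℝ (Fin (n + 2))} {a : ℝ}
    {f : EuclideanSpace ℝ (Fin n) → ℝ} (hf : ContDiff ℝ ∞ f)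
    (h : ∀ z, height ε a ((stereoChart v).symm z) = 0 ↔ z.1 = f z.2) {p : Sph n}
    (hp : p ∈ (stereoChart v).source) : IsGraphAt (stereoChart v) (slice ε a) f p where
  mem_source := hp
  smooth := Eventually.of_forall fun y => hf.contDiffAt
  eq_graph := by
    filter_upwards [(stereoChart v).open_source.mem_nhds hp] with q hq
    rw [← h, (stereoChart v).left_inv hq]
    rfl

end ConfSphere

/-! ### The equator as a hypersurface; orbits of its 1-jet and 2-jet. -/

namespace ConfSphere

open HypJet

variable {n : ℕ} {ε : EuclideanSpace ℝ (Fin (n + 2))} {a : ℝ} {p : Sph n}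

/-- A coordinate hyperplane of a stereographic chart is a hypersphere, hence a translate of the
equator; moving the chart back by the group element gives a chart at o. The pole plays no role. -/
theorem exists_isGraphAt_equator (hn : 1 ≤ n) :
    ∃ (v : Sph n) (A : SO n) (f : EuclideanSpace ℝ (Fin n) → ℝ),
      IsGraphAt ((stereoChart v).translate A) (equator n) f (origin n) := by
  set v := origin n
  obtain ⟨ε, a, ha, h⟩ := exists_height_stereoChart_symm v 0 0 0
  obtain ⟨A, hA₁, hA₂⟩ := exists_smul_equator_eq_slice hn ha
    (x := (stereoChart v).symm 0) ((h 0).2 (by simp))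
  have h1 := isGraphAt_stereoChart (f := fun y => 0 + (0 : EuclideanSpace ℝ (Fin n) →L[ℝ] ℝ)
    (y - 0)) (by fun_prop) h (stereoChart_symm_mem_source v 0)
  rw [← hA₁, ← hA₂] at h1
  have h2 := h1.smul A⁻¹
  rw [inv_smul_smul, inv_smul_smul] at h2
  exact ⟨_, _, _, h2⟩

theorem isHypersurface_slice (hn : 1 ≤ n) (ha : a ^ 2 < ‖ε‖ ^ 2) :
    IsHypersurface n (𝓡 (n + 1)) (slice ε a) := by
  intro p hp
  obtain ⟨A, hA₁, hA₂⟩ := exists_smul_equator_eq_slice hn ha hp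
  obtain ⟨v, B, f, h⟩ := exists_isGraphAt_equator hn
  have h1 := h.smul A
  rw [hA₁, hA₂] at h1
  exact ⟨_, _, h1⟩

theorem isHypersurface_equator (hn : 1 ≤ n) : IsHypersurface n (𝓡 (n + 1)) (equator n) := by
  obtain ⟨ε, a, ha, h⟩ := exists_smul_equator (1 : SO n)
  rw [one_smul] at h
  rw [h]
  exact isHypersurface_slice hn ha

/-- Through every point passes a great sphere, and pointed hyperspheres form one orbit. -/
theorem isPretransitive (hn : 1 ≤ n) : MulAction.IsPretransitive (SO n) (Sph n) := by
  have key : ∀ x : Sph n, ∃ A : SO n, A • origin n = x := by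
    intro x
    obtain ⟨ε, hε, hε0⟩ : ∃ ε : EuclideanSpace ℝ (Fin (n + 2)), inner ℝ ε x.1 = (0 : ℝ) ∧ ε ≠ 0 := by
      have h1 : (ℝ ∙ x.1)ᗮ ≠ ⊥ := by
        intro h
        have h2 := Submodule.finrank_orthogonal_span_singleton (𝕜 := ℝ) (n := n + 1) (v := x.1)
          (ne_zero_of_mem_unit_sphere x)
        rw [h, finrank_bot] at h2
        omega
      obtain ⟨ε, hε, h0⟩ := Submodule.exists_mem_ne_zero_of_ne_bot h1
      exact ⟨ε, Submodule.mem_orthogonal_singleton_iff_inner_left.1 hε, h0⟩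
    obtain ⟨A, hA, -⟩ := exists_smul_equator_eq_slice hn (ε := ε) (a := 0)
      (by rw [zero_pow two_ne_zero]; exact pow_pos (norm_pos_iff.2 hε0) 2) (x := x) (by rw [height, hε, sub_zero])
    exact ⟨A, hA⟩
  refine ⟨fun x y => ?_⟩
  obtain ⟨A, rfl⟩ := key x
  obtain ⟨B, rfl⟩ := key y
  exact ⟨B * A⁻¹, by rw [mul_smul, inv_smul_smul]⟩

/-- A hypersphere together with one of its points. -/
def pointedSlice (hn : 1 ≤ n) (ha : a ^ 2 < ‖ε‖ ^ 2) (hp : height ε a p = 0) :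
    PointedHypersurface n (𝓡 (n + 1)) (Sph n) :=
  ⟨slice ε a, p, isHypersurface_slice hn ha, hp⟩

variable {h : IsHypersurface n (𝓡 (n + 1)) (equator n)}

theorem mk_pointedSlice_mem_orbit (hn : 1 ≤ n) (ha : a ^ 2 < ‖ε‖ ^ 2) (hp : height ε a p = 0)
    (l : ℕ) : Jet.mk l (pointedSlice hn ha hp) ∈
      MulAction.orbit (SO n) (Jet.mk l (pointedEquator n h)) := by
  obtain ⟨A, hA₁, hA₂⟩ := exists_smul_equator_eq_slice hn ha hp
  refine ⟨A, ?_⟩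
  change Jet.mk l (A • pointedEquator n h) = _
  congr 1
  exact PointedHypersurface.ext hA₂ hA₁

/-- The normal direction of a hypersurface. -/
theorem exists_normal (P : PointedHypersurface n (𝓡 (n + 1)) (Sph n)) :
    ∃ ε : EuclideanSpace ℝ (Fin (n + 2)), ε ≠ 0 ∧ height ε 0 P.pt = 0 ∧
      ∀ X ∈ tangentAt (𝓡 (n + 1)) P.carrier P.pt,
        mfderiv (𝓡 (n + 1)) 𝓘(ℝ, ℝ) (height ε 0) P.pt X = 0 := by
  obtain ⟨φ, f, h⟩ := P.isHypersurface P.pt P.pt_mem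
  -- V is T_pS + ℝp in the ambient Euclidean space. It is proper, since the tangent vector with du =
  -- 1, dx = 0 is not in T_pS. A nonzero ε orthogonal to V defines a great sphere through p tangent
  -- to the hypersurface.
  set V := (tangentAt (𝓡 (n + 1)) P.carrier P.pt).map (diffCoe P.pt).toLinearMap ⊔ (ℝ ∙ P.pt.1)
    with hV
  have hVtop : V ≠ ⊤ := by
    intro htop
    obtain ⟨X, hX⟩ := φ.diff_surjective h.mem_source (1, 0)
    have h1 : diffCoe P.pt X ∈ V := by rw [htop]; trivial
    obtain ⟨_, ⟨Y, hY, rfl⟩, _, h2, h3⟩ := Submodule.mem_sup.1 h1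
    obtain ⟨s, rfl⟩ := Submodule.mem_span_singleton.1 h2
    have h4 := congrArg (inner ℝ P.pt.1) h3
    simp only [inner_add_right, inner_smul_right, inner_self_coe] at h4
    have h5 : inner ℝ P.pt.1 ((diffCoe P.pt).toLinearMap Y) = (0 : ℝ) := inner_diffCoe _ _
    rw [h5, inner_diffCoe, zero_add, mul_one] at h4
    rw [h4, zero_smul, add_zero] at h3
    have h6 : Y = X := diffCoe_injective _ h3
    have h7 := h.diff_eq_of_mem P.pt_mem hY
    rw [h6, hX, map_zero] at h7
    exact one_ne_zero (congrArg Prod.fst h7)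
  have h1 : Vᗮ ≠ ⊥ := fun h => hVtop (Submodule.orthogonal_eq_bot_iff.1 h)
  obtain ⟨ε, hε, h0⟩ := Submodule.exists_mem_ne_zero_of_ne_bot h1
  rw [Submodule.mem_orthogonal'] at hε
  refine ⟨ε, h0, ?_, fun X hX => ?_⟩
  · rw [height, sub_zero]
    exact hε _ (Submodule.mem_sup_right (Submodule.mem_span_singleton_self _))
  · rw [mfderiv_height]
    exact hε _ (Submodule.mem_sup_left ⟨X, hX, rfl⟩)

/-- The tangent great sphere has the same 1-jet as the hypersurface, and it lies in the orbit of the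
equator. -/
theorem orbit_one_eq_univ (hn : 1 ≤ n) :
    MulAction.orbit (SO n) (Jet.mk 1 (pointedEquator n h)) = Set.univ := by
  refine Set.eq_univ_of_forall ?_
  rintro ⟨P⟩
  obtain ⟨ε, hε, hP, hT⟩ := exists_normal P
  have ha : (0 : ℝ) ^ 2 < ‖ε‖ ^ 2 := by
    rw [zero_pow two_ne_zero]
    exact pow_pos (norm_pos_iff.2 hε) 2
  have h1 : Jet.mk 1 P = Jet.mk 1 (pointedSlice hn ha hP) :=
    Quot.sound (jetRel_one_of_tangent rfl rfl ha hT)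
  change Jet.mk 1 P ∈ _
  rw [h1]
  exact mk_pointedSlice_mem_orbit hn ha hP 1

theorem exists_mk_pointedSlice_eq (hn : 1 ≤ n) {P : PointedHypersurface n (𝓡 (n + 1)) (Sph n)}
    (hP : IsUmbilicAt P.carrier P.pt) : ∃ (ε : EuclideanSpace ℝ (Fin (n + 2))) (a : ℝ)
      (ha : a ^ 2 < ‖ε‖ ^ 2) (hp : height ε a P.pt = 0),
      Jet.mk 2 P = Jet.mk 2 (pointedSlice hn ha hp) := by
  obtain ⟨ε, a, ha, ho⟩ := hP
  exact ⟨ε, a, ha, height_eq_zero_of_isLittleO P.pt_mem ho,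
    Quot.sound (jetRel_two_of_isLittleO rfl rfl ha ho)⟩

/-- Translates of the equator are hyperspheres; conversely, second order contact means having the
2-jet of a hypersphere, and pointed hyperspheres form one orbit. -/
theorem mem_orbit_two_iff (hn : 1 ≤ n) (b : Jet n (𝓡 (n + 1)) (Sph n) 2) :
    b ∈ MulAction.orbit (SO n) (Jet.mk 2 (pointedEquator n h)) ↔ UmbilicJet b := by
  constructor
  · rintro ⟨A, rfl⟩
    obtain ⟨ε, a, ha, hA⟩ := exists_smul_equator A
    refine isUmbilicAt_of_eqOn_zero (ε := ε) (a := a) ha fun q hq => ?_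
    have h1 : q ∈ A • equator n := hq
    rw [hA] at h1
    exact h1
  · obtain ⟨P⟩ := b
    intro hP
    obtain ⟨ε, a, ha, hp, h1⟩ := exists_mk_pointedSlice_eq hn hP
    change Jet.mk 2 P ∈ _
    rw [h1]
    exact mk_pointedSlice_mem_orbit hn ha hp 2

end ConfSphere

/-! ### The first fundamental form of a graph as a smooth function of jet coordinates. -/

theorem Submodule.contDiff_coe {V : Type*} [NormedAddCommGroup V] [NormedSpace ℝ V]
    (S : Submodule ℝ V) : ContDiff ℝ ∞ fun y : S => (y : V) :=
  S.subtypeL.contDiff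

theorem ContDiff.smul_const_right {X F : Type*} [NormedAddCommGroup X] [NormedSpace ℝ X]
    [NormedAddCommGroup F] [NormedSpace ℝ F] {g : X → ℝ} (hg : ContDiff ℝ ∞ g) (c : F) :
    ContDiff ℝ ∞ fun x => g x • c :=
  hg.smul contDiff_const

namespace HypJet

variable {n : ℕ}

/-- The symmetric product of two linear forms. -/
def SymForm.prod (ℓ m : EuclideanSpace ℝ (Fin n) →L[ℝ] ℝ) : SymForm n 2 :=
  ⟨(1 / 2 : ℝ) • ((ContinuousMultilinearMap.mkPiAlgebra ℝ (Fin 2) ℝ).compContinuousLinearMap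
      ![ℓ, m] + (ContinuousMultilinearMap.mkPiAlgebra ℝ (Fin 2) ℝ).compContinuousLinearMap
      ![m, ℓ]), by
    intro σ v
    have h01 : σ = 1 ∨ σ = Equiv.swap 0 1 := by decide +revert
    rcases h01 with rfl | rfl
    · rfl
    · simp [Fin.prod_univ_two]
      ring⟩

theorem SymForm.prod_diag (ℓ m : EuclideanSpace ℝ (Fin n) →L[ℝ] ℝ) (w : EuclideanSpace ℝ (Fin n)) :
    (SymForm.prod ℓ m).1 (fun _ => w) = ℓ w * m w := by
  simp [SymForm.prod, Fin.prod_univ_two]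
  ring

/-- The derivative in the `i`-th direction, as a jet coordinate. -/
def JetCoord.deriv (i : Fin n) (y : JetCoord n 1) : ℝ :=
  (y.2 1).1 (fun _ => EuclideanSpace.single i 1)

theorem JetCoord.contDiff_deriv (i : Fin n) : ContDiff ℝ ∞ (JetCoord.deriv (n := n) i) :=
  (ContinuousMultilinearMap.apply ℝ (fun _ : Fin 1 => EuclideanSpace ℝ (Fin n)) ℝ
    (fun _ => EuclideanSpace.single i 1)).contDiff.comp
    ((Submodule.contDiff_coe (SymForm n 1)).comp ((contDiff_pi.1 contDiff_snd : _) 1))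

/-- The form `∑ (δ_{ij} + u_i u_j) dx^i dx^j`. -/
def graphForm (y : JetCoord n 1) : SymForm n 2 :=
  ∑ i, SymForm.prod (EuclideanSpace.proj i) (EuclideanSpace.proj i) +
    ∑ i, ∑ j, (y.deriv i * y.deriv j) •
      SymForm.prod (EuclideanSpace.proj i) (EuclideanSpace.proj j)

theorem contDiff_graphForm : ContDiff ℝ ∞ (graphForm (n := n)) := by
  refine contDiff_const.add (ContDiff.sum fun i _ => ContDiff.sum fun j _ => ?_)
  exact ((JetCoord.contDiff_deriv i).mul (JetCoord.contDiff_deriv j)).smul_const_right _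

theorem graphForm_diag (y : JetCoord n 1) (w : EuclideanSpace ℝ (Fin n)) :
    (graphForm y).1 (fun _ => w) = ‖w‖ ^ 2 + (∑ i, y.deriv i * w i) ^ 2 := by
  have h : (graphForm y).1 = ∑ i, (SymForm.prod (EuclideanSpace.proj (𝕜 := ℝ) i)
      (EuclideanSpace.proj i)).1 + ∑ i, ∑ j, (y.deriv i * y.deriv j) •
      (SymForm.prod (EuclideanSpace.proj (𝕜 := ℝ) i) (EuclideanSpace.proj j)).1 := by
    simp [graphForm]
  rw [h, EuclideanSpace.real_norm_sq_eq, pow_two (∑ i, y.deriv i * w i), Finset.sum_mul_sum]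
  simp only [_root_.add_apply, _root_.sum_apply,
    _root_.smul_apply, SymForm.prod_diag, smul_eq_mul]
  congr 1
  · refine Finset.sum_congr rfl fun i _ => ?_
    simp [pow_two]
  · refine Finset.sum_congr rfl fun i _ => Finset.sum_congr rfl fun j _ => ?_
    simp
    ring

theorem graphForm_ne_zero (hn : 1 ≤ n) (y : JetCoord n 1) : graphForm y ≠ 0 := by
  intro h
  have h1 := graphForm_diag y (EuclideanSpace.single ⟨0, hn⟩ 1)
  rw [h] at h1
  have h2 : ((0 : SymForm n 2).1 fun _ => EuclideanSpace.single ⟨0, hn⟩ (1 : ℝ)) = 0 := rfl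
  rw [h2, PiLp.norm_single] at h1
  simp only [norm_one, one_pow] at h1
  nlinarith [sq_nonneg (∑ i, y.deriv i * EuclideanSpace.single (⟨0, hn⟩ : Fin n) (1 : ℝ) i)]

end HypJet

/-! ### Umbilic jets in stereographic coordinates. -/

namespace ConfSphere

open HypJet

variable {n : ℕ} {S : Set (Sph n)} {p v : Sph n} {f : EuclideanSpace ℝ (Fin n) → ℝ}

/-- The limit of `dist_stereoChart_symm_sq` along z + t w as t → 0, after division by t². -/
theorem norm_fderiv_stereoChart_symm_sq (v : Sph n) (z w : ℝ × EuclideanSpace ℝ (Fin n)) :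
    ‖fderiv ℝ (((↑) : Sph n → EuclideanSpace ℝ (Fin (n + 2))) ∘ (stereoChart v).symm) z w‖ ^ 2 =
      16 / ((‖stereoLin v z‖ ^ 2 + 4) * (‖stereoLin v z‖ ^ 2 + 4)) * (w.1 ^ 2 + ‖w.2‖ ^ 2) := by
  set G := ((↑) : Sph n → EuclideanSpace ℝ (Fin (n + 2))) ∘ (stereoChart v).symm with hG
  have hsm := (stereoChart v).contDiffAt_comp_symm (stereoChart_symm_mem_source v z)
    (contMDiff_coe ((stereoChart v).symm z))
  rw [stereoChart_apply_symm] at hsm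
  have hd : HasFDerivAt G (fderiv ℝ G z) z := (hsm.differentiableAt (by simp)).hasFDerivAt
  have h1 : HasDerivAt (fun t : ℝ => G (z + t • w)) (fderiv ℝ G z w) 0 := by
    have h2 : HasDerivAt (fun t : ℝ => z + t • w) w 0 := by
      simpa using ((hasDerivAt_id (0 : ℝ)).smul_const w).const_add z
    have h3 : HasFDerivAt G (fderiv ℝ G z) (z + (0 : ℝ) • w) := by simpa using hd
    exact h3.comp_hasDerivAt 0 h2
  have h2 := ((hasDerivAt_iff_tendsto_slope_zero.1 h1).norm).pow 2
  have h3 : Tendsto (fun t : ℝ => 16 / ((‖stereoLin v (z + t • w)‖ ^ 2 + 4) *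
      (‖stereoLin v z‖ ^ 2 + 4)) * (w.1 ^ 2 + ‖w.2‖ ^ 2)) (𝓝[≠] 0)
      (𝓝 (16 / ((‖stereoLin v z‖ ^ 2 + 4) * (‖stereoLin v z‖ ^ 2 + 4)) *
        (w.1 ^ 2 + ‖w.2‖ ^ 2))) := by
    have h4 : Continuous (fun t : ℝ => 16 / ((‖stereoLin v (z + t • w)‖ ^ 2 + 4) *
      (‖stereoLin v z‖ ^ 2 + 4)) * (w.1 ^ 2 + ‖w.2‖ ^ 2)) := by
      have h5 : Continuous fun t : ℝ => stereoLin v (z + t • w) :=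
        (stereoLin v).continuous_of_finiteDimensional.comp (by fun_prop)
      refine Continuous.mul (Continuous.div continuous_const (by fun_prop) fun t => ?_)
        continuous_const
      positivity
    have h6 := h4.tendsto 0
    simp only [zero_smul, add_zero] at h6
    exact h6.mono_left nhdsWithin_le_nhds
  refine tendsto_nhds_unique h2 (h3.congr' ?_)
  filter_upwards [self_mem_nhdsWithin] with t ht
  have ht' : t ≠ 0 := ht
  have h4 := dist_stereoChart_symm_sq v (z + t • w) z
  rw [Subtype.dist_eq, dist_eq_norm] at h4
  have h5 : (z + t • w).1 - z.1 = t * w.1 := by simp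
  have h6 : ‖(z + t • w).2 - z.2‖ = |t| * ‖w.2‖ := by simp [norm_smul]
  rw [h5, h6] at h4
  simp only [zero_add, zero_smul, add_zero]
  rw [norm_smul, mul_pow, hG, Function.comp_apply, Function.comp_apply, h4, norm_inv,
    Real.norm_eq_abs, inv_pow, sq_abs, mul_pow, mul_pow, sq_abs]
  have : ‖stereoLin v (z + t • w)‖ ^ 2 + 4 ≠ 0 := by positivity
  have : ‖stereoLin v z‖ ^ 2 + 4 ≠ 0 := by positivity
  field_simp

/-- The comparison hypersphere is the affine hyperplane tangent to the graph. Its second derivative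
vanishes, so the difference of second derivatives is that of f itself; the conformal factor is
absorbed in t. -/
theorem isUmbilicAt_stereoChart_iff (h : IsGraphAt (stereoChart v) S f p) (hp : p ∈ S) :
    IsUmbilicAt S p ↔ ∃ t : ℝ, ∀ w, iteratedFDeriv ℝ 2 f (stereoChart v p).2 (fun _ => w) =
      t * (‖w‖ ^ 2 + fderiv ℝ f (stereoChart v p).2 w ^ 2) := by
  set y₀ := (stereoChart v p).2 with hy₀
  obtain ⟨ε, a, ha, hε⟩ := exists_height_stereoChart_symm v (f y₀) y₀ (fderiv ℝ f y₀)
  have hgs : ContDiff ℝ ∞ fun y => f y₀ + fderiv ℝ f y₀ (y - y₀) := by fun_prop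
  have hg := isGraphAt_stereoChart (f := fun y => f y₀ + fderiv ℝ f y₀ (y - y₀)) hgs hε h.mem_source
  obtain ⟨-, g1, g2⟩ := hgs.contDiffAt.jet_of_isLittleO (y₀ := y₀) (c := f y₀)
    (ℓ := fderiv ℝ f y₀) (q := fun _ => 0) (fun t w => by simp) (fun t w => by simp)
    (by simp)
  have hps : p ∈ slice ε a := by
    have h1 := (hε (stereoChart v p)).2 (by
      rw [← hy₀, sub_self, map_zero, add_zero]
      exact h.eq_graph.self_of_nhds.1 hp)
    rwa [(stereoChart v).left_inv h.mem_source] at h1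
  have hd : fderiv ℝ (fun y => f y₀ + fderiv ℝ f y₀ (y - y₀)) y₀ = fderiv ℝ f y₀ :=
    ContinuousLinearMap.ext g1
  have hsl : IsUmbilicAt (slice ε a) p := isUmbilicAt_of_eqOn_zero ha fun q hq => hq
  set c := 16 / ((‖stereoLin v (stereoChart v p)‖ ^ 2 + 4) *
    (‖stereoLin v (stereoChart v p)‖ ^ 2 + 4)) with hc
  have hc0 : c ≠ 0 := by positivity
  have hL : ∀ w, ‖fderiv ℝ (((↑) : Sph n → EuclideanSpace ℝ (Fin (n + 2))) ∘
      (stereoChart v).graphMap f) y₀ w‖ ^ 2 = c * (‖w‖ ^ 2 + fderiv ℝ f y₀ w ^ 2) := by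
    intro w
    rw [(h.hasFDerivAt_comp_graphMap hp (contMDiff_coe p)).fderiv, add_comm (‖w‖ ^ 2)]
    exact norm_fderiv_stereoChart_symm_sq v _ (_, _)
  constructor
  · intro hS
    obtain ⟨t, ht⟩ := exists_sub_eq_of_isUmbilicAt hg h hps hp hd hsl hS
    refine ⟨t * c, fun w => ?_⟩
    have := ht w
    rw [g2, sub_zero, hL] at this
    rw [this, mul_assoc]
  · rintro ⟨t, ht⟩
    refine isUmbilicAt_of_sub_eq hg h hps hp hd hsl (t := t / c) fun w => ?_
    rw [g2, sub_zero, hL, ht]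
    field_simp

theorem umbilicJet_iff_of_hasCoord {b : Jet n (𝓡 (n + 1)) (Sph n) 2} {z : JetCoord n 2}
    (hb : b.HasCoord (stereoChart v) z) :
    UmbilicJet b ↔ ∃ t : ℝ, z.top = t • graphForm (z.trunc one_le_two) := by
  obtain ⟨P, f, rfl, hf, hz, hk⟩ := hb
  refine (isUmbilicAt_stereoChart_iff hf P.pt_mem).trans (exists_congr fun t => ?_)
  rw [← hz]
  have h2 : z.top.1 = iteratedFDeriv ℝ 2 f z.1 := hk 2
  have h1 : ∀ i, (z.trunc one_le_two).deriv i = fderiv ℝ f z.1 (EuclideanSpace.single i 1) := by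
    intro i
    have := DFunLike.congr_fun (hk 1) (fun _ => EuclideanSpace.single i 1)
    exact this.trans (iteratedFDeriv_one_apply _)
  have h3 : ∀ w, ∑ i, (z.trunc one_le_two).deriv i * w i = fderiv ℝ f z.1 w := by
    intro w
    conv_rhs => rw [← (EuclideanSpace.basisFun (Fin n) ℝ).sum_repr w]
    simp only [map_sum, map_smul, h1]
    simp [mul_comm]
  have h4 : ∀ w, (t • graphForm (z.trunc one_le_two)).1 (fun _ => w) =
      t * (‖w‖ ^ 2 + fderiv ℝ f z.1 w ^ 2) := by
    intro w
    rw [← h3, ← graphForm_diag]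
    rfl
  constructor
  · intro h
    refine Subtype.ext (ContinuousMultilinearMap.ext_diag z.top.2
      (t • graphForm (z.trunc one_le_two)).2 fun w => ?_)
    rw [h4, h2, h]
  · intro h w
    rw [← h4, ← h, h2]

end ConfSphere

/-! ### Jet coordinates under the group action, and the normal line. -/

namespace HypJet

variable {E H : Type*} [NormedAddCommGroup E] [NormedSpace ℝ E] [TopologicalSpace H]
  {n : ℕ} {I : ModelWithCorners ℝ E H} {M : Type*} [TopologicalSpace M] [ChartedSpace H M]

/-- The jet coordinates of the graph of `f` over `x`. -/
def jetCoord {l : ℕ} (hl : l ≤ 2) {f : EuclideanSpace ℝ (Fin n) → ℝ} {x : EuclideanSpace ℝ (Fin n)}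
    (hf : ContDiffAt ℝ ∞ f x) : JetCoord n l :=
  (x, fun k => ⟨iteratedFDeriv ℝ k f x, fun σ v =>
    iteratedFDeriv_two_comp_perm hf ((Nat.lt_succ_iff.1 k.2).trans hl) σ v⟩)

theorem hasCoord_jetCoord {l : ℕ} (hl : l ≤ 2) {P : PointedHypersurface n I M}
    {φ : CoordChart n I M} {f : EuclideanSpace ℝ (Fin n) → ℝ} (h : IsGraphAt φ P.carrier f P.pt) :
    (Jet.mk l P).HasCoord φ (jetCoord hl h.contDiffAt) :=
  ⟨P, f, rfl, h, rfl, fun _ => rfl⟩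

variable {G : Type*} [Group G] [MulAction G M] [SmoothAction I G M]

theorem IsGraphAt.of_translate {φ : CoordChart n I M} {S : Set M}
    {f : EuclideanSpace ℝ (Fin n) → ℝ} {p : M} {g : G} (h : IsGraphAt (φ.translate g) S f p) :
    IsGraphAt φ (g⁻¹ • S) f (g⁻¹ • p) where
  mem_source := by
    have h1 : p ∈ ((smulHomeo I M g⁻¹).toOpenPartialHomeomorph.trans
      φ.toOpenPartialHomeomorph).source := h.mem_source
    have h2 : smulHomeo I M g⁻¹ p ∈ φ.source := by simpa using h1
    exact h2
  smooth := h.smooth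
  eq_graph := by
    have hc : Filter.Tendsto (fun q : M => g • q) (𝓝 (g⁻¹ • p)) (𝓝 p) := by
      have := (SmoothAction.contMDiff_smul (I := I) (M := M) g).continuous.tendsto (g⁻¹ • p)
      simpa using this
    filter_upwards [hc.eventually h.eq_graph] with q hq
    rw [CoordChart.translate_apply, inv_smul_smul] at hq
    rw [Set.mem_smul_set_iff_inv_smul_mem, inv_inv]
    exact hq

theorem Jet.HasCoord.of_translate {l : ℕ} {b : Jet n I M l} {φ : CoordChart n I M} {g : G}
    {z : JetCoord n l} (h : b.HasCoord (φ.translate g) z) : (g⁻¹ • b).HasCoord φ z := by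
  obtain ⟨P, f, rfl, hf, hz, hk⟩ := h
  exact ⟨g⁻¹ • P, f, rfl, hf.of_translate, hz, hk⟩

theorem Jet.HasCoord.translate {l : ℕ} {b : Jet n I M l} {φ : CoordChart n I M} (g : G)
    {z : JetCoord n l} (h : b.HasCoord φ z) : (g • b).HasCoord (φ.translate g) z := by
  obtain ⟨P, f, rfl, hf, hz, hk⟩ := h
  refine ⟨g • P, f, rfl, hf.smul g, ?_, hk⟩
  change z.1 = (φ.translate g (g • P.pt)).2
  rw [CoordChart.translate_apply, inv_smul_smul]
  exact hz

theorem eq_of_mk_one_eq {P Q : PointedHypersurface n I M} (h : Jet.mk 1 P = Jet.mk 1 Q) :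
    (⟨P.pt, tangentAt I P.carrier P.pt⟩ : Σ p : M, Submodule ℝ (TangentSpace I p)) =
      ⟨Q.pt, tangentAt I Q.carrier Q.pt⟩ :=
  congrArg Jet.tangentPair h

/-- The hypersurface of a chart domain defined by a graph. -/
def graphHypersurface (φ : CoordChart n I M) {f : EuclideanSpace ℝ (Fin n) → ℝ}
    (hf : ContDiff ℝ ∞ f) {p : M} (hp : p ∈ φ.source) (hpf : (φ p).1 = f (φ p).2) :
    PointedHypersurface n I M where
  carrier := {q | q ∈ φ.source ∧ (φ q).1 = f (φ q).2}
  pt := p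
  isHypersurface := fun q hq => ⟨φ, f, hq.1, Eventually.of_forall fun _ => hf.contDiffAt, by
    filter_upwards [φ.open_source.mem_nhds hq.1] with q' hq'
    exact and_iff_right hq'⟩
  pt_mem := ⟨hp, hpf⟩

theorem isGraphAt_graphHypersurface (φ : CoordChart n I M) {f : EuclideanSpace ℝ (Fin n) → ℝ}
    (hf : ContDiff ℝ ∞ f) {p : M} (hp : p ∈ φ.source) (hpf : (φ p).1 = f (φ p).2) :
    IsGraphAt φ (graphHypersurface φ hf hp hpf).carrier f p :=
  ⟨hp, Eventually.of_forall fun _ => hf.contDiffAt, by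
    filter_upwards [φ.open_source.mem_nhds hp] with q' hq'
    exact and_iff_right hq'⟩

/-- The form du - df has kernel T_pS and maps onto ℝ. -/
theorem finrank_normal (c : Jet n I M 1) : Module.finrank ℝ c.normal = 1 := by
  obtain ⟨P⟩ := c
  obtain ⟨φ, f, h⟩ := P.isHypersurface P.pt P.pt_mem
  set ℓ : TangentSpace I P.pt →ₗ[ℝ] ℝ :=
    ((LinearMap.fst ℝ ℝ (EuclideanSpace ℝ (Fin n))) - (fderiv ℝ f (φ P.pt).2).toLinearMap.comp
      (LinearMap.snd ℝ ℝ (EuclideanSpace ℝ (Fin n)))).comp (φ.diff P.pt).toLinearMap with hℓ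
  have hker : tangentAt I P.carrier P.pt = LinearMap.ker ℓ := by
    ext X
    rw [mem_tangentAt_iff h P.pt_mem, LinearMap.mem_ker]
    exact sub_eq_zero.symm
  have hsurj : Function.Surjective ℓ := by
    intro s
    obtain ⟨X, hX⟩ := φ.diff_surjective h.mem_source (s, 0)
    refine ⟨X, ?_⟩
    change (φ.diff P.pt X).1 - fderiv ℝ f (φ P.pt).2 (φ.diff P.pt X).2 = s
    rw [hX]
    simp
  have e := (Submodule.quotEquivOfEq _ _ hker).trans (ℓ.quotKerEquivOfSurjective hsurj)
  exact e.finrank_eq.trans (Module.finrank_self ℝ)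

end HypJet

/-! ### The model line ℝg⁰ ⊗ N. -/

namespace ConfSphere

open HypJet

variable {n : ℕ}

/-- The metric, as a multilinear map on a subspace of a tangent space. -/
def metricForm (p : Sph n) (T : Submodule ℝ (TangentSpace (𝓡 (n + 1)) p)) :
    MultilinearMap ℝ (fun _ : Fin 2 => T) ℝ :=
  ∑ i, (MultilinearMap.mkPiAlgebra ℝ (Fin 2) ℝ).compLinearMap fun _ =>
    (EuclideanSpace.proj (𝕜 := ℝ) i).toLinearMap.comp ((diffCoe p).toLinearMap.comp T.subtype)

theorem metricForm_apply (p : Sph n) (T : Submodule ℝ (TangentSpace (𝓡 (n + 1)) p))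
    (X : Fin 2 → T) : metricForm p T X = metric p (X 0).1 (X 1).1 := by
  rw [metric_eq]
  simp [metricForm, PiLp.inner_apply, Fin.prod_univ_two, mul_comm]

theorem metric_comm (p : Sph n) (X Y : TangentSpace (𝓡 (n + 1)) p) : metric p X Y = metric p Y X := by
  rw [metric_eq, metric_eq, real_inner_comm]

theorem metricForm_comp_perm (p : Sph n) (T : Submodule ℝ (TangentSpace (𝓡 (n + 1)) p))
    (σ : Equiv.Perm (Fin 2)) (X : Fin 2 → T) : metricForm p T (X ∘ σ) = metricForm p T X := by
  have h01 : σ = 1 ∨ σ = Equiv.swap 0 1 := by decide +revert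
  rw [metricForm_apply, metricForm_apply]
  rcases h01 with rfl | rfl
  · simp
  · simpa using metric_comm p _ _

/-- The map `(X, Y) ↦ g(X, Y) ν`. -/
def metricTensor (c : Jet n (𝓡 (n + 1)) (Sph n) 1) (ν : c.normal) : c.SymTensor 2 :=
  ⟨(metricForm c.tangentPair.1 c.tangent).smulRight ν, by
    intro σ X
    rw [MultilinearMap.smulRight_apply, MultilinearMap.smulRight_apply, metricForm_comp_perm]⟩

theorem metricTensor_apply (c : Jet n (𝓡 (n + 1)) (Sph n) 1) (ν : c.normal) (X : Fin 2 → c.tangent) :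
    (metricTensor c ν).1 X = metric c.tangentPair.1 (X 0).1 (X 1).1 • ν := by
  exact congrArg (fun t : ℝ => t • ν) (metricForm_apply c.tangentPair.1 c.tangent X)

theorem exists_metric_ne_zero (hn : 1 ≤ n) (P : PointedHypersurface n (𝓡 (n + 1)) (Sph n)) :
    ∃ X ∈ tangentAt (𝓡 (n + 1)) P.carrier P.pt, metric P.pt X X ≠ 0 := by
  obtain ⟨φ, f, h⟩ := P.isHypersurface P.pt P.pt_mem
  obtain ⟨X, hX, hXw⟩ := h.exists_diff_eq P.pt_mem (EuclideanSpace.single ⟨0, hn⟩ 1)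
  refine ⟨X, hX, fun h1 => ?_⟩
  rw [metric_eq, inner_self_eq_zero] at h1
  have h2 : X = 0 := diffCoe_injective _ (h1.trans (map_zero _).symm)
  rw [h2, map_zero] at hXw
  have h3 := congrFun (congrArg (fun z => (z.2).ofLp) hXw) ⟨0, hn⟩
  simp at h3

theorem exists_metricForm_ne_zero (hn : 1 ≤ n) (c : Jet n (𝓡 (n + 1)) (Sph n) 1) :
    ∃ X : Fin 2 → c.tangent, metricForm c.tangentPair.1 c.tangent X ≠ 0 := by
  obtain ⟨P⟩ := c
  obtain ⟨X, hX, h⟩ := exists_metric_ne_zero hn P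
  refine ⟨fun _ => ⟨X, hX⟩, ?_⟩
  rw [metricForm_apply]
  exact h

/-- The isomorphism `ν ↦ g⁰ ⊗ ν` of the normal space with the model line. -/
def metricTensorLinear (c : Jet n (𝓡 (n + 1)) (Sph n) 1) :
    c.normal →ₗ[ℝ] Jet.formLine metric c where
  toFun ν := ⟨metricTensor c ν, ν, metricTensor_apply c ν⟩
  map_add' ν μ := Subtype.ext <| Subtype.ext <| MultilinearMap.ext fun X =>
    smul_add (metricForm c.tangentPair.1 c.tangent X) ν μ
  map_smul' t ν := Subtype.ext <| Subtype.ext <| MultilinearMap.ext fun X =>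
    smul_comm (metricForm c.tangentPair.1 c.tangent X) t ν

/-- Injectivity needs g⁰ ≠ 0, which holds as the metric is definite and T_pS has dimension n ≥ 1;
surjectivity is the definition of the line. -/
theorem metricTensorLinear_bijective (hn : 1 ≤ n) (c : Jet n (𝓡 (n + 1)) (Sph n) 1) :
    Function.Bijective (metricTensorLinear c) := by
  constructor
  · rw [injective_iff_map_eq_zero]
    intro ν hν
    obtain ⟨X, hX⟩ := exists_metricForm_ne_zero hn c
    have h1 : (metricTensor c ν).1 X = 0 := by
      have h2 : metricTensor c ν = 0 := congrArg Subtype.val hν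
      rw [h2]
      rfl
    exact (smul_eq_zero.1 h1).resolve_left hX
  · rintro ⟨v, ν, hν⟩
    refine ⟨ν, Subtype.ext <| Subtype.ext <| MultilinearMap.ext fun X => ?_⟩
    exact (metricTensor_apply c ν X).trans (hν X).symm

theorem finrank_formLine (hn : 1 ≤ n) (c : Jet n (𝓡 (n + 1)) (Sph n) 1) :
    Module.finrank ℝ (Jet.formLine metric c) = 1 :=
  (LinearEquiv.ofBijective (metricTensorLinear c)
    (metricTensorLinear_bijective hn c)).finrank_eq.symm.trans (finrank_normal c)

end ConfSphere

/-! ### Umbilic fibres as affine lines. -/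

namespace ConfSphere

open HypJet

variable {n : ℕ} {h : IsHypersurface n (𝓡 (n + 1)) (equator n)}

/-- The vector N represents the normal ν. Applying du - df, which kills T_pS, to ξ ≡ g(X, X) N
identifies the change of second derivative as t g(X, X) with t = (du - df)(N). -/
theorem isUmbilicAt_of_isTranslate_aux {S S' : Set (Sph n)} {p : Sph n}
    {φ : CoordChart n (𝓡 (n + 1)) (Sph n)} {f g : EuclideanSpace ℝ (Fin n) → ℝ}
    (hf : IsGraphAt φ S f p) (hg : IsGraphAt φ S' g p) (hp : p ∈ S) (hp' : p ∈ S')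
    (hT : tangentAt (𝓡 (n + 1)) S p = tangentAt (𝓡 (n + 1)) S' p) (hS : IsUmbilicAt S p)
    (N : TangentSpace (𝓡 (n + 1)) p)
    (hD : ∀ X ∈ tangentAt (𝓡 (n + 1)) S p, ∃ ξ : TangentSpace (𝓡 (n + 1)) p,
      φ.diff p ξ = (iteratedFDeriv ℝ 2 g (φ p).2 (fun _ => (φ.diff p X).2) -
        iteratedFDeriv ℝ 2 f (φ p).2 (fun _ => (φ.diff p X).2), 0) ∧
      ξ - metric p X X • N ∈ tangentAt (𝓡 (n + 1)) S p) : IsUmbilicAt S' p := by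
  refine isUmbilicAt_of_sub_eq hf hg hp hp' (hf.fderiv_eq_of_tangentAt_eq hp hg hp' hT) hS
    (t := (φ.diff p N).1 - fderiv ℝ f (φ p).2 (φ.diff p N).2) fun w => ?_
  obtain ⟨X, hX, hXw⟩ := hg.exists_diff_eq hp' w
  have h1 := hg.fderiv_comp_graphMap_eq hp' (contMDiff_coe p) hX
  rw [hXw] at h1
  have h2 : ‖fderiv ℝ (((↑) : Sph n → EuclideanSpace ℝ (Fin (n + 2))) ∘ φ.graphMap g)
      (φ p).2 w‖ ^ 2 = metric p X X := by
    rw [h1, metric_eq]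
    exact (real_inner_self_eq_norm_sq _).symm
  obtain ⟨ξ, hξ, hξT⟩ := hD X (by rw [hT]; exact hX)
  rw [hXw] at hξ
  have h3 := hf.diff_eq_of_mem hp hξT
  rw [map_sub, map_smul, hξ] at h3
  have h4 := congrArg Prod.fst h3
  simp only [Prod.fst_sub, Prod.snd_sub, Prod.smul_fst, Prod.smul_snd, map_sub, map_smul, map_zero,
    smul_eq_mul] at h4
  rw [h2]
  linarith

theorem umbilicJet_of_isTranslate {a b : Jet n (𝓡 (n + 1)) (Sph n) 2} (ha : UmbilicJet a)
    {v : ((a.proj (Nat.sub_le 2 1)).proj (Nat.le_sub_one_of_lt (le_refl 2))).SymTensor 2}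
    (hv : v ∈ Jet.formLine metric
      ((a.proj (Nat.sub_le 2 1)).proj (Nat.le_sub_one_of_lt (le_refl 2))))
    (h : IsTranslate (le_refl 2) (a.proj (Nat.sub_le 2 1)) v a b) : UmbilicJet b := by
  obtain ⟨ν, hν⟩ := hv
  obtain ⟨-, hb, φ, y, z, ⟨P, f, rfl, hf, hy, hyk⟩, ⟨Q, g, rfl, hg, hz, hzk⟩, hX⟩ := h
  obtain ⟨S, p, hS, hp⟩ := P
  obtain ⟨S', p', hS', hp'⟩ := Q
  have hpair := eq_of_mk_one_eq (P := ⟨S', p', hS', hp'⟩) (Q := ⟨S, p, hS, hp⟩) hb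
  obtain rfl : p' = p := congrArg Sigma.fst hpair
  have hT : tangentAt (𝓡 (n + 1)) S' p' = tangentAt (𝓡 (n + 1)) S p' :=
    eq_of_heq (Sigma.mk.inj hpair).2
  obtain ⟨N, hN⟩ := Submodule.Quotient.mk_surjective _ ν
  refine isUmbilicAt_of_isTranslate_aux hf hg hp hp' hT.symm ha N fun X hXT => ?_
  obtain ⟨ξ, hξ, hξv⟩ := hX fun _ => ⟨X, hXT⟩
  refine ⟨ξ, ?_, ?_⟩
  · have h1 := hyk 2
    have h2 := hzk 2
    rw [hy] at h1
    rw [hz] at h2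
    refine Eq.trans hξ (Prod.ext ?_ rfl)
    change (z.2 2).1 _ - (y.2 2).1 _ = _
    rw [h1, h2]
    rfl
  · have h1 := hν fun _ => ⟨X, hXT⟩
    rw [hξv, ← hN] at h1
    exact (Submodule.Quotient.eq _).1 h1

/-- The normal vector is t ∂_u, with t the factor by which the second derivatives differ;
polarization passes from equal arguments to arbitrary pairs. -/
theorem exists_isTranslate_aux {S S' : Set (Sph n)} {p : Sph n}
    {φ : CoordChart n (𝓡 (n + 1)) (Sph n)} {f g : EuclideanSpace ℝ (Fin n) → ℝ}
    (hf : IsGraphAt φ S f p) (hg : IsGraphAt φ S' g p) (hp : p ∈ S) (hp' : p ∈ S')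
    (hT : tangentAt (𝓡 (n + 1)) S p = tangentAt (𝓡 (n + 1)) S' p) (hS : IsUmbilicAt S p)
    (hS' : IsUmbilicAt S' p) :
    ∃ N : TangentSpace (𝓡 (n + 1)) p, ∀ X : Fin 2 → TangentSpace (𝓡 (n + 1)) p,
      (∀ i, X i ∈ tangentAt (𝓡 (n + 1)) S p) →
      φ.diff p (metric p (X 0) (X 1) • N) =
        (iteratedFDeriv ℝ 2 g (φ p).2 (fun i => (φ.diff p (X i)).2) -
          iteratedFDeriv ℝ 2 f (φ p).2 (fun i => (φ.diff p (X i)).2), 0) := by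
  obtain ⟨t, ht⟩ := exists_sub_eq_of_isUmbilicAt hf hg hp hp'
    (hf.fderiv_eq_of_tangentAt_eq hp hg hp' hT) hS hS'
  obtain ⟨N, hN⟩ := φ.diff_surjective hf.mem_source (t, 0)
  refine ⟨N, fun X hX => ?_⟩
  set L := fderiv ℝ (((↑) : Sph n → EuclideanSpace ℝ (Fin (n + 2))) ∘ φ.graphMap g) (φ p).2
  have hL : ∀ i, L (φ.diff p (X i)).2 = diffCoe p (X i) := fun i =>
    hg.fderiv_comp_graphMap_eq hp' (contMDiff_coe p) (by rw [← hT]; exact hX i)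
  rw [map_smul, hN, metric_eq, ← hL, ← hL]
  have p1 := ContinuousMultilinearMap.polarization
    (fun σ v => iteratedFDeriv_two_comp_perm hg.contDiffAt le_rfl σ v)
    (fun i => (φ.diff p (X i)).2)
  have p2 := ContinuousMultilinearMap.polarization
    (fun σ v => iteratedFDeriv_two_comp_perm hf.contDiffAt le_rfl σ v)
    (fun i => (φ.diff p (X i)).2)
  refine Prod.ext ?_ (by simp)
  have t1 := ht ((φ.diff p (X 0)).2 + (φ.diff p (X 1)).2)
  have t2 := ht (φ.diff p (X 0)).2
  have t3 := ht (φ.diff p (X 1)).2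
  rw [map_add, norm_add_sq_real] at t1
  simp only [Prod.smul_fst, smul_eq_mul]
  linarith

theorem metricTensor_mem_formLine (c : Jet n (𝓡 (n + 1)) (Sph n) 1) (ν : c.normal) :
    metricTensor c ν ∈ Jet.formLine metric c :=
  ⟨ν, metricTensor_apply c ν⟩

theorem exists_isTranslate_mk {P Q : PointedHypersurface n (𝓡 (n + 1)) (Sph n)}
    {φ : CoordChart n (𝓡 (n + 1)) (Sph n)} {f g : EuclideanSpace ℝ (Fin n) → ℝ}
    (hf : IsGraphAt φ P.carrier f P.pt) (hg : IsGraphAt φ Q.carrier g Q.pt)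
    (h : (Jet.mk 2 Q).proj (Nat.sub_le 2 1) = (Jet.mk 2 P).proj (Nat.sub_le 2 1))
    (N : TangentSpace (𝓡 (n + 1)) P.pt)
    (hN : ∀ X : Fin 2 → TangentSpace (𝓡 (n + 1)) P.pt,
      (∀ i, X i ∈ tangentAt (𝓡 (n + 1)) P.carrier P.pt) →
      φ.diff P.pt (metric P.pt (X 0) (X 1) • N) =
        (iteratedFDeriv ℝ 2 g (φ Q.pt).2 (fun i => (φ.diff P.pt (X i)).2) -
          iteratedFDeriv ℝ 2 f (φ P.pt).2 (fun i => (φ.diff P.pt (X i)).2), 0)) :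
    ∃ ν, IsTranslate (le_refl 2) ((Jet.mk 2 P).proj (Nat.sub_le 2 1))
      (metricTensor (((Jet.mk 2 P).proj (Nat.sub_le 2 1)).proj
        (Nat.le_sub_one_of_lt (le_refl 2))) ν) (Jet.mk 2 P) (Jet.mk 2 Q) := by
  refine ⟨Submodule.Quotient.mk N, rfl, h, φ, _, _, hasCoord_jetCoord le_rfl hf, hasCoord_jetCoord le_rfl hg, fun X => ?_⟩
  refine ⟨metric P.pt (X 0).1 (X 1).1 • N, ?_, ?_⟩
  · exact hN (fun i => (X i).1) fun i => (X i).2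
  · exact metricTensor_apply _ _ X

/-- A translate must be exhibited in one chart adapted to both jets. The representative of a is
replaced by a hypersphere, whose height function becomes the first coordinate of a chart in which
the representative of b is also a graph. -/
theorem exists_isGraphAt_pair (hn : 1 ≤ n) {a b : Jet n (𝓡 (n + 1)) (Sph n) 2} (ha : UmbilicJet a)
    (hb : UmbilicJet b) (hab : b.proj (Nat.sub_le 2 1) = a.proj (Nat.sub_le 2 1)) :
    ∃ (P Q : PointedHypersurface n (𝓡 (n + 1)) (Sph n)) (φ : CoordChart n (𝓡 (n + 1)) (Sph n))
      (f g : EuclideanSpace ℝ (Fin n) → ℝ) (N : TangentSpace (𝓡 (n + 1)) P.pt),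
      Jet.mk 2 P = a ∧ Jet.mk 2 Q = b ∧ IsGraphAt φ P.carrier f P.pt ∧
      IsGraphAt φ Q.carrier g Q.pt ∧ ∀ X : Fin 2 → TangentSpace (𝓡 (n + 1)) P.pt,
        (∀ i, X i ∈ tangentAt (𝓡 (n + 1)) P.carrier P.pt) →
        φ.diff P.pt (metric P.pt (X 0) (X 1) • N) =
          (iteratedFDeriv ℝ 2 g (φ Q.pt).2 (fun i => (φ.diff P.pt (X i)).2) -
            iteratedFDeriv ℝ 2 f (φ P.pt).2 (fun i => (φ.diff P.pt (X i)).2), 0) := by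
  obtain ⟨P⟩ := a
  obtain ⟨⟨S', p', hS', hp'⟩⟩ := b
  obtain ⟨ε, r, hr, hp, h⟩ := exists_mk_pointedSlice_eq hn (P := P) ha
  have h1 : Jet.mk 1 P = Jet.mk 1 (pointedSlice hn hr hp) :=
    congrArg (Jet.proj (Nat.sub_le 2 1)) h
  have hpair := (eq_of_mk_one_eq (P := ⟨S', p', hS', hp'⟩) (Q := P) hab).trans (eq_of_mk_one_eq h1)
  have ha' : UmbilicJet (Jet.mk 2 (pointedSlice hn hr hp)) := h ▸ ha
  obtain ⟨S, p, hS, hpS⟩ := P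
  obtain rfl : p' = p := congrArg Sigma.fst hpair
  have hT : tangentAt (𝓡 (n + 1)) S' p' = tangentAt (𝓡 (n + 1)) (slice ε r) p' :=
    eq_of_heq (Sigma.mk.inj hpair).2
  obtain ⟨φ, f, hf⟩ := hS' p' hp'
  obtain ⟨ψ, -, hs, hg⟩ := hf.exists_chart hp' contMDiff_height (fun X hX => by
    rw [hT] at hX
    exact hX _ (contMDiff_height p') (Eventually.of_forall fun q hq => hq))
    (exists_mfderiv_height_ne_zero hr hp)
  obtain ⟨N, hN⟩ := exists_isTranslate_aux hs hg hp hp' hT.symm ha' hb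
  exact ⟨pointedSlice hn hr hp, ⟨S', p', hS', hp'⟩, ψ, _, _, N, h.symm, rfl, hs, hg, hN⟩

theorem exists_isTranslate_metricTensor (hn : 1 ≤ n) {a b : Jet n (𝓡 (n + 1)) (Sph n) 2}
    (ha : UmbilicJet a) (hb : UmbilicJet b)
    (hab : b.proj (Nat.sub_le 2 1) = a.proj (Nat.sub_le 2 1)) :
    ∃ ν : ((a.proj (Nat.sub_le 2 1)).proj (Nat.le_sub_one_of_lt (le_refl 2))).normal,
      IsTranslate (le_refl 2) (a.proj (Nat.sub_le 2 1)) (metricTensor _ ν) a b := by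
  obtain ⟨P, Q, φ, f, g, N, rfl, rfl, hf, hg, hN⟩ := exists_isGraphAt_pair hn ha hb hab
  exact exists_isTranslate_mk hf hg hab N hN

theorem exists_isTranslate (hn : 1 ≤ n) {a b : Jet n (𝓡 (n + 1)) (Sph n) 2} (ha : UmbilicJet a)
    (hb : UmbilicJet b) (hab : b.proj (Nat.sub_le 2 1) = a.proj (Nat.sub_le 2 1)) :
    ∃ v : ((a.proj (Nat.sub_le 2 1)).proj (Nat.le_sub_one_of_lt (le_refl 2))).SymTensor 2,
      v ∈ Jet.formLine metric
        ((a.proj (Nat.sub_le 2 1)).proj (Nat.le_sub_one_of_lt (le_refl 2))) ∧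
      IsTranslate (le_refl 2) (a.proj (Nat.sub_le 2 1)) v a b :=
  (exists_isTranslate_metricTensor hn ha hb hab).elim fun ν h =>
    Exists.intro (metricTensor _ ν) (And.intro (metricTensor_mem_formLine _ ν) h)

end ConfSphere

/-! ### The sub-bundle structure and properness. -/

theorem MulAction.smul_mem_orbit_iff {G X : Type*} [Group G] [MulAction G X] {g : G} {x y : X} :
    g • x ∈ orbit G y ↔ x ∈ orbit G y :=
  ⟨fun h => by simpa using mem_orbit_of_mem_orbit g⁻¹ h, mem_orbit_of_mem_orbit g⟩

theorem HypJet.SymForm.linearIndependent_fin_one {n k : ℕ} {x : SymForm n k} (hx : x ≠ 0) :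
    LinearIndependent ℝ fun _ : Fin 1 => x := by
  refine LinearIndependent.of_comp (SymForm n k).subtype ?_
  have h : x.1 ≠ 0 := fun h => hx (Subtype.ext h)
  exact LinearIndependent.of_subsingleton 0 h

theorem HypJet.SymForm.exists_eq_smul_iff {n k : ℕ} {x y : SymForm n k} :
    (∃ t : ℝ, x = t • y) ↔ ∃ t : Fin 1 → ℝ, x = 0 + ∑ i, t i • y :=
  ⟨fun ⟨t, ht⟩ => ⟨fun _ => t, by simpa using ht⟩, fun ⟨t, ht⟩ => ⟨t 0, by simpa using ht⟩⟩

namespace ConfSphere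

open HypJet

variable {n : ℕ} {h : IsHypersurface n (𝓡 (n + 1)) (equator n)}

theorem mem_orbit_two_and_proj_eq_iff (hn : 1 ≤ n) {a : Jet n (𝓡 (n + 1)) (Sph n) 2}
    (ha : a ∈ MulAction.orbit (SO n) (Jet.mk 2 (pointedEquator n h)))
    (b : Jet n (𝓡 (n + 1)) (Sph n) 2) :
    (b ∈ MulAction.orbit (SO n) (Jet.mk 2 (pointedEquator n h)) ∧
      b.proj (Nat.sub_le 2 1) = a.proj (Nat.sub_le 2 1)) ↔
    ∃ v : ((a.proj (Nat.sub_le 2 1)).proj (Nat.le_sub_one_of_lt (le_refl 2))).SymTensor 2,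
      v ∈ Jet.formLine metric
        ((a.proj (Nat.sub_le 2 1)).proj (Nat.le_sub_one_of_lt (le_refl 2))) ∧
      IsTranslate (le_refl 2) (a.proj (Nat.sub_le 2 1)) v a b :=
  have hu := (mem_orbit_two_iff hn a).1 ha
  ⟨fun hb => exists_isTranslate hn hu ((mem_orbit_two_iff hn b).1 hb.1) hb.2,
    fun hv => hv.elim fun _ hv =>
      ⟨(mem_orbit_two_iff hn b).2 (umbilicJet_of_isTranslate hu hv.1 hv.2), hv.2.2.1⟩⟩

/-- The orbit is invariant, so the jet may be moved back to the stereographic chart without changing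
its coordinates. -/
theorem mem_orbit_two_iff_of_hasCoord (hn : 1 ≤ n) {v : Sph n} {A g : SO n}
    {b : Jet n (𝓡 (n + 1)) (Sph n) 2} {z : JetCoord n 2}
    (hb : b.HasCoord (((stereoChart v).translate A).translate g) z) :
    b ∈ MulAction.orbit (SO n) (Jet.mk 2 (pointedEquator n h)) ↔
      ∃ t : ℝ, z.top = t • graphForm (z.trunc one_le_two) := by
  rw [← MulAction.smul_mem_orbit_iff (g := g⁻¹), ← MulAction.smul_mem_orbit_iff (g := A⁻¹),
    mem_orbit_two_iff hn]
  exact umbilicJet_iff_of_hasCoord hb.of_translate.of_translate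

theorem exists_hasCoord (hn : 1 ≤ n) (c : Jet n (𝓡 (n + 1)) (Sph n) 1) :
    ∃ (v : Sph n) (A g : SO n) (y : JetCoord n 1),
      c.HasCoord (((stereoChart v).translate A).translate g) y := by
  have h := isHypersurface_equator hn
  obtain ⟨v, A, f, hf⟩ := exists_isGraphAt_equator hn
  have hc : c ∈ MulAction.orbit (SO n) (Jet.mk 1 (pointedEquator n h)) :=
    (orbit_one_eq_univ hn).symm ▸ Set.mem_univ c
  obtain ⟨g, rfl⟩ := hc
  exact ⟨v, A, g, _, (hasCoord_jetCoord one_le_two (P := pointedEquator n h) hf).translate g⟩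

/-- The reference section is 0, because hyperplanes of a stereographic chart are hyperspheres; the
frame is δ_ij + u_i u_j, defined for all coordinate values. -/
theorem exists_frame (hn : 1 ≤ n) (c : Jet n (𝓡 (n + 1)) (Sph n) 1) :
    ∃ (φ : CoordChart n (𝓡 (n + 1)) (Sph n)) (O : Set (JetCoord n 1))
      (s : JetCoord n 1 → SymForm n 2) (r : Fin 1 → JetCoord n 1 → SymForm n 2),
      (∃ y ∈ O, c.HasCoord φ y) ∧ IsOpen O ∧ ContDiffOn ℝ ∞ s O ∧
      (∀ i, ContDiffOn ℝ ∞ (r i) O) ∧ (∀ y ∈ O, LinearIndependent ℝ (fun i => r i y)) ∧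
      ∀ (b : Jet n (𝓡 (n + 1)) (Sph n) 2) (z : JetCoord n 2), b.HasCoord φ z →
        z.trunc (Nat.sub_le 2 1) ∈ O →
        (b ∈ MulAction.orbit (SO n) (Jet.mk 2 (pointedEquator n h)) ↔
          ∃ t : Fin 1 → ℝ, z.top = s (z.trunc (Nat.sub_le 2 1)) +
            ∑ i, t i • r i (z.trunc (Nat.sub_le 2 1))) :=
  (exists_hasCoord hn c).elim fun v hv => hv.elim fun A hA => hA.elim fun g hg =>
    hg.elim fun y hy =>
  ⟨((stereoChart v).translate A).translate g, Set.univ, fun _ => 0, fun _ => graphForm,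
    ⟨y, Set.mem_univ _, hy⟩, isOpen_univ, contDiffOn_const,
    fun _ => contDiff_graphForm.contDiffOn,
    fun y _ => SymForm.linearIndependent_fin_one (graphForm_ne_zero hn y),
    fun _ _ hb _ => (mem_orbit_two_iff_of_hasCoord hn hb).trans SymForm.exists_eq_smul_iff⟩

theorem isAffineSubbundle (hn : 1 ≤ n) :
    IsAffineSubbundle (le_refl 2)
      (MulAction.orbit (SO n) (Jet.mk (2 - 1) (pointedEquator n h)))
      (MulAction.orbit (SO n) (Jet.mk 2 (pointedEquator n h))) 1
      (fun c => Jet.formLine metric (c.proj (Nat.le_sub_one_of_lt (le_refl 2)))) where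
  isOpen_base := by
    have h1 := orbit_one_eq_univ hn (h := h)
    exact h1 ▸ isOpen_univ
  proj_mem _ _ := (orbit_one_eq_univ hn (h := h)).symm ▸ Set.mem_univ _
  exists_mem := by
    rintro _ ⟨g, rfl⟩
    exact ⟨g • Jet.mk 2 (pointedEquator n h), ⟨g, rfl⟩, rfl⟩
  mem_iff _ ha b := mem_orbit_two_and_proj_eq_iff hn ha b
  finrank_eq c _ := finrank_formLine hn (c.proj (Nat.le_sub_one_of_lt (le_refl 2)))
  smooth c _ := exists_frame hn c

/-- A non-umbilic graph. -/
theorem exists_not_isUmbilicAt (hn : 2 ≤ n) :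
    ∃ P : PointedHypersurface n (𝓡 (n + 1)) (Sph n), ¬ IsUmbilicAt P.carrier P.pt := by
  let v := origin n
  let i : Fin n := ⟨0, by omega⟩
  let j : Fin n := ⟨1, by omega⟩
  have hij : i ≠ j := by simp [i, j, Fin.ext_iff]
  -- At 0 the gradient vanishes and the Hessian is 2 (dx^i)². Were it t times the Euclidean form,
  -- the directions i and j would give t = 2 and t = 0.
  have hf : ContDiff ℝ ∞ fun y : EuclideanSpace ℝ (Fin n) => y i ^ 2 := by fun_prop
  have hp := stereoChart_symm_mem_source v 0
  have hz := stereoChart_apply_symm v 0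
  have hpf : (stereoChart v ((stereoChart v).symm 0)).1 =
      (stereoChart v ((stereoChart v).symm 0)).2 i ^ 2 := by
    rw [hz]
    simp
  refine ⟨graphHypersurface _ hf hp hpf, fun hu => ?_⟩
  obtain ⟨t, ht⟩ := (isUmbilicAt_stereoChart_iff (isGraphAt_graphHypersurface _ hf hp hpf)
    (graphHypersurface _ hf hp hpf).pt_mem).1 hu
  obtain ⟨-, h1, h2⟩ := hf.contDiffAt.jet_of_isLittleO (y₀ := 0) (c := 0) (ℓ := 0)
    (q := fun w => 2 * w i ^ 2) (fun t w => by simp) (fun t w => by simp; ring)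
    (by simp)
  have h4 : ∀ w : EuclideanSpace ℝ (Fin n), 2 * w i ^ 2 = t * ‖w‖ ^ 2 := by
    intro w
    have := ht w
    change iteratedFDeriv ℝ 2 _ (stereoChart v ((stereoChart v).symm 0)).2 _ =
      t * (_ + fderiv ℝ _ (stereoChart v ((stereoChart v).symm 0)).2 w ^ 2) at this
    rw [hz, Prod.snd_zero, h2, h1] at this
    simpa using this
  have h5 := h4 (EuclideanSpace.single i 1)
  have h6 := h4 (EuclideanSpace.single j 1)
  simp [hij] at h5 h6
  linarith

/-- One non-umbilic jet suffices: the group acts transitively on 1-jets and preserves the orbit, so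
the jet can be carried over any 1-jet. -/
theorem exists_proj_eq_not_mem_orbit (hn : 2 ≤ n) (c : Jet n (𝓡 (n + 1)) (Sph n) 1) :
    ∃ b : Jet n (𝓡 (n + 1)) (Sph n) 2, b.proj one_le_two = c ∧
      b ∉ MulAction.orbit (SO n) (Jet.mk 2 (pointedEquator n h)) := by
  have hn1 : 1 ≤ n := one_le_two.trans hn
  obtain ⟨P, hP⟩ := exists_not_isUmbilicAt hn
  have key : ∀ c : Jet n (𝓡 (n + 1)) (Sph n) 1,
      c ∈ MulAction.orbit (SO n) (Jet.mk 1 (pointedEquator n h)) := fun c => by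
    rw [orbit_one_eq_univ hn1]
    trivial
  obtain ⟨g, hg⟩ : c ∈ MulAction.orbit (SO n) (Jet.mk 1 P) := by
    rw [MulAction.orbit_eq_iff.2 (key (Jet.mk 1 P))]
    exact key c
  refine ⟨g • Jet.mk 2 P, hg, fun h1 => hP ?_⟩
  exact (mem_orbit_two_iff hn1 (Jet.mk 2 P)).1 (MulAction.smul_mem_orbit_iff.1 h1)

end ConfSphere

end

theorem mainTheorem7 (n : ℕ) (hn : 1 ≤ n) :
    ∃ h : HypJet.IsHypersurface n (𝓡 (n + 1)) (ConfSphere.equator n),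
      (2 ≤ n → HypJet.IsFiducial (ConfSphere.SO n) 2 (ConfSphere.pointedEquator n h)) ∧
      HypJet.IsAffineSubbundle (le_refl 2)
        (MulAction.orbit (ConfSphere.SO n) (HypJet.Jet.mk (2 - 1) (ConfSphere.pointedEquator n h)))
        (MulAction.orbit (ConfSphere.SO n) (HypJet.Jet.mk 2 (ConfSphere.pointedEquator n h)))
        1
        (fun c => HypJet.Jet.formLine ConfSphere.metric (c.proj (Nat.le_sub_one_of_lt (le_refl 2)))) := by
  have h := ConfSphere.isHypersurface_equator hn
  have hA := ConfSphere.isAffineSubbundle hn (h := h)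
  exact ⟨h, fun h2 => ⟨ConfSphere.isPretransitive hn, le_rfl, hA.isOpen_base, ⟨1, _, hA⟩,
    fun c _ => ConfSphere.exists_proj_eq_not_mem_orbit h2 c⟩, hA⟩
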